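/- **Theorem (Tower Paradigm).** *Conventions.* Simplicial complexes are finite and contain the empty face; $X(i)$ is the set of $i$-dimensional faces ($X(-1)=\{\emptyset\}$), and $X_z=\{x-z : z\subseteq x\in X\}$ is the link of $X$ at $z\in X$. A *$d$-complex* is a complex all of whose faces lie in $d$-faces; its canonical weight is $w(x)=\binom{d+1}{i+1}^{-1}|X(d)|^{-1}\,|\{y\in X(d): y\supseteq x\}|$ for $x\in X(i)$. It is *strongly connected* if $X_z$ is connected for every face $z$ of dimension $\le d-2$ (including $z=\emptyset$). A covering $f:Y\to X$ is a simplicial map, onto on vertices, that maps the faces containing $v$ bijectively onto the faces containing $f(v)$, for every vertex $v$ of $Y$; it is *$G$-Galois* if $G$ acts on $Y$ by automorphisms over $X$, simply transitively on the fibre of every nonempty face of $X$. An augmented $\mathbb F$-sheaf $\mathcal F$ on $X$ assigns to each face $x$ a finite-dimensional $\mathbb F$-vector space $\mathcal F(x)$ and to each pair of faces $x\subseteq y$ a linear map $\mathrm{res}_{y\leftarrow x}:\mathcal F(x)\to\mathcal F(y)$, functorially; it is a *sheaf* if $\mathcal F(\emptyset)=0$. Pullback is $(u^*\mathcal F)(y)=\mathcal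 F(u(y))$, and $\mathcal F_z(x)=\mathcal F(x\cup z)$ is the induced augmented sheaf on $X_z$. After ordering the vertices, $C^i=\prod_{x\in X(i)}\mathcal F(x)$, $(d_if)(y)=\sum_{x\subset y}[y:x]\,\mathrm{res}_{y\leftarrow x}f(x)$ with the usual incidence signs, $Z^i=\ker d_i$, $B^i=\operatorname{im}d_{i-1}$ (with $B^{-1}=0$), and $h^i=\dim_{\mathbb F}Z^i/B^i$. For a $d$-complex put $\|f\|=\sum_{x\in X(i):\, f(x)\ne0}w(x)$ for $f\in C^i$ and $m(i)=\sum_{x\in X(i):\,\mathcal F(x)\neq 0}w(x)$. The pair $(X,\mathcal F)$ is an *$\varepsilon$-coboundary expander in dimension $i$* if $\|d_if\|\,m(i)\ge\varepsilon\,m(i+1)\,\min_{b\in B^i}\|f+b\|$ for all $f\in C^i$; it is a *$j$-local $\varepsilon$-coboundary expander in dimension $i$* if $(X_z,\mathcal F_z)$ is an $\varepsilon$-coboundary expander in dimension $i-j-1$ for all $z\in X(j)$. A $d$-complex with $d\ge 1$ is a *$[-1,\lambda]$-spectral expander* if all eigenvalues of the operator $(\mathcal Af)(x)=\sum_{e\in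 X(1),\,e\supseteq x}\frac{w(e)}{2w(x)}f(e-x)$ on $\{f:X(0)\to\mathbb R : \sum_x w(x)f(x)=0\}$ lie in $[-1,\lambda]$. *Setting.* Let $p$ be a prime, $\mathbb F$ a finite field of characteristic $p$, $k\ge 0$, $d\ge k+2$, $m\geq 1$. Let $X$ be a strongly connected $d$-complex and $\mathcal F$ an $\mathbb F$-sheaf on $X$ such that $\mathcal F(x)=\mathbb F^m=:\Sigma$ for all $x\in X(k)$, $\mathcal F(x)\ne0$ for all $x\in X(k+1)\cup X(k+2)$, and $B^k(X,\mathcal F)=0$ (which is automatic if $k=0$). Assume * **(t1)** $X$ has an infinite tower of connected coverings $\cdots\to X_2\to X_1\to X_0=X$ in which every $X_{r+1}\to X_r$ is $C_p$-Galois ($C_p$ being the cyclic group of order $p$). Let $u_r:X_r\to X$ be the composition and $\mathcal F_r=u_r^*\mathcal F$. View $Z_r=Z^k(X_r,\mathcal F_r)$ as a code inside $C^k(X_r,\mathcal F_r)=\Sigma^{X_r(k)}$, of length $n_r=|X_r(k)|$, and let $\Phi_r$ be its natural tester: given $f$, choose $y\in X_r(k+1)$ uniformly at random, query the letters of $f$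 at the $k$-faces of $y$, and accept iff $(d_kf)(y)=0$. Consider also the conditions * **(t2)** There are positive reals $\varepsilon_0,\dots,\varepsilon_k,\varepsilon_0',\dots,\varepsilon'_{k+1},\lambda$ such that, with $\varepsilon=\min_{0\le i\le k}\frac{(k+2)\varepsilon_i}{k+1-i}$ and $\varepsilon'=\min_{0\le i\le k+1}\frac{(k+3)\varepsilon'_i}{k+2-i}$, $$\lambda\le\tfrac1d\min\Big\{\Big(\tfrac{\varepsilon}{(k+1)^22^{2k+6}}\Big)^{2^k},\Big(\tfrac{\varepsilon'}{(k+2)^22^{2k+8}}\Big)^{2^{k+1}},1\Big\},$$ and such that $(X,\mathcal F)$ is an $i$-local $\varepsilon_i$-coboundary expander in dimension $k$ for $0\le i\le k$ and an $i$-local $\varepsilon_i'$-coboundary expander in dimension $k+1$ for $0\le i\le k+1$, and $X_z$ is a $[-1,\lambda]$-spectral expander for every $z\in X(d-2)$. * **(t3)** $h^k(X,\mathcal F)>h^{k+1}(X,\mathcal F)$. *Conclusions.* 1. If (t1) and (t2) hold, then $\{(Z_r,\Sigma^{X_r(k)},\Phi_r)\}_{r\ge0}$ is a family of $(k+2)$-query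 locally testable codes with linear distance and linear-time decoding. That is, there are $\mu,\delta,\eta>0$ such that for all $r$: $\Phi_r$ makes at most $k+2$ queries, always accepts words of $Z_r$, and rejects each $f\notin Z_r$ with probability at least $\mu\cdot d_{\mathrm{Ham}}(f,Z_r)$ (normalized Hamming distance); any two distinct words of $Z_r$ are at normalized distance at least $\delta$; and some algorithm taking $O(n_r)$ steps returns $g$ when given any word $f\in\Sigma^{X_r(k)}$ with $d_{\mathrm{Ham}}(f,g)<\eta$ for a codeword $g\in Z_r$. Here $p,\mathbb F,X,\mathcal F$ and the tower are fixed, the implied constants do not depend on $r$ or $f$, and time is counted on a unit-cost random access machine whose words are numbers bounded by $O(n_r)$; one program serves all $r$, and it knows the code through a table of $O(n_r)$ words that is fixed before $f$ is given. 2. If (t1) and (t3) hold, then the codes have constant rate: there is $\rho>0$ with $\log_{|\Sigma|}|Z_r|\ge\rho\, n_r$ for all $r$. In particular, if (t1), (t2) and (t3) all hold, the codes form a family of $(k+2)$-query locally testable codes ($2$-query if $k=0$) with linear distance, constant rate and linear-time decoding. -/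

import Mathlib

open scoped BigOperators

noncomputable section

/-! ## Simplicial complexes -/

/-- A finite simplicial complex with vertices in `V`.  The empty face (of dimension `-1`) is
always a face.  The vertex set is the set of all `v` such that `{v}` is a face, so links live in
the same ambient type. -/
structure SComplex (V : Type*) where
  faces : Finset (Finset V)
  empty_mem : ∅ ∈ faces
  down_closed : ∀ {s t : Finset V}, s ∈ faces → t ⊆ s → t ∈ faces

namespace SComplex

variable {V : Type*} [LinearOrder V]

/-- The faces of `X` (the empty one included), partially ordered by inclusion. -/
abbrev Face (X : SComplex V) : Type _ := {x : Finset V // x ∈ X.faces}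

/-- The faces with exactly `n` vertices, i.e. the faces of dimension `n - 1`. -/
abbrev CardFace (X : SComplex V) (n : ℕ) : Type _ := {x : X.Face // x.1.card = n}

/-- The empty face. -/
def emptyFace (X : SComplex V) : X.Face := ⟨∅, X.empty_mem⟩

/-- `X` is a `d`-complex: pure of dimension `d`. -/
def IsPure (X : SComplex V) (d : ℕ) : Prop :=
  ∀ x ∈ X.faces, ∃ y ∈ X.faces, x ⊆ y ∧ y.card = d + 1

/-- The canonical weight of a face `x` of a `d`-complex: for `x` of dimension `k = |x| - 1` it is
`|X(d)_{⊇ x}| / (binom (d+1) (k+1) * |X(d)|)`. -/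
def weight (X : SComplex V) (d : ℕ) (x : Finset V) : ℝ :=
  ((X.faces.filter fun y => y.card = d + 1 ∧ x ⊆ y).card : ℝ) /
    (((d + 1).choose x.card : ℝ) * ((X.faces.filter fun y => y.card = d + 1).card : ℝ))

/-- The link of `X` at the face `z`. -/
def link (X : SComplex V) (z : X.Face) : SComplex V where
  faces := X.faces.filter fun x => Disjoint x z.1 ∧ x ∪ z.1 ∈ X.faces
  empty_mem := by
    simp only [Finset.mem_filter, Finset.disjoint_empty_left, Finset.empty_union, true_and]
    exact ⟨X.empty_mem, z.2⟩
  down_closed := by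
    intro s t hs hts
    simp only [Finset.mem_filter] at hs ⊢
    exact ⟨X.down_closed hs.1 hts, hs.2.1.mono_left hts,
      X.down_closed hs.2.2 (Finset.union_subset_union_left hts)⟩

/-- The underlying graph of `X`, on the set of `0`-faces. -/
def graph (X : SComplex V) : SimpleGraph (X.CardFace 1) where
  Adj x y := x ≠ y ∧ x.1.1 ∪ y.1.1 ∈ X.faces
  symm := ⟨fun x y h => ⟨h.1.symm, by rw [Finset.union_comm]; exact h.2⟩⟩
  loopless := ⟨fun _ h => h.1 rfl⟩

/-- `X` is connected: its underlying graph is connected. -/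
def IsConnected (X : SComplex V) : Prop := X.graph.Connected

/-- A `d`-complex is strongly connected if all its links of dimension at least `1`, namely those
at the faces of dimension at most `d - 2` (including the empty face), are connected. -/
def IsStronglyConnected (X : SComplex V) (d : ℕ) : Prop :=
  ∀ z : X.Face, z.1.card + 1 ≤ d → (X.link z).IsConnected

open scoped Classical in
/-- The weighted adjacency operator of a `d`-complex:
`(A f)(x) = ∑_{e ∈ X(1), e ⊇ x} w(e) / (2 w(x)) f(e - x)`. -/
def adjacency (X : SComplex V) (d : ℕ) (f : X.CardFace 1 → ℝ) (x : X.CardFace 1) : ℝ :=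
  ∑ y : X.CardFace 1, if X.graph.Adj x y then
    X.weight d (x.1.1 ∪ y.1.1) / (2 * X.weight d x.1.1) * f y else 0

/-- The underlying weighted graph of the `d`-complex `X` is a spectral `I`-expander: every
eigenvalue of the weighted adjacency operator on the orthogonal complement of the constant
functions (with respect to the weights `w`) is in `I`. -/
def IsSpectralExpander (X : SComplex V) (d : ℕ) (I : Set ℝ) : Prop :=
  ∀ (μ : ℝ) (f : X.CardFace 1 → ℝ), f ≠ 0 → ∑ x, X.weight d x.1.1 * f x = 0 →
    X.adjacency d f = μ • f → μ ∈ I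

/-- Every link of `X` at a `(d-2)`-face (such a link is a `1`-complex) is a spectral
`I`-expander; here `d ≥ 2`. -/
def IsCodimTwoSpectralExpander (X : SComplex V) (d : ℕ) (I : Set ℝ) : Prop :=
  ∀ z : X.Face, z.1.card = d - 1 → (X.link z).IsSpectralExpander 1 I

end SComplex

/-! ## Morphisms and coverings -/

/-- A morphism of simplicial complexes (its values on non-vertices are irrelevant). -/
structure SMap {W V : Type*} [LinearOrder W] [LinearOrder V] (Y : SComplex W) (X : SComplex V) where
  toFun : W → V
  map_mem : ∀ y ∈ Y.faces, y.image toFun ∈ X.faces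

namespace SMap

variable {U W V : Type*} [LinearOrder U] [LinearOrder W] [LinearOrder V]
variable {Z : SComplex U} {Y : SComplex W} {X : SComplex V}

/-- The map induced on faces. -/
def face (u : SMap Y X) (y : Y.Face) : X.Face := ⟨y.1.image u.toFun, u.map_mem y.1 y.2⟩

theorem face_mono (u : SMap Y X) {y y' : Y.Face} (h : y ≤ y') : u.face y ≤ u.face y' :=
  Finset.image_subset_image (f := u.toFun) h

/-- The identity morphism. -/
def id (X : SComplex V) : SMap X X where
  toFun := fun v => v
  map_mem := by intro y hy; simpa using hy

/-- Composition of morphisms. -/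
def comp (u : SMap Y X) (v : SMap Z Y) : SMap Z X where
  toFun := fun z => u.toFun (v.toFun z)
  map_mem := by
    intro z hz
    have := u.map_mem _ (v.map_mem z hz)
    rwa [Finset.image_image] at this

/-- A morphism is dimension preserving if it does not change the number of vertices of faces. -/
def DimPreserving (u : SMap Y X) : Prop := ∀ y : Y.Face, (u.face y).1.card = y.1.card

/-- A covering map: onto, and inducing a bijection from the faces containing a vertex `v` to the
faces containing its image. -/
def IsCovering (u : SMap Y X) : Prop :=
  (∀ v : V, {v} ∈ X.faces → ∃ w : W, {w} ∈ Y.faces ∧ u.toFun w = v) ∧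
  ∀ w : W, {w} ∈ Y.faces →
    Set.BijOn (fun y : Finset W => y.image u.toFun)
      {y | y ∈ Y.faces ∧ w ∈ y} {x | x ∈ X.faces ∧ u.toFun w ∈ x}

/-- A `G`-Galois covering: a covering map together with an action of `G` by automorphisms of `Y`
over `X` which is simply transitive on the fibre of every nonempty face of `X`. -/
def IsGalois (G : Type*) [Group G] (u : SMap Y X) : Prop :=
  u.IsCovering ∧ ∃ ρ : G →* Equiv.Perm W,
    (∀ g, ∀ y ∈ Y.faces, y.image (ρ g) ∈ Y.faces) ∧
    (∀ g, ∀ y ∈ Y.faces, (y.image (ρ g)).image u.toFun = y.image u.toFun) ∧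
    ∀ y ∈ Y.faces, ∀ y' ∈ Y.faces, y.Nonempty → y.image u.toFun = y'.image u.toFun →
      ∃! g, y.image (ρ g) = y'

theorem IsCovering.dimPreserving {u : SMap Y X} (hu : u.IsCovering) : u.DimPreserving := by
  intro y
  refine Finset.card_image_of_injOn ?_
  intro a ha b hb hab
  have ha1 : ({a} : Finset W) ∈ Y.faces := Y.down_closed y.2 (by simpa using ha)
  have hab1 : ({a, b} : Finset W) ∈ Y.faces :=
    Y.down_closed y.2 (by
      intro c hc
      rcases Finset.mem_insert.1 hc with rfl | hc
      · exact ha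
      · rw [Finset.mem_singleton.1 hc]; exact hb)
  have key : ({a} : Finset W) = {a, b} :=
    (hu.2 a ha1).injOn ⟨ha1, by simp⟩ ⟨hab1, by simp⟩ (by simp [Finset.image_insert, hab])
  have hb' : b ∈ ({a} : Finset W) := by rw [key]; simp
  exact (Finset.mem_singleton.1 hb').symm

theorem dimPreserving_id : (SMap.id X).DimPreserving := by
  intro y; simp [face, SMap.id]

theorem DimPreserving.comp {u : SMap Y X} {v : SMap Z Y} (hu : u.DimPreserving)
    (hv : v.DimPreserving) : (u.comp v).DimPreserving := by
  intro z
  have h : (u.comp v).face z = u.face (v.face z) := by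
    apply Subtype.ext
    simp [face, SMap.comp, Finset.image_image, Function.comp_def]
  rw [h, hu, hv]

end SMap

section Tower

variable {V : ℕ → Type*} [∀ r, LinearOrder (V r)] {X : ∀ r, SComplex (V r)}

/-- The composition `X r → X (r-1) → ⋯ → X 0`. -/
def towerMap (u : ∀ r, SMap (X (r + 1)) (X r)) : ∀ r, SMap (X r) (X 0)
  | 0 => SMap.id (X 0)
  | r + 1 => (towerMap u r).comp (u r)

theorem towerMap_dimPreserving {u : ∀ r, SMap (X (r + 1)) (X r)}
    (hu : ∀ r, (u r).IsCovering) : ∀ r, (towerMap u r).DimPreserving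
  | 0 => SMap.dimPreserving_id
  | r + 1 => (towerMap_dimPreserving hu r).comp (hu r).dimPreserving

end Tower

/-! ## Sheaves on simplicial complexes and their cohomology -/

/-- An augmented sheaf of `𝔽`-vector spaces on `X`.  A sheaf is an augmented sheaf whose space of
sections on the empty face is zero. -/
structure AugSheaf (𝔽 : Type*) [Field 𝔽] {V : Type*} [LinearOrder V] (X : SComplex V) where
  obj : X.Face → Type*
  [addCommGroup : ∀ x, AddCommGroup (obj x)]
  [module : ∀ x, Module 𝔽 (obj x)]
  res : ∀ {x y : X.Face}, x ≤ y → (obj x →ₗ[𝔽] obj y)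
  res_refl : ∀ (x : X.Face) (f : obj x), res (le_refl x) f = f
  res_res : ∀ {x y z : X.Face} (hxy : x ≤ y) (hyz : y ≤ z) (f : obj x),
    res hyz (res hxy f) = res (hxy.trans hyz) f

attribute [instance] AugSheaf.addCommGroup AugSheaf.module

namespace AugSheaf

variable {𝔽 : Type*} [Field 𝔽] {W V : Type*} [LinearOrder W] [LinearOrder V]
variable {Y : SComplex W} {X : SComplex V}

/-- An (unaugmented) sheaf: no nonzero sections on the empty face. -/
def IsSheaf (F : AugSheaf 𝔽 X) : Prop := Subsingleton (F.obj X.emptyFace)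

/-- The pullback of a sheaf along a morphism of simplicial complexes. -/
def pullback (F : AugSheaf 𝔽 X) (u : SMap Y X) : AugSheaf 𝔽 Y where
  obj y := F.obj (u.face y)
  res h := F.res (u.face_mono h)
  res_refl y f := F.res_refl (u.face y) f
  res_res hxy hyz f := F.res_res (u.face_mono hxy) (u.face_mono hyz) f

/-- The face `x ∪ z` of `X` for a face `x` of the link at `z`. -/
def linkFace (z : X.Face) (x : (X.link z).Face) : X.Face :=
  ⟨x.1 ∪ z.1, (Finset.mem_filter.1 x.2).2.2⟩

theorem linkFace_mono (z : X.Face) {x y : (X.link z).Face} (h : x ≤ y) :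
    linkFace z x ≤ linkFace z y :=
  Finset.union_subset_union_left (t := z.1) h

/-- The restriction `F_z` of an augmented sheaf to the link at `z`: `F_z(x) = F(x ∪ z)`. -/
def link (F : AugSheaf 𝔽 X) (z : X.Face) : AugSheaf 𝔽 (X.link z) where
  obj x := F.obj (linkFace z x)
  res h := F.res (linkFace_mono z h)
  res_refl x f := F.res_refl (linkFace z x) f
  res_res hxy hyz f := F.res_res (linkFace_mono z hxy) (linkFace_mono z hyz) f

/-- The cochains of degree `n - 1`, as families of sections indexed by the faces with `n`
vertices (each ordered by the linear order on the vertices). -/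
abbrev Cochain (F : AugSheaf 𝔽 X) (n : ℕ) : Type _ := (x : X.CardFace n) → F.obj x.1

/-- The sign `[y : x]`, which is `(-1)^i` if `x` is obtained from the ordered face
`y = (v_0 < ⋯ < v_n)` by removing `v_i`. -/
def incidenceSign (y x : Finset V) : ℤ :=
  (-1) ^ (y.filter fun a => ∃ b ∈ y \ x, a < b).card

/-- The coboundary map from degree `n - 1` to degree `n`:
`(d f)(y) = ∑_{x ⊂ y} [y : x] res_{y ← x} f(x)`. -/
def coboundary (F : AugSheaf 𝔽 X) (n : ℕ) : F.Cochain n →ₗ[𝔽] F.Cochain (n + 1) :=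
  LinearMap.pi fun y => ∑ x : {x : X.CardFace n // x.1 ≤ y.1},
    ((incidenceSign y.1.1 x.1.1.1 : ℤ) : 𝔽) • (F.res x.2 ∘ₗ LinearMap.proj x.1)

/-- The cocycles of degree `n - 1`. -/
def cocycles (F : AugSheaf 𝔽 X) (n : ℕ) : Submodule 𝔽 (F.Cochain n) :=
  LinearMap.ker (F.coboundary n)

/-- The coboundaries of degree `n - 1`. -/
def coboundaries (F : AugSheaf 𝔽 X) : (n : ℕ) → Submodule 𝔽 (F.Cochain n)
  | 0 => ⊥
  | n + 1 => LinearMap.range (F.coboundary n)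

/-- The dimension of the cohomology in degree `n - 1`. -/
def cohomologyDim (F : AugSheaf 𝔽 X) (n : ℕ) : ℕ :=
  Module.finrank 𝔽 (F.cocycles n ⧸ (F.coboundaries n).submoduleOf (F.cocycles n))

/-! ### Coboundary expansion -/

open scoped Classical in
/-- The weighted support norm of a section on a face of a `d`-complex. -/
def sectionNorm (F : AugSheaf 𝔽 X) (d : ℕ) (x : X.Face) (s : F.obj x) : ℝ :=
  if s = 0 then 0 else X.weight d x.1

/-- The weighted support norm of a cochain. -/
def wsNorm (F : AugSheaf 𝔽 X) (d n : ℕ) (f : F.Cochain n) : ℝ :=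
  ∑ x : X.CardFace n, F.sectionNorm d x.1 (f x)

/-- The total mass `m(n - 1)` of the faces with `n` vertices. -/
def mass (F : AugSheaf 𝔽 X) (d n : ℕ) : ℝ :=
  ∑ x : X.CardFace n, ⨆ s : F.obj x.1, F.sectionNorm d x.1 s

/-- The seminorm of the class of a cochain modulo coboundaries. -/
def quotientNorm (F : AugSheaf 𝔽 X) (d n : ℕ) (f : F.Cochain n) : ℝ :=
  ⨅ b : F.coboundaries n, F.wsNorm d n (f + b.1)

/-- `(X, F)`, with `X` a `d`-complex, is an `ε`-coboundary expander in dimension `n - 1`. -/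
def IsCoboundaryExpander (F : AugSheaf 𝔽 X) (d n : ℕ) (ε : ℝ) : Prop :=
  ∀ f : F.Cochain n,
    ε * F.quotientNorm d n f * F.mass d (n + 1) ≤
      F.wsNorm d (n + 1) (F.coboundary n f) * F.mass d n

/-- `(X, F)`, with `X` a `d`-complex, is an `i`-local `ε`-coboundary expander in dimension `k`,
where `0 ≤ i ≤ k` and `i < d`: for every `i`-face `z`, the pair `(X_z, F_z)`, with `X_z` a
`(d-i-1)`-complex, is an `ε`-coboundary expander in dimension `k-i-1`. -/
def IsLocalCoboundaryExpander (F : AugSheaf 𝔽 X) (d i k : ℕ) (ε : ℝ) : Prop :=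
  ∀ z : X.Face, z.1.card = i + 1 → (F.link z).IsCoboundaryExpander (d - (i + 1)) (k - i) ε

/-- The minimum of `(k+2) ε_i / (k+1-i)` over `0 ≤ i ≤ k`. -/
def expansionMin (k : ℕ) (ε : ℕ → ℝ) : ℝ :=
  (Finset.range (k + 1)).inf' ⟨0, by simp⟩
    fun i => ((k : ℝ) + 2) * ε i / ((k : ℝ) + 1 - (i : ℝ))

/-- The local expansion hypotheses in degree `k` on a sheaved `d`-complex. -/
def HasLocalExpansion (F : AugSheaf 𝔽 X) (d k : ℕ) : Prop :=
  ∃ (ε ε' : ℕ → ℝ) (lam : ℝ),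
    (∀ i ≤ k, 0 < ε i) ∧ (∀ i ≤ k + 1, 0 < ε' i) ∧ 0 < lam ∧
    lam ≤ 1 / (d : ℝ) * min (min
      ((expansionMin k ε / (((k : ℝ) + 1) ^ 2 * 2 ^ (2 * k + 6))) ^ (2 ^ k))
      ((expansionMin (k + 1) ε' / (((k : ℝ) + 2) ^ 2 * 2 ^ (2 * k + 8))) ^ (2 ^ (k + 1)))) 1 ∧
    (∀ i ≤ k, F.IsLocalCoboundaryExpander d i k (ε i)) ∧
    (∀ i ≤ k + 1, F.IsLocalCoboundaryExpander d i (k + 1) (ε' i)) ∧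
    X.IsCodimTwoSpectralExpander d (Set.Icc (-1) lam)

end AugSheaf

/-! ## Codes and testers -/

section Codes

variable {ι A : Type*} [Fintype ι]

open scoped Classical in
/-- The normalized Hamming distance. -/
def relHamming (f g : ι → A) : ℝ := (hammingDist f g : ℝ) / (Fintype.card ι : ℝ)

/-- The normalized Hamming distance from a word to a (nonempty) code. -/
def distToCode (f : ι → A) (C : Set (ι → A)) : ℝ := ⨅ g : C, relHamming f g.1

/-- The relative distance of the code `C` is at least `δ`. -/
def HasRelDistance (C : Set (ι → A)) (δ : ℝ) : Prop :=
  ∀ f ∈ C, ∀ g ∈ C, f ≠ g → δ ≤ relHamming f g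

/-- The rate `log_{|A|} |C| / n` of a code `C` of length `n` on the alphabet `A`. -/
def codeRate (C : Set (ι → A)) : ℝ :=
  Real.logb (Nat.card A : ℝ) (Nat.card C : ℝ) / (Fintype.card ι : ℝ)

/-- A (nonadaptive) tester: a seed is drawn uniformly at random from a finite set, the seed
determines the queried positions, and acceptance depends only on the letters at these
positions. -/
structure Tester (ι A : Type*) where
  Seed : Type*
  [fintypeSeed : Fintype Seed]
  query : Seed → Finset ι
  accept : Seed → (ι → A) → Prop
  accept_congr : ∀ (ω : Seed) (f g : ι → A), (∀ i ∈ query ω, f i = g i) →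
    (accept ω f ↔ accept ω g)

attribute [instance] Tester.fintypeSeed

open scoped Classical in
/-- The probability that the tester rejects a word. -/
def Tester.rejectProb (Φ : Tester ι A) (f : ι → A) : ℝ :=
  ((Finset.univ.filter fun ω : Φ.Seed => ¬ Φ.accept ω f).card : ℝ) / (Fintype.card Φ.Seed : ℝ)

/-- `(C, Φ)` is a `t`-query `μ`-testable code. -/
def IsTestable (C : Set (ι → A)) (Φ : Tester ι A) (t : ℕ) (μ : ℝ) : Prop :=
  (∀ ω, (Φ.query ω).card ≤ t) ∧ (∀ f ∈ C, ∀ ω, Φ.accept ω f) ∧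
    ∀ f, f ∉ C → μ * distToCode f C ≤ Φ.rejectProb f

end Codes

/-! ## Word RAM programs and linear-time decoding -/

/-- Programs of a random access machine whose memory is a sequence of words `M[0], M[1], …`. -/
inductive RamProg : Type
  /-- `M[a] := c` -/
  | const (a c : ℕ)
  /-- `M[a] := M[b] + M[c]` -/
  | add (a b c : ℕ)
  /-- `M[a] := M[b] - M[c]` (truncated at zero) -/
  | sub (a b c : ℕ)
  /-- `M[a] := M[M[b]]` -/
  | load (a b : ℕ)
  /-- `M[M[a]] := M[b]` -/
  | store (a b : ℕ)
  /-- sequential composition -/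
  | seq (P Q : RamProg)
  /-- run the first program if `M[a] ≠ 0` and the second one otherwise -/
  | cond (a : ℕ) (P Q : RamProg)
  /-- repeat the program as long as `M[a] ≠ 0` -/
  | loop (a : ℕ) (P : RamProg)

/-- `RamRuns N P s t s'`: on a machine with word size `N` (words are the numbers below `N`, and
arithmetic is modulo `N`), the program `P` started in memory state `s` halts after exactly `t`
elementary operations in the state `s'`. -/
inductive RamRuns (N : ℕ) : RamProg → (ℕ → ℕ) → ℕ → (ℕ → ℕ) → Prop
  | const (a c : ℕ) (s : ℕ → ℕ) : RamRuns N (.const a c) s 1 (Function.update s a (c % N))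
  | add (a b c : ℕ) (s : ℕ → ℕ) :
      RamRuns N (.add a b c) s 1 (Function.update s a ((s b + s c) % N))
  | sub (a b c : ℕ) (s : ℕ → ℕ) : RamRuns N (.sub a b c) s 1 (Function.update s a (s b - s c))
  | load (a b : ℕ) (s : ℕ → ℕ) : RamRuns N (.load a b) s 1 (Function.update s a (s (s b)))
  | store (a b : ℕ) (s : ℕ → ℕ) : RamRuns N (.store a b) s 1 (Function.update s (s a) (s b))
  | seq {P Q : RamProg} {s s' s'' : ℕ → ℕ} {t t' : ℕ} :
      RamRuns N P s t s' → RamRuns N Q s' t' s'' → RamRuns N (.seq P Q) s (t + t') s''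
  | cond_true {a : ℕ} {P Q : RamProg} {s s' : ℕ → ℕ} {t : ℕ} :
      s a ≠ 0 → RamRuns N P s t s' → RamRuns N (.cond a P Q) s (t + 1) s'
  | cond_false {a : ℕ} {P Q : RamProg} {s s' : ℕ → ℕ} {t : ℕ} :
      s a = 0 → RamRuns N Q s t s' → RamRuns N (.cond a P Q) s (t + 1) s'
  | loop_done {a : ℕ} {P : RamProg} {s : ℕ → ℕ} : s a = 0 → RamRuns N (.loop a P) s 1 s
  | loop_step {a : ℕ} {P : RamProg} {s s' s'' : ℕ → ℕ} {t t' : ℕ} :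
      s a ≠ 0 → RamRuns N P s t s' → RamRuns N (.loop a P) s' t' s'' →
      RamRuns N (.loop a P) s (t + t' + 1) s''

section Decoding

variable {A : Type*}

/-- The memory state holding the letters of the word `f` of length `n` at the addresses
`b, …, b + n - 1`, and the words of the table `T` everywhere else. -/
def ramInput {ι : Type*} {n q : ℕ} (b : ℕ) (enc : A ≃ Fin q) (pos : ι ≃ Fin n) (T : ℕ → ℕ)
    (f : ι → A) (a : ℕ) : ℕ :=
  if h : b ≤ a ∧ a - b < n then (enc (f (pos.symm ⟨a - b, h.2⟩)) : ℕ) else T a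

/-- The codes `C r` of length `n r` admit linear-time decoding algorithms that correct up to an
`η`-fraction of errors.  There is one program for the whole family and a constant `c` such that
the `r`-th decoder runs on words bounded by `c * n r`, takes at most `c * n r` steps, and replaces
in memory every word at normalized distance less than `η` from a codeword `g` by `g`.  The code is
made known to the program through a table `T` of words, fixed before the input word is given;
since words are bounded by `c * n r`, only linearly many entries of memory can be addressed. -/
def LinearTimeDecodable {ι : ℕ → Type*} [∀ r, Fintype (ι r)] (C : ∀ r, Set (ι r → A))
    (η : ℝ) : Prop :=
  ∃ (P : RamProg) (b c : ℕ) (enc : A ≃ Fin (Nat.card A)), ∀ r,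
    ∃ (pos : ι r ≃ Fin (Fintype.card (ι r))) (T : ℕ → ℕ),
      (∀ a, T a < c * Fintype.card (ι r)) ∧
      ∀ g ∈ C r, ∀ f : ι r → A, relHamming f g < η →
        ∃ (t : ℕ) (s : ℕ → ℕ), t ≤ c * Fintype.card (ι r) ∧
          RamRuns (c * Fintype.card (ι r)) P (ramInput b enc pos T f) t s ∧
          ∀ i, s (b + (pos i : ℕ)) = (enc (g i) : ℕ)

end Decoding

/-! ## Cocycle codes -/

namespace AugSheaf

variable {𝔽 : Type*} [Field 𝔽] {W V : Type*} [LinearOrder W] [LinearOrder V]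
variable {Y : SComplex W} {X : SComplex V}

/-- Identifications of the spaces of sections on all `k`-faces with `𝔽^m`. -/
abbrev Framing (F : AugSheaf 𝔽 X) (k m : ℕ) : Type _ :=
  (x : X.CardFace (k + 1)) → (F.obj x.1 ≃ₗ[𝔽] (Fin m → 𝔽))

/-- The identifications for a pullback sheaf that are induced by those on the base. -/
def Framing.pullback {F : AugSheaf 𝔽 X} {k m : ℕ} (e : F.Framing k m) (u : SMap Y X)
    (hu : u.DimPreserving) : (F.pullback u).Framing k m :=
  fun y => e ⟨u.face y.1, (hu y.1).trans y.2⟩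

/-- The cochain corresponding to a word with letters in `𝔽^m` indexed by the `k`-faces. -/
def toCochain {F : AugSheaf 𝔽 X} {k m : ℕ} (e : F.Framing k m)
    (f : X.CardFace (k + 1) → (Fin m → 𝔽)) : F.Cochain (k + 1) :=
  fun x => (e x).symm (f x)

/-- The `k`-cocycle code, on the alphabet `𝔽^m`. -/
def cocycleCode {F : AugSheaf 𝔽 X} {k m : ℕ} (e : F.Framing k m) :
    Set (X.CardFace (k + 1) → (Fin m → 𝔽)) :=
  {f | toCochain e f ∈ F.cocycles (k + 1)}

/-- The natural tester of the `k`-cocycle code: choose a `(k+1)`-face `y` uniformly at random,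
query the `k`-faces contained in `y`, and accept if the coboundary vanishes at `y`. -/
def cocycleTester {F : AugSheaf 𝔽 X} {k m : ℕ} (e : F.Framing k m) :
    Tester (X.CardFace (k + 1)) (Fin m → 𝔽) where
  Seed := X.CardFace (k + 2)
  query y := Finset.univ.filter fun x => x.1 ≤ y.1
  accept y f := F.coboundary (k + 1) (toCochain e f) y = 0
  accept_congr := by
    intro y f g h
    have : F.coboundary (k + 1) (toCochain e f) y = F.coboundary (k + 1) (toCochain e g) y := by
      simp only [coboundary, LinearMap.pi_apply, LinearMap.sum_apply, LinearMap.smul_apply,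
        LinearMap.comp_apply, LinearMap.proj_apply]
      refine Finset.sum_congr rfl fun x _ => ?_
      rw [show toCochain e f x.1 = toCochain e g x.1 by
        simp only [toCochain]
        rw [h x.1 (by simpa using x.2)]]
    rw [this]

/-- The identifications with `𝔽^m` on the `r`-th level of a tower of coverings, for the pullback
sheaf on `X r`, that are induced by those on `X 0`. -/
def towerFraming {V : ℕ → Type*} [∀ r, LinearOrder (V r)] {X : ∀ r, SComplex (V r)}
    {F : AugSheaf 𝔽 (X 0)} {k m : ℕ} (e : F.Framing k m) (u : ∀ r, SMap (X (r + 1)) (X r))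
    (hu : ∀ r, (u r).IsCovering) (r : ℕ) : (F.pullback (towerMap u r)).Framing k m :=
  e.pullback (towerMap u r) (towerMap_dimPreserving hu r)

end AugSheaf

end

/-! Conclusion 1 rests on one vanishing statement, `AugSheaf.eq_zero_of_isLocallyMinimal`. In the
degrees `k` and `k + 1` and on every level of the tower, a cocycle is zero if its weight is below a
threshold independent of the level and cannot be lowered by adding the coboundary of a cochain that
lives on the star of one vertex.

Why light locally minimal cocycles vanish. A covering is an isomorphism on the stars of nonempty
faces, so local coboundary expansion and spectral gaps of proper links pass from the base to each
level. The only link that changes is that of the empty face, and there connectedness and Oppenheim's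
trickling down give the gap (`SComplex.linkMixing_of_forall_insert`). Let `A` be the support of `f`.
A smaller face is fat if sufficiently many fat faces one dimension up surround it. Every face of `A`
descends along a ladder of fat faces to a terminal one `z`, nonempty because `f` is light. The part
of `f` with ladders to `z` lives on the star of `z` and inherits minimality, so local expansion
gives it a large coboundary. At a face containing no bad union of fat faces, the coboundary of this
part either vanishes or agrees with that of `f`, since ladders can be exchanged among the facets
(`SComplex.Ladder.exchange`). The exceptional faces have weight `O(h)` times that of `f` by the
expander mixing inequality (`SComplex.sum_not_tame_le`). Hence `ε ‖f‖ ≤ C (‖df‖ + h ‖f‖)`, and a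
cocycle must vanish once `h` is small compared with `ε`.

Distance. As `B^k = 0`, all restriction maps into `k`-faces from their facets vanish, on every
level. So every `k`-cochain is locally minimal, and light `k`-cocycles are zero.

Testing and decoding. Given a word `f`, alter it on the star of a vertex whenever this reduces the
support of `df`, counted with multiplicity in top faces. When no vertex allows a reduction, `df` is
a locally minimal `(k+1)`-cocycle; if it was light at the start, it is now zero and a codeword has
been reached. Each alteration changes boundedly many letters and lowers an integer of size `O(|supp
df|)`. Thus the distance to the code is `O(|supp df|)`, and few errors are corrected to the right
codeword. A worklist of possibly unsettled vertices makes the procedure take linear time. It is cut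
into elementary tasks that one fixed machine program reads off a table of linear size.

Rate. A generator `T` of `C_p` acts on the cocycles of `X_{r+1}` with `(T - 1)^p = 0` in
characteristic `p`, so their dimension is at most `p` times that of the invariants, which are pulled
back from `X_r`. Therefore `dim Z^{k+1}(X_r) ≤ p^r dim Z^{k+1}(X)`, while `dim C^k` grows exactly by
`p^r`. Since `dim Z^k ≥ dim C^k - dim Z^{k+1}`, and (t3) makes this difference positive on the base,
the rate stays bounded below. -/

noncomputable section

namespace AugSheaf

/-! ### Cochain calculus: signs, coboundaries and supports -/

section Calculus

variable {𝔽 : Type*} [Field 𝔽] {V : Type*} [LinearOrder V] {X : SComplex V}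

open scoped Classical in
/-- The value of the cochain `f` at `s`, restricted to `y`; it is zero unless `s` is a face of
the right dimension contained in `y`. -/
def ev (F : AugSheaf 𝔽 X) {n : ℕ} (f : F.Cochain n) (y : X.Face) (s : Finset V) : F.obj y :=
  if h : s ∈ X.faces ∧ s.card = n ∧ s ⊆ y.1 then
    F.res (x := ⟨s, h.1⟩) (y := y) h.2.2 (f ⟨⟨s, h.1⟩, h.2.1⟩) else 0

/-- The sign of the position of `v` relative to the elements of `s`. -/
def posSign (s : Finset V) (v : V) : ℤ := (-1) ^ (s.filter fun a => a < v).card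

theorem posSign_eq_prod (s : Finset V) (v : V) :
    posSign s v = ∏ a ∈ s, if a < v then (-1 : ℤ) else 1 := by
  rw [posSign, Finset.prod_ite]; simp

theorem posSign_erase (s : Finset V) (v : V) : posSign (s.erase v) v = posSign s v := by
  unfold posSign
  congr 2
  ext a
  simp only [Finset.mem_filter, Finset.mem_erase]
  constructor
  · rintro ⟨⟨_, h⟩, h'⟩; exact ⟨h, h'⟩
  · rintro ⟨h, h'⟩; exact ⟨⟨h'.ne, h⟩, h'⟩

theorem posSign_mul_self (s : Finset V) (v : V) : posSign s v * posSign s v = 1 := by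
  unfold posSign
  rw [← mul_pow]; simp

theorem incidenceSign_erase {y : Finset V} {v : V} (hv : v ∈ y) :
    incidenceSign y (y.erase v) = posSign y v := by
  unfold incidenceSign posSign
  congr 2
  ext a
  simp only [Finset.mem_filter, Finset.mem_sdiff, Finset.mem_erase, not_and]
  constructor
  · rintro ⟨h, b, ⟨hb, hb'⟩, hab⟩
    by_cases hbv : b = v
    · exact ⟨h, hbv ▸ hab⟩
    · exact absurd hb (hb' hbv)
  · rintro ⟨h, hav⟩
    exact ⟨h, v, ⟨hv, fun h => absurd rfl h⟩, hav⟩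

variable (F : AugSheaf 𝔽 X) {n : ℕ}

theorem ev_of_mem (f : F.Cochain n) {y : X.Face} (x : X.CardFace n) (h : x.1 ≤ y) :
    F.ev f y x.1.1 = F.res h (f x) := by
  unfold ev
  rw [dif_pos ⟨x.1.2, x.2, h⟩]

theorem res_ev (f : F.Cochain n) {x y : X.Face} (h : x ≤ y) {s : Finset V} (hs : s ⊆ x.1) :
    F.res h (F.ev f x s) = F.ev f y s := by
  unfold ev
  by_cases h' : s ∈ X.faces ∧ s.card = n
  · rw [dif_pos ⟨h'.1, h'.2, hs⟩, dif_pos ⟨h'.1, h'.2, hs.trans h⟩, F.res_res]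
  · rw [dif_neg (fun h => h' ⟨h.1, h.2.1⟩), dif_neg (fun h => h' ⟨h.1, h.2.1⟩), map_zero]

/-- The facet of `y` opposite to `v`. -/
def facet (y : X.CardFace (n + 1)) (v : V) (hv : v ∈ y.1.1) : X.CardFace n :=
  ⟨⟨y.1.1.erase v, X.down_closed y.1.2 (Finset.erase_subset _ _)⟩, by
    simp [Finset.card_erase_of_mem hv, y.2]⟩

theorem facet_le (y : X.CardFace (n + 1)) (v : V) (hv : v ∈ y.1.1) : (facet y v hv).1 ≤ y.1 :=
  Finset.erase_subset _ _

theorem ev_erase (f : F.Cochain n) {y : X.CardFace (n + 1)} {v : V} (hv : v ∈ y.1.1) :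
    F.ev f y.1 (y.1.1.erase v) = F.res (facet_le y v hv) (f (facet y v hv)) :=
  ev_of_mem F f (facet y v hv) (facet_le y v hv)

theorem exists_facet_eq {y : X.CardFace (n + 1)} {x : X.CardFace n} (h : x.1 ≤ y.1) :
    ∃ v, ∃ hv : v ∈ y.1.1, facet y v hv = x := by
  have hc : x.1.1.card + 1 = y.1.1.card := by rw [x.2, y.2]
  have hss : x.1.1 ⊂ y.1.1 := Finset.ssubset_iff_subset_ne.2
    ⟨h, fun he => by rw [he] at hc; omega⟩
  obtain ⟨v, hv, hvx⟩ := Finset.exists_of_ssubset hss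
  refine ⟨v, hv, ?_⟩
  apply Subtype.ext; apply Subtype.ext
  refine (Finset.eq_of_subset_of_card_le ?_ ?_).symm
  · intro a ha
    exact Finset.mem_erase.2 ⟨fun e => hvx (e ▸ ha), h ha⟩
  · simp only [facet, Finset.card_erase_of_mem hv]; omega

theorem coboundary_apply (f : F.Cochain n) (y : X.CardFace (n + 1)) :
    F.coboundary n f y = ∑ v ∈ y.1.1, posSign y.1.1 v • F.ev f y.1 (y.1.1.erase v) := by
  simp only [coboundary, LinearMap.pi_apply, LinearMap.sum_apply, LinearMap.smul_apply,
    LinearMap.comp_apply, LinearMap.proj_apply, Int.cast_smul_eq_zsmul]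
  rw [← Finset.sum_attach y.1.1]
  symm
  refine Finset.sum_bij (fun v _ => ⟨facet y v.1 v.2, facet_le y v.1 v.2⟩) ?_ ?_ ?_ ?_
  · intros; exact Finset.mem_univ _
  · intro a _ b _ h
    have h1 : y.1.1.erase a.1 = y.1.1.erase b.1 := congrArg (fun t => t.1.1.1) h
    apply Subtype.ext
    by_contra hne
    have : a.1 ∈ y.1.1.erase b.1 := Finset.mem_erase.2 ⟨hne, a.2⟩
    rw [← h1] at this
    exact (Finset.mem_erase.1 this).1 rfl
  · intro x _
    obtain ⟨v, hv, h⟩ := exists_facet_eq x.2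
    exact ⟨⟨v, hv⟩, Finset.mem_attach _ _, Subtype.ext h⟩
  · intro v _
    simp only
    rw [← ev_of_mem F f (facet y v.1 v.2) (facet_le y v.1 v.2)]
    simp only [facet, incidenceSign_erase v.2]

/-- Deleting two vertices in either order gives the same face with opposite signs: removing the
smaller vertex shifts the position of the larger by one, whereas removing the larger leaves the
smaller in place. The double sum cancels along the involution exchanging the two vertices. -/
theorem coboundary_coboundary (f : F.Cochain n) : F.coboundary (n + 1) (F.coboundary n f) = 0 := by
  funext y
  rw [coboundary_apply]
  have h1 : ∀ v ∈ y.1.1, posSign y.1.1 v • F.ev (F.coboundary n f) y.1 (y.1.1.erase v) =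
      ∑ w ∈ y.1.1.erase v, (posSign y.1.1 v * posSign (y.1.1.erase v) w) •
        F.ev f y.1 ((y.1.1.erase v).erase w) := by
    intro v hv
    rw [ev_erase F _ hv, coboundary_apply, map_sum, Finset.smul_sum]
    refine Finset.sum_congr rfl fun w hw => ?_
    rw [map_zsmul, res_ev _ _ _ (Finset.erase_subset _ _), smul_smul]
    rfl
  rw [Finset.sum_congr rfl h1, Finset.sum_sigma']
  refine Finset.sum_involution (fun p _ => ⟨p.2, p.1⟩) ?_ ?_ ?_ ?_
  · rintro ⟨v, w⟩ h
    simp only [Finset.mem_sigma, Finset.mem_erase] at h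
    obtain ⟨hv, hwv, hw⟩ := h
    simp only
    rw [Finset.erase_right_comm, ← add_smul]
    convert zero_smul ℤ _
    have key : ∀ a b : V, a < b → a ∈ y.1.1 →
        posSign (y.1.1.erase b) a = posSign y.1.1 a ∧
        posSign (y.1.1.erase a) b = - posSign y.1.1 b := by
      intro a b hab ha
      constructor
      · unfold posSign
        congr 2
        ext c
        simp only [Finset.mem_filter, Finset.mem_erase]
        constructor
        · rintro ⟨⟨_, h⟩, h'⟩; exact ⟨h, h'⟩
        · rintro ⟨h, h'⟩; exact ⟨⟨(h'.trans hab).ne, h⟩, h'⟩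
      · rw [posSign_eq_prod, posSign_eq_prod, ← Finset.mul_prod_erase y.1.1 _ ha, if_pos hab]
        ring
    rcases lt_or_gt_of_ne hwv with h | h
    · obtain ⟨e1, e2⟩ := key w v h hw
      rw [e1, e2]; ring
    · obtain ⟨e1, e2⟩ := key v w h hv
      rw [e1, e2]; ring
  · rintro ⟨v, w⟩ h _ he
    simp only [Finset.mem_sigma, Finset.mem_erase] at h
    simp only [Sigma.mk.injEq, heq_eq_eq] at he
    exact h.2.1 he.1
  · rintro ⟨v, w⟩ h
    simp only [Finset.mem_sigma, Finset.mem_erase] at h ⊢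
    exact ⟨h.2.2, fun e => h.2.1 e.symm, h.1⟩
  · rintro ⟨v, w⟩ h
    rfl

open scoped Classical in
/-- The support of a cochain. -/
def supp (f : F.Cochain n) : Finset (Finset V) :=
  (Finset.univ.filter fun x => f x ≠ 0).image fun x => x.1.1

theorem mem_supp {f : F.Cochain n} {s : Finset V} :
    s ∈ F.supp f ↔ ∃ x : X.CardFace n, f x ≠ 0 ∧ x.1.1 = s := by
  simp [supp]

theorem coe_mem_supp {f : F.Cochain n} (x : X.CardFace n) : x.1.1 ∈ F.supp f ↔ f x ≠ 0 := by
  rw [mem_supp]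
  constructor
  · rintro ⟨x', h, e⟩
    have : x' = x := Subtype.ext (Subtype.ext e)
    rwa [← this]
  · intro h; exact ⟨x, h, rfl⟩

theorem supp_subset_faces {f : F.Cochain n} {s : Finset V} (h : s ∈ F.supp f) :
    s ∈ X.faces ∧ s.card = n := by
  obtain ⟨x, _, rfl⟩ := (mem_supp F).1 h
  exact ⟨x.1.2, x.2⟩

theorem supp_add (f g : F.Cochain n) : F.supp (f + g) ⊆ F.supp f ∪ F.supp g := by
  intro s hs
  obtain ⟨x, h, rfl⟩ := (mem_supp F).1 hs
  rw [Finset.mem_union, coe_mem_supp, coe_mem_supp]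
  by_contra hc
  push Not at hc
  exact h (by simp [hc.1, hc.2])

/-- The total `w`-weight of the support of a cochain. -/
def suppNorm (w : Finset V → ℝ) (f : F.Cochain n) : ℝ := ∑ s ∈ F.supp f, w s

theorem sum_supp {M : Type*} [AddCommMonoid M] (w : Finset V → M) (f : F.Cochain n)
    [DecidablePred fun x => f x ≠ 0] :
    ∑ s ∈ F.supp f, w s = ∑ x : X.CardFace n, if f x ≠ 0 then w x.1.1 else 0 := by
  classical
  rw [supp, Finset.sum_image, Finset.sum_filter]
  · exact Finset.sum_congr rfl fun x _ => by congr
  · intro a _ b _ h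
    exact Subtype.ext (Subtype.ext h)

theorem wsNorm_eq_suppNorm (d : ℕ) (f : F.Cochain n) :
    F.wsNorm d n f = F.suppNorm (X.weight d) f := by
  classical
  rw [suppNorm, sum_supp, wsNorm]
  refine Finset.sum_congr rfl fun x _ => ?_
  simp only [sectionNorm]
  split_ifs <;> simp_all

theorem coboundary_ne_zero {f : F.Cochain n} {y : X.CardFace (n + 1)}
    (h : F.coboundary n f y ≠ 0) : ∃ v, ∃ hv : v ∈ y.1.1, f (facet y v hv) ≠ 0 := by
  by_contra hc
  push Not at hc
  apply h
  rw [coboundary_apply]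
  refine Finset.sum_eq_zero fun v hv => ?_
  rw [ev_erase F _ hv, hc v hv, map_zero, smul_zero]

theorem coboundary_congr {f g : F.Cochain n} {y : X.CardFace (n + 1)}
    (h : ∀ v (hv : v ∈ y.1.1), f (facet y v hv) = g (facet y v hv)) :
    F.coboundary n f y = F.coboundary n g y := by
  rw [coboundary_apply, coboundary_apply]
  refine Finset.sum_congr rfl fun v hv => ?_
  rw [ev_erase F _ hv, ev_erase F _ hv, h v hv]

end Calculus

/-! ### Transfer of cochains along maps of complexes, with orientation signs -/

section Transfer

variable {V W : Type*} [LinearOrder V] [LinearOrder W]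

/-- The sign of the pair `(a, b)` in `transferSign`. -/
def pairSign (u : W → V) (z : Finset W) (a b : W) : ℤ :=
  (if a < b ∧ u b < u a then -1 else 1) * if a ∈ z ∧ b ∉ z ∧ u a < u b then -1 else 1

/-- The sign that compares the orientation of a face `y ⊇ z` with that of `u y - u z`. -/
def transferSign (u : W → V) (z y : Finset W) : ℤ := ∏ a ∈ y, ∏ b ∈ y, pairSign u z a b

theorem pairSign_mul_self (u : W → V) (z : Finset W) (a b : W) :
    pairSign u z a b * pairSign u z a b = 1 := by
  unfold pairSign; split_ifs <;> norm_num

theorem transferSign_mul_self (u : W → V) (z y : Finset W) :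
    transferSign u z y * transferSign u z y = 1 := by
  unfold transferSign
  rw [← Finset.prod_mul_distrib]
  refine Finset.prod_eq_one fun a _ => ?_
  rw [← Finset.prod_mul_distrib]
  exact Finset.prod_eq_one fun b _ => pairSign_mul_self _ _ _ _

/-- Deleting `v` removes from the product the pairs `(a, v)` and `(v, a)`. For fixed `a` these
contribute the inversion sign of `u` on `{a, v}`, together with a sign when `a ∈ z` and `u a < u v`.
The latter completes the position of `u v` outside `u z` to its position in all of `u y`, and the
inversion sign converts `u a < u v` into `a < v`. -/
theorem transferSign_erase {u : W → V} {z y : Finset W} (hu : Set.InjOn u y) (hz : z ⊆ y) {v : W}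
    (hv : v ∈ y) (hvz : v ∉ z) :
    posSign y v * transferSign u z (y.erase v) =
      transferSign u z y * posSign (y.image u \ z.image u) (u v) := by
  have h1 : transferSign u z y = transferSign u z (y.erase v) *
      ∏ a ∈ y.erase v, pairSign u z a v * pairSign u z v a := by
    unfold transferSign
    rw [← Finset.mul_prod_erase y _ hv, ← Finset.mul_prod_erase y _ hv]
    have : ∏ a ∈ y.erase v, ∏ b ∈ y, pairSign u z a b =
        ∏ a ∈ y.erase v, (pairSign u z a v * ∏ b ∈ y.erase v, pairSign u z a b) :=
      Finset.prod_congr rfl fun a _ => (Finset.mul_prod_erase y _ hv).symm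
    rw [this, Finset.prod_mul_distrib, Finset.prod_mul_distrib]
    have h0 : pairSign u z v v = 1 := by simp [pairSign]
    rw [h0]; ring
  have h2 : posSign (y.image u \ z.image u) (u v) =
      ∏ a ∈ y.erase v, if a ∉ z ∧ u a < u v then (-1 : ℤ) else 1 := by
    have : y.image u \ z.image u = (y \ z).image u := by
      ext b
      simp only [Finset.mem_sdiff, Finset.mem_image, not_exists, not_and]
      constructor
      · rintro ⟨⟨a, ha, rfl⟩, h⟩
        exact ⟨a, ⟨ha, fun h' => h a h' rfl⟩, rfl⟩
      · rintro ⟨a, ⟨ha, haz⟩, rfl⟩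
        exact ⟨⟨a, ha, rfl⟩, fun c hc h => haz (hu (hz hc) ha h ▸ hc)⟩
    rw [this, posSign_eq_prod, Finset.prod_image
      (fun a ha b hb h => hu (Finset.mem_sdiff.1 ha).1 (Finset.mem_sdiff.1 hb).1 h)]
    rw [Finset.sdiff_eq_filter, Finset.prod_filter, ← Finset.mul_prod_erase y _ hv]
    simp only [lt_self_iff_false, if_false, ite_self, one_mul]
    refine Finset.prod_congr rfl fun a _ => ?_
    split_ifs <;> simp_all
  rw [h1, h2, ← posSign_erase, posSign_eq_prod, mul_comm, mul_assoc, ← Finset.prod_mul_distrib]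
  · congr 1
    refine Finset.prod_congr rfl fun a ha => ?_
    have hne : a ≠ v := (Finset.mem_erase.1 ha).1
    have hune : u a ≠ u v := fun h => hne (hu (Finset.mem_erase.1 ha).2 hv h)
    unfold pairSign
    rcases lt_or_gt_of_ne hne with h | h <;> rcases lt_or_gt_of_ne hune with h' | h' <;>
      by_cases haz : a ∈ z <;> simp [h, h', haz, hvz, h.not_gt, h'.not_gt]

variable {𝔽 : Type*} [Field 𝔽] {K : SComplex V} {Y : SComplex W}

open scoped Classical in
/-- The cochains of `F` supported on the faces containing `z` which come from cochains of `G`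
through the maps `θ y : G(u y - u z) → F(y)`. -/
def transfer (G : AugSheaf 𝔽 K) (F : AugSheaf 𝔽 Y) (u : W → V) (z : Finset W)
    (θ : ∀ (y : Y.Face) (x : K.Face), z ⊆ y.1 → x.1 = y.1.image u \ z.image u →
      (G.obj x →ₗ[𝔽] F.obj y)) (n N : ℕ) :
    G.Cochain n →ₗ[𝔽] F.Cochain N where
  toFun g y := if h : z ⊆ y.1.1 ∧ y.1.1.image u \ z.image u ∈ K.faces ∧
      (y.1.1.image u \ z.image u).card = n then
    transferSign u z y.1.1 • θ y.1 ⟨_, h.2.1⟩ h.1 rfl (g ⟨⟨_, h.2.1⟩, h.2.2⟩) else 0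
  map_add' f g := by
    funext y
    simp only [Pi.add_apply]
    split_ifs <;> simp
  map_smul' c f := by
    funext y
    simp only [Pi.smul_apply, RingHom.id_apply]
    split_ifs
    · rw [map_smul, smul_comm]
    · simp

variable {G : AugSheaf 𝔽 K} {F : AugSheaf 𝔽 Y} {u : W → V} {z : Finset W}
  {θ : ∀ (y : Y.Face) (x : K.Face), z ⊆ y.1 → x.1 = y.1.image u \ z.image u →
      (G.obj x →ₗ[𝔽] F.obj y)}

theorem transfer_apply {n N : ℕ} (g : G.Cochain n) (y : Y.CardFace N) (x : K.CardFace n)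
    (hz : z ⊆ y.1.1) (hx : x.1.1 = y.1.1.image u \ z.image u) :
    transfer G F u z θ n N g y = transferSign u z y.1.1 • θ y.1 x.1 hz hx (g x) := by
  obtain ⟨⟨x, hxK⟩, hxn⟩ := x
  simp only at hx hxn
  subst hx
  simp only [transfer, LinearMap.coe_mk, AddHom.coe_mk]
  rw [dif_pos ⟨hz, hxK, hxn⟩]

theorem transfer_apply_of_not {n N : ℕ} (g : G.Cochain n) (y : Y.CardFace N)
    (hz : ¬ z ⊆ y.1.1) : transfer G F u z θ n N g y = 0 := by
  simp only [transfer, LinearMap.coe_mk, AddHom.coe_mk]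
  rw [dif_neg (fun h => hz h.1)]

/-- One chain-map identity serves for lifting cochains from a link of the base to a star of the
covering, for pulling back along maps over the base (`z = ∅`), and for comparing a sheaf with its
pullback along the identity. A facet of `y` that omits a vertex of `z` carries no value. The other
facets correspond to those of `u y - u z`, with signs matched by `transferSign_erase` and sections
by the naturality of `θ`. -/
theorem coboundary_transfer
    (hinj : ∀ y ∈ Y.faces, Set.InjOn u y)
    (hK : ∀ y ∈ Y.faces, z ⊆ y → y.image u \ z.image u ∈ K.faces)
    (hnat : ∀ (y y' : Y.Face) (x x' : K.Face) (hy : y ≤ y') (hx : x ≤ x') (hz : z ⊆ y.1)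
      (hz' : z ⊆ y'.1) (h : x.1 = y.1.image u \ z.image u) (h' : x'.1 = y'.1.image u \ z.image u)
      (s : G.obj x), F.res hy (θ y x hz h s) = θ y' x' hz' h' (G.res hx s))
    {n N : ℕ} (hnN : N = n + z.card) (g : G.Cochain n) :
    F.coboundary N (transfer G F u z θ n N g) =
      transfer G F u z θ (n + 1) (N + 1) (G.coboundary n g) := by
  have hcard : ∀ y ∈ Y.faces, z ⊆ y → (y.image u \ z.image u).card + z.card = y.card := by
    intro y hy hzy
    rw [Finset.card_sdiff_of_subset (Finset.image_subset_image hzy),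
      Finset.card_image_of_injOn (hinj y hy),
      Finset.card_image_of_injOn ((hinj y hy).mono (by exact_mod_cast hzy))]
    have := Finset.card_le_card hzy
    omega
  funext y
  by_cases hz : z ⊆ y.1.1
  swap
  · rw [transfer_apply_of_not _ _ hz]
    by_contra hc
    obtain ⟨v, hv, h⟩ := coboundary_ne_zero F hc
    exact h (transfer_apply_of_not _ _ fun h' => hz (h'.trans (Finset.erase_subset _ _)))
  have hyc := hcard y.1.1 y.1.2 hz
  rw [y.2] at hyc
  have hyc' : (y.1.1.image u \ z.image u).card = n + 1 := by omega
  rw [transfer_apply _ _ ⟨⟨_, hK _ y.1.2 hz⟩, hyc'⟩ hz rfl, coboundary_apply,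
    coboundary_apply, map_sum, Finset.smul_sum]
  simp only
  have himg : y.1.1.image u \ z.image u = (y.1.1 \ z).image u := by
    ext b
    simp only [Finset.mem_sdiff, Finset.mem_image, not_exists, not_and]
    constructor
    · rintro ⟨⟨a, ha, rfl⟩, h⟩
      exact ⟨a, ⟨ha, fun h' => h a h' rfl⟩, rfl⟩
    · rintro ⟨a, ⟨ha, haz⟩, rfl⟩
      exact ⟨⟨a, ha, rfl⟩, fun c hc h => haz (hinj _ y.1.2 (hz hc) ha h ▸ hc)⟩
  rw [show (∑ v ∈ y.1.1.image u \ z.image u, transferSign u z y.1.1 •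
      (θ y.1 ⟨_, hK _ y.1.2 hz⟩ hz rfl) (posSign (y.1.1.image u \ z.image u) v •
        G.ev g ⟨_, hK _ y.1.2 hz⟩ ((y.1.1.image u \ z.image u).erase v))) =
      ∑ v ∈ (y.1.1 \ z).image u, transferSign u z y.1.1 •
      (θ y.1 ⟨_, hK _ y.1.2 hz⟩ hz rfl) (posSign (y.1.1.image u \ z.image u) v •
        G.ev g ⟨_, hK _ y.1.2 hz⟩ ((y.1.1.image u \ z.image u).erase v)) from
      Finset.sum_congr himg fun _ _ => rfl]
  rw [Finset.sum_image (fun a ha b hb h => hinj _ y.1.2 (Finset.mem_sdiff.1 ha).1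
    (Finset.mem_sdiff.1 hb).1 h)]
  symm
  refine Finset.sum_subset_zero_on_sdiff Finset.sdiff_subset ?_ ?_
  · intro v hv
    have hv' : v ∈ z := by simpa using (Finset.mem_sdiff.1 hv).2 ∘ fun h => Finset.mem_sdiff.2 ⟨(Finset.mem_sdiff.1 hv).1, h⟩
    rw [ev_erase F _ (hz hv'), transfer_apply_of_not, map_zero, smul_zero]
    · intro h
      exact (Finset.mem_erase.1 (h hv')).1 rfl
  · intro v hv
    obtain ⟨hvy, hvz⟩ := Finset.mem_sdiff.1 hv
    have hze : z ⊆ y.1.1.erase v := fun a ha => Finset.mem_erase.2 ⟨fun e => hvz (e ▸ ha), hz ha⟩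
    have heq : (y.1.1.image u \ z.image u).erase (u v) =
        (y.1.1.erase v).image u \ z.image u := by
      rw [himg, show (y.1.1.erase v).image u = (y.1.1.image u).erase (u v) from ?_]
      · rw [← himg]; exact Finset.erase_sdiff_comm _ _ _ |>.symm
      · ext b
        simp only [Finset.mem_image, Finset.mem_erase]
        constructor
        · rintro ⟨a, ⟨hne, ha⟩, rfl⟩
          exact ⟨fun h => hne (hinj _ y.1.2 ha hvy h), a, ha, rfl⟩
        · rintro ⟨hne, a, ha, rfl⟩
          exact ⟨a, ⟨fun h => hne (h ▸ rfl), ha⟩, rfl⟩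
    have hc := hcard _ (facet y v hvy).1.2 hze
    have hfc : ((y.1.1.image u \ z.image u).erase (u v)).card = n := by
      rw [(facet y v hvy).2] at hc
      rw [heq]; change (Finset.image u (facet y v hvy).1.1 \ Finset.image u z).card = n; omega
    let x : K.CardFace n := ⟨⟨(y.1.1.image u \ z.image u).erase (u v),
      K.down_closed (hK _ y.1.2 hz) (Finset.erase_subset _ _)⟩, hfc⟩
    have hxle : x.1 ≤ ⟨_, hK _ y.1.2 hz⟩ :=
      Finset.erase_subset (u v) (y.1.1.image u \ z.image u)
    have hev : G.ev g ⟨_, hK _ y.1.2 hz⟩ ((y.1.1.image u \ z.image u).erase (u v)) =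
        G.res hxle (g x) := ev_of_mem G g x hxle
    have hze' : z ⊆ (facet y v hvy).1.1 := hze
    have heq' : x.1.1 = (facet y v hvy).1.1.image u \ z.image u := heq
    rw [ev_erase F _ hvy, transfer_apply g (facet y v hvy) x hze' heq', map_zsmul (F.res _),
      hnat (facet y v hvy).1 y.1 x.1 ⟨_, hK _ y.1.2 hz⟩ (facet_le y v hvy) hxle hze' hz heq' rfl,
      hev, map_zsmul, smul_smul, smul_smul, ← transferSign_erase (hinj _ y.1.2) hz hvy hvz]
    rfl

end Transfer

end AugSheaf

end

/-! ### Canonical weights and their behaviour in links -/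

noncomputable section

namespace SComplex

variable {V : Type*} [LinearOrder V] {X : SComplex V} {d : ℕ}

/-- The number of `d`-faces containing `s`. -/
def topCount (X : SComplex V) (d : ℕ) (s : Finset V) : ℕ :=
  (X.faces.filter fun y => y.card = d + 1 ∧ s ⊆ y).card

theorem weight_eq (s : Finset V) :
    X.weight d s = (X.topCount d s : ℝ) / (((d + 1).choose s.card : ℝ) * (X.topCount d ∅ : ℝ)) := by
  simp [weight, topCount]

theorem topCount_pos (hX : X.IsPure d) {s : Finset V} (hs : s ∈ X.faces) :
    0 < X.topCount d s := by
  obtain ⟨y, hy, hsy, hc⟩ := hX s hs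
  exact Finset.card_pos.2 ⟨y, by simp [hy, hsy, hc]⟩

theorem card_le_of_mem (hX : X.IsPure d) {s : Finset V} (hs : s ∈ X.faces) : s.card ≤ d + 1 := by
  obtain ⟨y, hy, hsy, hc⟩ := hX s hs
  exact hc ▸ Finset.card_le_card hsy

theorem weight_nonneg (s : Finset V) : 0 ≤ X.weight d s := by
  rw [weight_eq]; positivity

theorem weight_pos (hX : X.IsPure d) {s : Finset V} (hs : s ∈ X.faces) : 0 < X.weight d s := by
  rw [weight_eq]
  have h1 := topCount_pos hX hs
  have h2 := topCount_pos hX X.empty_mem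
  have h3 := Nat.choose_pos (card_le_of_mem hX hs)
  positivity

theorem weight_empty (hX : X.IsPure d) : X.weight d ∅ = 1 := by
  rw [weight_eq]
  have h2 := topCount_pos hX X.empty_mem
  simp only [Finset.card_empty, Nat.choose_zero_right, Nat.cast_one, one_mul]
  exact div_self (by positivity)

theorem card_between {x t : Finset V} (hxt : x ⊆ t) (m : ℕ) (hm : x.card ≤ m) :
    (t.powerset.filter fun y => y.card = m ∧ x ⊆ y).card =
      (t.card - x.card).choose (m - x.card) := by
  rw [← Finset.card_sdiff_of_subset hxt, ← Finset.card_powersetCard]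
  refine Finset.card_bij' (fun y _ => y \ x) (fun y _ => y ∪ x) ?_ ?_ ?_ ?_
  · intro y hy
    simp only [Finset.mem_filter, Finset.mem_powerset] at hy
    rw [Finset.mem_powersetCard]
    exact ⟨Finset.sdiff_subset_sdiff hy.1 le_rfl, by
      rw [Finset.card_sdiff_of_subset hy.2.2, hy.2.1]⟩
  · intro y hy
    rw [Finset.mem_powersetCard] at hy
    simp only [Finset.mem_filter, Finset.mem_powerset]
    have hd : Disjoint y x := Finset.sdiff_disjoint.mono_left hy.1
    refine ⟨Finset.union_subset (hy.1.trans Finset.sdiff_subset) hxt, ?_,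
      Finset.subset_union_right⟩
    rw [Finset.card_union_of_disjoint hd, hy.2]; omega
  · intro y hy
    simp only [Finset.mem_filter, Finset.mem_powerset] at hy
    exact Finset.sdiff_union_of_subset hy.2.2
  · intro y hy
    rw [Finset.mem_powersetCard] at hy
    have hd : Disjoint y x := Finset.sdiff_disjoint.mono_left hy.1
    exact Finset.union_sdiff_cancel_right hd

theorem sum_topCount {x : Finset V} {m : ℕ} (hm : x.card ≤ m) :
    ∑ y ∈ X.faces.filter (fun y => y.card = m ∧ x ⊆ y), X.topCount d y =
      X.topCount d x * (d + 1 - x.card).choose (m - x.card) := by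
  have h := Finset.sum_card_bipartiteAbove_eq_sum_card_bipartiteBelow
    (s := X.faces.filter (fun y => y.card = m ∧ x ⊆ y))
    (t := X.faces.filter (fun y => y.card = d + 1 ∧ x ⊆ y)) (fun y t => y ⊆ t)
  have h1 : ∀ y ∈ X.faces.filter (fun y => y.card = m ∧ x ⊆ y), X.topCount d y =
      (Finset.bipartiteAbove (fun y t => y ⊆ t)
        (X.faces.filter (fun y => y.card = d + 1 ∧ x ⊆ y)) y).card := by
    intro y hy
    simp only [Finset.mem_filter] at hy
    rw [Finset.bipartiteAbove, Finset.filter_filter, topCount]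
    congr 1
    ext t
    simp only [Finset.mem_filter]
    constructor
    · rintro ⟨h1, h2, h3⟩; exact ⟨h1, ⟨h2, hy.2.2.trans h3⟩, h3⟩
    · rintro ⟨h1, h2, h3⟩; exact ⟨h1, h2.1, h3⟩
  rw [Finset.sum_congr rfl h1, h, topCount, Finset.card_eq_sum_ones, Finset.sum_mul]
  refine Finset.sum_congr rfl fun t ht => ?_
  simp only [Finset.mem_filter] at ht
  rw [one_mul, ← ht.2.1, ← card_between ht.2.2 m hm, Finset.bipartiteBelow]
  congr 1
  ext y
  simp only [Finset.mem_filter, Finset.mem_powerset]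
  constructor
  · rintro ⟨⟨_, h⟩, h'⟩; exact ⟨h', h⟩
  · rintro ⟨h', h⟩; exact ⟨⟨X.down_closed ht.1 h', h⟩, h'⟩

/-- The weight of a face is the probability that it arises as a random subface, of its dimension, of
a uniformly random top face. The identity is the double count `sum_topCount` rewritten with the
trinomial relation between binomial coefficients. -/
theorem sum_weight (hX : X.IsPure d) {x : Finset V} {m : ℕ} (hm : x.card ≤ m) (hmd : m ≤ d + 1) :
    ∑ y ∈ X.faces.filter (fun y => y.card = m ∧ x ⊆ y), X.weight d y =
      (m.choose x.card : ℝ) * X.weight d x := by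
  have h1 : ∀ y ∈ X.faces.filter (fun y => y.card = m ∧ x ⊆ y), X.weight d y =
      (X.topCount d y : ℝ) / (((d + 1).choose m : ℝ) * (X.topCount d ∅ : ℝ)) := by
    intro y hy
    simp only [Finset.mem_filter] at hy
    rw [weight_eq, hy.2.1]
  rw [Finset.sum_congr rfl h1, ← Finset.sum_div, ← Nat.cast_sum, sum_topCount hm, weight_eq]
  have h2 := topCount_pos hX X.empty_mem
  have h3 := Nat.choose_pos hmd
  have h4 := Nat.choose_pos (hm.trans hmd)
  have h5 : ((d + 1).choose m : ℝ) * (m.choose x.card) =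
      (d + 1).choose x.card * ((d + 1 - x.card).choose (m - x.card)) := by
    exact_mod_cast Nat.choose_mul (n := d + 1) hm
  rw [Nat.cast_mul, mul_div_assoc', div_eq_div_iff (by positivity) (by positivity)]
  linear_combination -(X.topCount d x : ℝ) * (X.topCount d ∅ : ℝ) * h5

theorem mem_link {z : X.Face} {x : Finset V} :
    x ∈ (X.link z).faces ↔ Disjoint x z.1 ∧ x ∪ z.1 ∈ X.faces := by
  simp only [link, Finset.mem_filter]
  exact ⟨fun h => h.2, fun h => ⟨X.down_closed h.2 Finset.subset_union_left, h⟩⟩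

theorem isPure_link (hX : X.IsPure d) (z : X.Face) (hz : z.1.card ≤ d) :
    (X.link z).IsPure (d - z.1.card) := by
  intro x hx
  rw [mem_link] at hx
  obtain ⟨y, hy, hsy, hc⟩ := hX _ hx.2
  have hzy : z.1 ⊆ y := Finset.subset_union_right.trans hsy
  refine ⟨y \ z.1, ?_, ?_, ?_⟩
  · rw [mem_link, Finset.sdiff_union_of_subset hzy]
    exact ⟨Finset.sdiff_disjoint, hy⟩
  · rw [← Finset.union_sdiff_cancel_right hx.1]
    exact Finset.sdiff_subset_sdiff hsy le_rfl
  · rw [Finset.card_sdiff_of_subset hzy, hc]; omega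

theorem topCount_link {z : X.Face} (hz : z.1.card ≤ d) {x : Finset V} (hx : Disjoint x z.1) :
    (X.link z).topCount (d - z.1.card) x = X.topCount d (x ∪ z.1) := by
  refine Finset.card_bij' (fun y _ => y ∪ z.1) (fun y _ => y \ z.1) ?_ ?_ ?_ ?_
  · intro y hy
    simp only [Finset.mem_filter, mem_link] at hy ⊢
    refine ⟨hy.1.2, ?_, Finset.union_subset_union_left hy.2.2⟩
    rw [Finset.card_union_of_disjoint hy.1.1, hy.2.1]; omega
  · intro y hy
    simp only [Finset.mem_filter, mem_link] at hy ⊢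
    have hzy : z.1 ⊆ y := Finset.subset_union_right.trans hy.2.2
    rw [Finset.sdiff_union_of_subset hzy, Finset.card_sdiff_of_subset hzy, hy.2.1]
    refine ⟨⟨Finset.sdiff_disjoint, hy.1⟩, by omega, ?_⟩
    rw [← Finset.union_sdiff_cancel_right hx]
    exact Finset.sdiff_subset_sdiff hy.2.2 le_rfl
  · intro y hy
    simp only [Finset.mem_filter, mem_link] at hy
    exact Finset.union_sdiff_cancel_right hy.1.1
  · intro y hy
    simp only [Finset.mem_filter] at hy
    exact Finset.sdiff_union_of_subset (Finset.subset_union_right.trans hy.2.2)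

/-- Both weights count the same top faces, by `topCount_link`. The binomial coefficient is the
number of ways to single out a face of the size of `z` inside `x ∪ z`. -/
theorem weight_link (hX : X.IsPure d) {z : X.Face} (hz : z.1.card ≤ d) {x : Finset V}
    (hx : x ∈ (X.link z).faces) :
    (X.link z).weight (d - z.1.card) x * ((x.card + z.1.card).choose z.1.card * X.weight d z.1) =
      X.weight d (x ∪ z.1) := by
  rw [mem_link] at hx
  rw [weight_eq, weight_eq, weight_eq, topCount_link hz hx.1,
    topCount_link hz (Finset.disjoint_empty_left _), Finset.empty_union,
    Finset.card_union_of_disjoint hx.1]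
  have hc := card_le_of_mem hX hx.2
  rw [Finset.card_union_of_disjoint hx.1] at hc
  have h1 := topCount_pos hX X.empty_mem
  have h2 := topCount_pos hX z.2
  have h3 := Nat.choose_pos (show x.card ≤ d - z.1.card + 1 by omega)
  have h4 := Nat.choose_pos hc
  have h6 := Nat.choose_pos (show z.1.card ≤ d + 1 by omega)
  have h5 : ((d + 1).choose (x.card + z.1.card) : ℝ) * ((x.card + z.1.card).choose z.1.card) =
      (d + 1).choose z.1.card * ((d - z.1.card + 1).choose x.card) := by
    have := Nat.choose_mul (n := d + 1) (Nat.le_add_left z.1.card x.card)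
    rw [Nat.add_sub_cancel, show d + 1 - z.1.card = d - z.1.card + 1 by omega] at this
    exact_mod_cast this
  field_simp
  linear_combination (X.topCount d (x ∪ z.1) : ℝ) * h5

end SComplex

end

/-! ### Spectral gaps as quadratic inequalities, and trickling down -/

noncomputable section

open Matrix in
-- The spectral theorem for a random walk that is reversible with respect to `p`. Conjugation by the
-- square roots of `p` makes the walk symmetric, and subtracting the projection to the constants
-- leaves the part on which all eigenvalues must be at most `lam`.
theorem quadForm_le_of_eigenvalues_le {ι : Type*} [Fintype ι] {p : ι → ℝ} (hp : ∀ i, 0 < p i)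
    {q : ι → ι → ℝ} (hq : ∀ i j, q i j = q j i) (hqp : ∀ i, ∑ j, q i j = p i)
    {lam : ℝ} (hlam : 0 ≤ lam)
    (h : ∀ (μ : ℝ) (φ : ι → ℝ), φ ≠ 0 → ∑ i, p i * φ i = 0 →
      (∀ i, ∑ j, q i j * φ j = μ * (p i * φ i)) → μ ≤ lam) (φ : ι → ℝ) :
    (∑ i, p i) * ∑ i, ∑ j, q i j * (φ i * φ j) ≤
      (1 - lam) * (∑ i, p i * φ i) ^ 2 + lam * ((∑ i, p i) * ∑ i, p i * φ i ^ 2) := by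
  classical
  rcases isEmpty_or_nonempty ι with hι | hι
  · simp
  set M := ∑ i, p i with hM
  have hMpos : 0 < M := Finset.sum_pos (fun i _ => hp i) Finset.univ_nonempty
  set r : ι → ℝ := fun i => Real.sqrt (p i) with hr
  have hrpos : ∀ i, 0 < r i := fun i => Real.sqrt_pos.2 (hp i)
  have hrr : ∀ i, r i * r i = p i := fun i => Real.mul_self_sqrt (hp i).le
  -- `lam` minus the symmetrised walk, with its top eigenvector `r` (eigenvalue `1`) deflated;
  -- positive semidefiniteness of `H` is the inequality sought.
  let H : Matrix ι ι ℝ := Matrix.of fun i j =>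
    lam * (if i = j then 1 else 0) - (q i j / (r i * r j) - r i * r j / M)
  have hmul : ∀ (g : ι → ℝ) i, (H *ᵥ g) i =
      lam * g i - ((∑ j, q i j * (g j / r j)) / r i - r i * (∑ j, r j * g j) / M) := by
    intro g i
    simp only [Matrix.mulVec, dotProduct, H, Matrix.of_apply]
    rw [Finset.sum_div, Finset.mul_sum, Finset.sum_div]
    simp only [sub_mul, Finset.sum_sub_distrib]
    congr 1
    · simp
    · congr 1
      · refine Finset.sum_congr rfl fun j _ => ?_
        have := (hrpos i).ne'; have := (hrpos j).ne'
        field_simp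
      · refine Finset.sum_congr rfl fun j _ => ?_
        ring
  have hH : H.IsHermitian := by
    ext i j
    simp only [Matrix.conjTranspose_apply, star_trivial, H, Matrix.of_apply]
    rw [hq j i, mul_comm (r j)]
    simp [eq_comm]
  have hps : H.PosSemidef := by
    rw [hH.posSemidef_iff_eigenvalues_nonneg]
    intro k
    by_contra hneg
    simp only [Pi.zero_apply, not_le] at hneg
    set e := hH.eigenvalues k
    set g : ι → ℝ := ⇑(hH.eigenvectorBasis k) with hg
    have hge : H *ᵥ g = e • g := hH.mulVec_eigenvectorBasis k
    have hg0 : g ≠ 0 := by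
      intro h0
      have h1 : hH.eigenvectorBasis k ≠ 0 := hH.eigenvectorBasis.orthonormal.ne_zero k
      apply h1
      ext i
      exact congrFun h0 i
    have hgi : ∀ i, (∑ j, q i j * (g j / r j)) / r i - r i * (∑ j, r j * g j) / M =
        (lam - e) * g i := by
      intro i
      have := congrFun hge i
      rw [hmul] at this
      simp only [Pi.smul_apply, smul_eq_mul] at this
      linarith
    -- The deflated walk kills `r`, so pairing the eigenvalue equation with `r` gives `(lam - e) ⟨r,
    -- g⟩ = 0`. Here `lam - e > 0`, as `e < 0 ≤ lam`, so `g` is orthogonal to `r` and is an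
    -- eigenvector of the original walk with eigenvalue above `lam`.
    have hsum : ∑ j, r j * g j = 0 := by
      have h1 : ∑ i, r i * ((∑ j, q i j * (g j / r j)) / r i - r i * (∑ j, r j * g j) / M) = 0 := by
        have : ∀ i, r i * ((∑ j, q i j * (g j / r j)) / r i - r i * (∑ j, r j * g j) / M) =
            ∑ j, q i j * (g j / r j) - p i * ((∑ j, r j * g j) / M) := by
          intro i
          rw [← hrr i, mul_sub, mul_div_cancel₀ _ (hrpos i).ne']
          ring
        simp only [this, Finset.sum_sub_distrib, ← Finset.sum_mul]
        rw [Finset.sum_comm]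
        have h2 : ∀ j, ∑ i, q i j * (g j / r j) = r j * g j := by
          intro j
          rw [← Finset.sum_mul]
          simp only [fun i => hq i j]
          rw [hqp, ← hrr j]
          have := (hrpos j).ne'
          field_simp
        simp only [h2]
        rw [mul_div_cancel₀ _ hMpos.ne', sub_self]
      simp only [hgi] at h1
      have h3 : (lam - e) * ∑ i, r i * g i = 0 := by
        rw [Finset.mul_sum, ← h1]
        exact Finset.sum_congr rfl fun i _ => by ring
      rcases mul_eq_zero.1 h3 with h4 | h4
      · linarith
      · exact h4
    have := h (lam - e) (fun i => g i / r i) ?_ ?_ ?_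
    · linarith
    · intro h0
      apply hg0
      funext i
      have := congrFun h0 i
      simpa [(hrpos i).ne'] using this
    · rw [← hsum]
      refine Finset.sum_congr rfl fun i _ => ?_
      rw [← hrr i]
      have := (hrpos i).ne'
      field_simp
    · intro i
      have := hgi i
      rw [hsum, mul_zero, zero_div, sub_zero, div_eq_iff (hrpos i).ne'] at this
      rw [this, ← hrr i]
      have := (hrpos i).ne'
      field_simp
  have key : ∀ φ : ι → ℝ, M * ∑ i, ∑ j, q i j * (φ i * φ j) ≤
      (∑ i, p i * φ i) ^ 2 + lam * (M * ∑ i, p i * φ i ^ 2) := by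
    intro φ
    have key := hps.dotProduct_mulVec_nonneg (fun i => r i * φ i)
    simp only [star_trivial, dotProduct, hmul] at key
    have h1 : ∀ i, r i * φ i * (lam * (r i * φ i) - ((∑ j, q i j * (r j * φ j / r j)) / r i -
        r i * (∑ j, r j * (r j * φ j)) / M)) = lam * (p i * φ i ^ 2) -
          ∑ j, q i j * (φ i * φ j) + p i * φ i * ((∑ j, p j * φ j) / M) := by
      intro i
      have h2 : ∑ j, q i j * (r j * φ j / r j) = ∑ j, q i j * φ j :=
        Finset.sum_congr rfl fun j _ => by rw [mul_div_cancel_left₀ _ (hrpos j).ne']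
      have h3 : ∑ j, r j * (r j * φ j) = ∑ j, p j * φ j :=
        Finset.sum_congr rfl fun j _ => by rw [← mul_assoc, hrr]
      have h4 : ∑ j, q i j * (φ i * φ j) = φ i * ∑ j, q i j * φ j := by
        rw [Finset.mul_sum]; exact Finset.sum_congr rfl fun j _ => by ring
      rw [h2, h3, h4, ← hrr i]
      have := (hrpos i).ne'
      field_simp
      ring
    simp only [h1, Finset.sum_add_distrib, Finset.sum_sub_distrib, ← Finset.mul_sum,
      ← Finset.sum_mul] at key
    have h5 := mul_nonneg hMpos.le key
    have h6 : M * ((∑ i, p i * φ i) * ((∑ i, p i * φ i) / M)) = (∑ i, p i * φ i) ^ 2 := by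
      field_simp
    rw [mul_add, h6] at h5
    linarith
  -- Applying `key` to the centred function `φ - S / M` sharpens the coefficient of the squared mean
  -- from `1` to `1 - lam`.
  set S := ∑ i, p i * φ i with hS
  have k := key (fun i => φ i - S / M)
  have e1 : ∑ i, p i * (φ i - S / M) = 0 := by
    simp only [mul_sub, Finset.sum_sub_distrib, ← Finset.sum_mul]
    rw [← hS, ← hM, mul_div_cancel₀ _ hMpos.ne', sub_self]
  have e2 : ∑ i, p i * (φ i - S / M) ^ 2 = ∑ i, p i * φ i ^ 2 - S ^ 2 / M := by
    have : ∀ i, p i * (φ i - S / M) ^ 2 =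
        p i * φ i ^ 2 - p i * φ i * (2 * (S / M)) + p i * (S / M) ^ 2 := fun i => by ring
    simp only [this, Finset.sum_add_distrib, Finset.sum_sub_distrib, ← Finset.sum_mul]
    rw [← hS, ← hM]
    field_simp
    ring
  have e3 : ∑ i, ∑ j, q i j * ((φ i - S / M) * (φ j - S / M)) =
      ∑ i, ∑ j, q i j * (φ i * φ j) - S ^ 2 / M := by
    have : ∀ i j, q i j * ((φ i - S / M) * (φ j - S / M)) = q i j * (φ i * φ j) -
        q i j * (φ i * (S / M)) - q j i * (φ j * (S / M)) + q i j * (S / M) ^ 2 := by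
      intro i j; rw [hq j i]; ring
    simp only [this, Finset.sum_add_distrib, Finset.sum_sub_distrib]
    rw [Finset.sum_comm (f := fun i j => q j i * (φ j * (S / M)))]
    simp only [← Finset.sum_mul, hqp]
    have e : ∑ i, p i * (φ i * (S / M)) = S * (S / M) := by
      rw [hS, Finset.sum_mul]; exact Finset.sum_congr rfl fun i _ => by ring
    rw [e, ← hM]
    field_simp
    ring
  rw [e1, e2, e3] at k
  have e4 : M * (S ^ 2 / M) = S ^ 2 := by field_simp
  rw [mul_sub, mul_sub, e4] at k
  linarith

namespace SComplex

variable {V : Type*} [LinearOrder V] {X : SComplex V} {d : ℕ}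

/-- The vertices of the link of `X` at `z`. -/
def linkVerts (X : SComplex V) (z : Finset V) : Finset V :=
  (X.faces.biUnion fun y => y).filter fun v => v ∉ z ∧ insert v z ∈ X.faces

theorem mem_linkVerts {z : Finset V} {v : V} :
    v ∈ X.linkVerts z ↔ v ∉ z ∧ insert v z ∈ X.faces := by
  simp only [linkVerts, Finset.mem_filter, Finset.mem_biUnion]
  exact ⟨fun h => h.2, fun h => ⟨⟨_, h.2, Finset.mem_insert_self _ _⟩, h⟩⟩

/-- The weight of the edge `ab` in the link of `X` at `z`. -/
def pairWeight (X : SComplex V) (d : ℕ) (z : Finset V) (a b : V) : ℝ :=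
  if a ≠ b ∧ a ∉ z ∧ b ∉ z ∧ insert a (insert b z) ∈ X.faces then
    X.weight d (insert a (insert b z)) else 0

theorem pairWeight_nonneg (z : Finset V) (a b : V) : 0 ≤ X.pairWeight d z a b := by
  unfold pairWeight; split_ifs
  · exact weight_nonneg _
  · exact le_rfl

theorem pairWeight_comm (z : Finset V) (a b : V) :
    X.pairWeight d z a b = X.pairWeight d z b a := by
  unfold pairWeight
  rw [Finset.insert_comm a b]
  congr 1
  simp only [ne_eq, eq_comm, eq_iff_iff]
  tauto

theorem sum_weight_linkVerts (hX : X.IsPure d) {z : Finset V} (hz : z.card ≤ d) :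
    ∑ a ∈ X.linkVerts z, X.weight d (insert a z) = (z.card + 1 : ℝ) * X.weight d z := by
  have h := sum_weight hX (Nat.le_succ z.card) (Nat.succ_le_succ hz)
  rw [Nat.succ_eq_add_one, Nat.choose_succ_self_right, Nat.cast_add, Nat.cast_one] at h
  rw [← h]
  refine Finset.sum_bij (fun a _ => insert a z) ?_ ?_ ?_ ?_
  · intro a ha
    rw [mem_linkVerts] at ha
    simp [ha.1, ha.2]
  · intro a ha b hb h
    rw [mem_linkVerts] at ha hb
    have : a ∈ insert b z := h ▸ Finset.mem_insert_self a z
    rcases Finset.mem_insert.1 this with h | h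
    · exact h
    · exact absurd h ha.1
  · intro y hy
    simp only [Finset.mem_filter] at hy
    obtain ⟨a, ha, h⟩ := (Finset.covBy_iff_exists_insert.1
      (Finset.covBy_iff_card_sdiff_eq_one.2 ⟨hy.2.2, by
        rw [Finset.card_sdiff_of_subset hy.2.2, hy.2.1]; omega⟩))
    exact ⟨a, mem_linkVerts.2 ⟨ha, h ▸ hy.1⟩, h⟩
  · intros; rfl

theorem linkVerts_insert_subset {z : Finset V} (c : V) :
    X.linkVerts (insert c z) ⊆ X.linkVerts z := by
  intro a ha
  rw [mem_linkVerts] at ha ⊢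
  refine ⟨fun h => ha.1 (Finset.mem_insert_of_mem h), X.down_closed ha.2 ?_⟩
  exact Finset.insert_subset_insert _ (Finset.subset_insert _ _)

theorem pairWeight_of_mem {z : Finset V} {a b : V} (ha : a ∈ X.linkVerts z)
    (hb : b ∈ X.linkVerts (insert a z)) :
    X.pairWeight d z a b = X.weight d (insert b (insert a z)) := by
  rw [mem_linkVerts] at ha hb
  simp only [Finset.mem_insert, not_or] at hb
  rw [pairWeight, Finset.insert_comm, if_pos ⟨Ne.symm hb.1.1, ha.1, hb.1.2, hb.2⟩]

theorem pairWeight_of_not_mem {z : Finset V} {a b : V}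
    (hb : b ∉ X.linkVerts (insert a z)) : X.pairWeight d z a b = 0 := by
  rw [pairWeight, if_neg]
  rintro ⟨h1, h2, h3, h4⟩
  apply hb
  rw [mem_linkVerts, Finset.insert_comm]
  exact ⟨by simp [Ne.symm h1, h3], h4⟩

theorem mem_of_pairWeight_ne_zero {z : Finset V} {a b : V} (h : X.pairWeight d z a b ≠ 0) :
    a ∈ X.linkVerts z ∧ b ∈ X.linkVerts z := by
  unfold pairWeight at h
  split_ifs at h with h'
  · obtain ⟨_, h2, h3, h4⟩ := h'
    refine ⟨mem_linkVerts.2 ⟨h2, X.down_closed h4 ?_⟩, mem_linkVerts.2 ⟨h3, X.down_closed h4 ?_⟩⟩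
    · exact Finset.insert_subset_insert _ (Finset.subset_insert _ _)
    · exact Finset.subset_insert _ _
  · exact absurd rfl h

theorem sum_pairWeight_mul {z : Finset V} {a : V} (ha : a ∈ X.linkVerts z) (φ : V → ℝ) :
    ∑ b ∈ X.linkVerts z, X.pairWeight d z a b * φ b =
      ∑ b ∈ X.linkVerts (insert a z), X.weight d (insert b (insert a z)) * φ b := by
  symm
  refine Finset.sum_subset_zero_on_sdiff (linkVerts_insert_subset a) ?_ ?_
  · intro b hb
    rw [pairWeight_of_not_mem (Finset.mem_sdiff.1 hb).2, zero_mul]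
  · intro b hb
    rw [pairWeight_of_mem ha hb]

theorem sum_pairWeight (hX : X.IsPure d) {z : Finset V} (hz : z.card + 1 ≤ d) {a : V}
    (ha : a ∈ X.linkVerts z) :
    ∑ b ∈ X.linkVerts z, X.pairWeight d z a b = (z.card + 2 : ℝ) * X.weight d (insert a z) := by
  have h := sum_pairWeight_mul (d := d) ha (fun _ => 1)
  simp only [mul_one] at h
  have hc : (insert a z).card = z.card + 1 := Finset.card_insert_of_notMem (mem_linkVerts.1 ha).1
  rw [h, sum_weight_linkVerts hX (by omega), hc]
  push_cast
  ring

/-- Garland's localisation: an edge of the link at `z` lies in the links at `z ∪ {c}` for precisely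
those `c` that extend it to a triangle. The weights of these triangles add up to a fixed multiple of
the weight of the edge. -/
theorem sum_pairWeight_insert (hX : X.IsPure d) {z : Finset V} (hz : z.card + 2 ≤ d) (a b : V) :
    ∑ c ∈ X.linkVerts z, X.pairWeight d (insert c z) a b =
      (z.card + 3 : ℝ) * X.pairWeight d z a b := by
  by_cases h : a ≠ b ∧ a ∉ z ∧ b ∉ z ∧ insert a (insert b z) ∈ X.faces
  · obtain ⟨h1, h2, h3, h4⟩ := h
    have hc : (insert a (insert b z)).card = z.card + 2 := by
      rw [Finset.card_insert_of_notMem (by simp [h1, h2]), Finset.card_insert_of_notMem h3]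
    have key := sum_weight_linkVerts hX (z := insert a (insert b z)) (by omega)
    rw [pairWeight, if_pos ⟨h1, h2, h3, h4⟩, ← show (z.card + 2 + 1 : ℝ) = z.card + 3 by ring]
    rw [hc] at key
    push_cast at key
    rw [← key]
    symm
    refine Finset.sum_subset_zero_on_sdiff
      ((linkVerts_insert_subset a).trans (linkVerts_insert_subset b)) ?_ ?_
    · intro c hc
      rw [Finset.mem_sdiff] at hc
      rw [pairWeight, if_neg]
      rintro ⟨_, g2, g3, g4⟩
      apply hc.2
      simp only [Finset.mem_insert, not_or] at g2 g3
      rw [mem_linkVerts]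
      refine ⟨by simp [Ne.symm g2.1, Ne.symm g3.1, (mem_linkVerts.1 hc.1).1], ?_⟩
      rwa [Finset.insert_comm c a, Finset.insert_comm c b]
    · intro c hc
      rw [mem_linkVerts] at hc
      simp only [Finset.mem_insert, not_or] at hc
      rw [Finset.insert_comm c a, Finset.insert_comm c b] at hc ⊢
      rw [pairWeight, if_pos]
      exact ⟨h1, by simp [Ne.symm hc.1.1, h2], by simp [Ne.symm hc.1.2.1, h3], hc.2⟩
  · rw [pairWeight, if_neg h, mul_zero]
    refine Finset.sum_eq_zero fun c _ => ?_
    rw [pairWeight, if_neg]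
    rintro ⟨g1, g2, g3, g4⟩
    simp only [Finset.mem_insert, not_or] at g2 g3
    refine h ⟨g1, g2.2, g3.2, X.down_closed g4 ?_⟩
    exact Finset.insert_subset_insert _ (Finset.insert_subset_insert _ (Finset.subset_insert _ _))

/-- The underlying weighted graph of the link at `z` satisfies the mixing inequality of a graph
whose nontrivial eigenvalues are at most `lam`. -/
def LinkMixing (X : SComplex V) (d : ℕ) (z : Finset V) (lam : ℝ) : Prop :=
  ∀ φ : V → ℝ, ((z.card + 1) * X.weight d z) *
      ∑ a ∈ X.linkVerts z, ∑ b ∈ X.linkVerts z, X.pairWeight d z a b * (φ a * φ b) ≤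
    (z.card + 2) * ((1 - lam) * (∑ a ∈ X.linkVerts z, X.weight d (insert a z) * φ a) ^ 2 +
      lam * (((z.card + 1) * X.weight d z) *
        ∑ a ∈ X.linkVerts z, X.weight d (insert a z) * φ a ^ 2))

/-- Dividing the edge weights by `|z| + 2` makes the row sums equal to the vertex weights `w(z ∪
{a})`, whose total is `(|z| + 1) w(z)`. This is where the normalising factors in `LinkMixing` come
from. -/
theorem linkMixing_of_eigenvalues_le (hX : X.IsPure d) {z : Finset V} (hz : z.card + 1 ≤ d)
    {lam : ℝ} (hlam : 0 ≤ lam)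
    (h : ∀ (μ : ℝ) (φ : V → ℝ), (∃ a ∈ X.linkVerts z, φ a ≠ 0) →
      ∑ a ∈ X.linkVerts z, X.weight d (insert a z) * φ a = 0 →
      (∀ a ∈ X.linkVerts z, ∑ b ∈ X.linkVerts z, X.pairWeight d z a b * φ b =
        μ * ((z.card + 2) * (X.weight d (insert a z) * φ a))) → μ ≤ lam) :
    X.LinkMixing d z lam := by
  intro φ
  have hc : (0 : ℝ) < z.card + 2 := by positivity
  have key := quadForm_le_of_eigenvalues_le (ι := {a // a ∈ X.linkVerts z})
    (p := fun a => X.weight d (insert a.1 z))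
    (q := fun a b => X.pairWeight d z a.1 b.1 / (z.card + 2))
    (fun a => weight_pos hX (mem_linkVerts.1 a.2).2)
    (fun a b => by simp only [pairWeight_comm z a.1])
    (fun a => by
      rw [← Finset.sum_div, Finset.sum_coe_sort (X.linkVerts z) (fun b => X.pairWeight d z a.1 b),
        sum_pairWeight hX hz a.2]
      field_simp) hlam ?_ (fun a => φ a.1)
  · rw [Finset.sum_coe_sort (X.linkVerts z) (fun a => X.weight d (insert a z)),
      Finset.sum_coe_sort (X.linkVerts z) (fun a => X.weight d (insert a z) * φ a),
      Finset.sum_coe_sort (X.linkVerts z) (fun a => X.weight d (insert a z) * φ a ^ 2),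
      sum_weight_linkVerts hX (by omega),
      Finset.sum_congr rfl (fun (a : {a // a ∈ X.linkVerts z}) _ =>
        Finset.sum_coe_sort (X.linkVerts z)
          (fun b => X.pairWeight d z a.1 b / (z.card + 2) * (φ a.1 * φ b))),
      Finset.sum_coe_sort (X.linkVerts z) (fun a => ∑ b ∈ X.linkVerts z,
        X.pairWeight d z a b / (z.card + 2) * (φ a * φ b))] at key
    simp only [div_mul_eq_mul_div, ← Finset.sum_div] at key
    rw [mul_div_assoc', div_le_iff₀ hc] at key
    linarith
  · intro μ ψ hψ h1 h2
    classical
    refine h μ (fun v => if hv : v ∈ X.linkVerts z then ψ ⟨v, hv⟩ else 0) ?_ ?_ ?_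
    · obtain ⟨a, ha⟩ := Function.ne_iff.1 hψ
      exact ⟨a.1, a.2, by simpa using ha⟩
    · rw [← h1, ← Finset.sum_coe_sort]
      simp
    · intro a ha
      have := h2 ⟨a, ha⟩
      simp only [ha, dite_true]
      rw [← Finset.sum_coe_sort]
      simp only [Finset.coe_mem, dite_true, Subtype.coe_eta]
      simp only [div_mul_eq_mul_div, ← Finset.sum_div] at this
      rw [div_eq_iff hc.ne'] at this
      rw [this]
      ring

/-- The link at `z` is connected, in terms of functions on the vertices. -/
def LinkConn (X : SComplex V) (z : Finset V) : Prop :=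
  ∀ φ : V → ℝ, (∀ a b, a ≠ b → a ∉ z → b ∉ z → insert a (insert b z) ∈ X.faces → φ a = φ b) →
    ∀ a ∈ X.linkVerts z, ∀ b ∈ X.linkVerts z, φ a = φ b

/-- Oppenheim's trickling down. For an eigenfunction `φ` with eigenvalue `μ`, the quadratic form of
the link at `z` is an average of those of the links at `z ∪ {c}`. The mean of `φ` over the latter
link is `μ φ(c)` by the eigenvalue equation. Mixing in the smaller links then yields `μ ≤ (1 - lam)
μ² + lam`, and connectedness excludes the root `μ = 1`. -/
theorem linkMixing_of_forall_insert (hX : X.IsPure d) {z : Finset V} (hz : z.card + 2 ≤ d)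
    {lam : ℝ} (hlam : 0 ≤ lam) (hlam1 : lam < 1) (hconn : X.LinkConn z)
    (h : ∀ c ∈ X.linkVerts z, X.LinkMixing d (insert c z) lam) :
    X.LinkMixing d z (lam / (1 - lam)) := by
  have hl : 0 < 1 - lam := by linarith
  refine linkMixing_of_eigenvalues_le hX (by omega) (by positivity) ?_
  rintro μ φ ⟨a₀, ha₀, hφ⟩ h1 h2
  set L := X.linkVerts z with hL
  set w := X.weight d with hw
  set n : ℝ := (z.card : ℝ) with hn
  have hn0 : 0 ≤ n := by positivity
  set S := ∑ a ∈ L, w (insert a z) * φ a ^ 2 with hS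
  have hwpos : ∀ a ∈ L, 0 < w (insert a z) := fun a ha => weight_pos hX (mem_linkVerts.1 ha).2
  have hSpos : 0 < S := by
    refine Finset.sum_pos' (fun a ha => mul_nonneg (hwpos a ha).le (sq_nonneg _))
      ⟨a₀, ha₀, mul_pos (hwpos _ ha₀) (by positivity)⟩
  set Q := ∑ a ∈ L, ∑ b ∈ L, X.pairWeight d z a b * (φ a * φ b) with hQ
  have hQS : Q = μ * ((n + 2) * S) := by
    rw [hQ, hS, Finset.mul_sum, Finset.mul_sum]
    refine Finset.sum_congr rfl fun a ha => ?_
    rw [show ∑ b ∈ L, X.pairWeight d z a b * (φ a * φ b) =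
      φ a * ∑ b ∈ L, X.pairWeight d z a b * φ b from by
        rw [Finset.mul_sum]; exact Finset.sum_congr rfl fun b _ => by ring, h2 a ha]
    ring
  have hpS : ∑ a ∈ L, ∑ b ∈ L, X.pairWeight d z a b * φ b ^ 2 = (n + 2) * S := by
    rw [Finset.sum_comm, hS, Finset.mul_sum]
    refine Finset.sum_congr rfl fun b hb => ?_
    rw [← Finset.sum_mul, Finset.sum_congr rfl fun a _ => pairWeight_comm z a b,
      sum_pairWeight hX (by omega) hb]
    ring
  have hdiff : ∑ a ∈ L, ∑ b ∈ L, X.pairWeight d z a b * (φ a - φ b) ^ 2 =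
      2 * (n + 2) * S * (1 - μ) := by
    have e : ∀ a b, X.pairWeight d z a b * (φ a - φ b) ^ 2 = X.pairWeight d z b a * φ a ^ 2 +
        X.pairWeight d z a b * φ b ^ 2 - 2 * (X.pairWeight d z a b * (φ a * φ b)) := by
      intro a b; rw [pairWeight_comm z b a]; ring
    simp only [e, Finset.sum_sub_distrib, Finset.sum_add_distrib, ← Finset.mul_sum]
    rw [Finset.sum_comm (f := fun a b => X.pairWeight d z b a * φ a ^ 2), hpS, ← hQ, hQS]
    ring
  have hterm : ∀ a b, 0 ≤ X.pairWeight d z a b * (φ a - φ b) ^ 2 := fun a b =>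
    mul_nonneg (pairWeight_nonneg _ _ _) (sq_nonneg _)
  -- For `μ ≥ 1` the Dirichlet energy of `φ` would be nonpositive, making `φ` constant along edges
  -- and so constant by connectedness; having weighted mean zero, it would vanish.
  have hμ1 : μ < 1 := by
    by_contra hc
    have hle : ∑ a ∈ L, ∑ b ∈ L, X.pairWeight d z a b * (φ a - φ b) ^ 2 ≤ 0 := by
      rw [hdiff]
      exact mul_nonpos_of_nonneg_of_nonpos (by positivity) (by linarith)
    have hz1 : ∀ a ∈ L, ∀ b ∈ L, X.pairWeight d z a b * (φ a - φ b) ^ 2 = 0 := by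
      have h3 := (Finset.sum_eq_zero_iff_of_nonneg
        (fun a _ => Finset.sum_nonneg fun b _ => hterm a b)).1
        (le_antisymm hle (Finset.sum_nonneg fun a _ => Finset.sum_nonneg fun b _ => hterm a b))
      intro a ha b hb
      exact (Finset.sum_eq_zero_iff_of_nonneg (fun b _ => hterm a b)).1 (h3 a ha) b hb
    have hconst : ∀ a ∈ L, ∀ b ∈ L, φ a = φ b := by
      apply hconn
      intro a b hab ha hb hf
      have hp : X.pairWeight d z a b ≠ 0 := by
        rw [pairWeight, if_pos ⟨hab, ha, hb, hf⟩]
        exact (weight_pos hX hf).ne'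
      have hm := mem_of_pairWeight_ne_zero hp
      have := (mul_eq_zero.1 (hz1 a hm.1 b hm.2)).resolve_left hp
      have := pow_eq_zero_iff (two_ne_zero) |>.1 this
      linarith
    have : ∑ a ∈ L, w (insert a z) * φ a = (∑ a ∈ L, w (insert a z)) * φ a₀ := by
      rw [Finset.sum_mul]
      exact Finset.sum_congr rfl fun a ha => by rw [hconst a ha a₀ ha₀]
    rw [this] at h1
    rcases mul_eq_zero.1 h1 with h4 | h4
    · have : 0 < ∑ a ∈ L, w (insert a z) := Finset.sum_pos hwpos ⟨a₀, ha₀⟩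
      linarith
    · exact hφ h4
  have hQc : (n + 3) * Q = ∑ c ∈ L, ∑ a ∈ X.linkVerts (insert c z),
      ∑ b ∈ X.linkVerts (insert c z), X.pairWeight d (insert c z) a b * (φ a * φ b) := by
    have e1 : ∀ c ∈ L, ∑ a ∈ X.linkVerts (insert c z),
        ∑ b ∈ X.linkVerts (insert c z), X.pairWeight d (insert c z) a b * (φ a * φ b) =
        ∑ a ∈ L, ∑ b ∈ L, X.pairWeight d (insert c z) a b * (φ a * φ b) := by
      intro c _
      have hz0 : ∀ a b, a ∉ X.linkVerts (insert c z) ∨ b ∉ X.linkVerts (insert c z) →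
          X.pairWeight d (insert c z) a b * (φ a * φ b) = 0 := by
        intro a b hab
        by_contra hne
        have := mem_of_pairWeight_ne_zero (left_ne_zero_of_mul hne)
        tauto
      refine Finset.sum_subset_zero_on_sdiff (linkVerts_insert_subset c) ?_ ?_
      · intro a ha
        exact Finset.sum_eq_zero fun b _ => hz0 a b (Or.inl (Finset.mem_sdiff.1 ha).2)
      · intro a _
        refine Finset.sum_subset_zero_on_sdiff (linkVerts_insert_subset c) ?_ fun b _ => rfl
        intro b hb
        exact hz0 a b (Or.inr (Finset.mem_sdiff.1 hb).2)
    rw [Finset.sum_congr rfl e1, Finset.sum_comm, hQ, Finset.mul_sum]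
    refine Finset.sum_congr rfl fun a _ => ?_
    rw [Finset.sum_comm, Finset.mul_sum]
    refine Finset.sum_congr rfl fun b _ => ?_
    rw [← Finset.sum_mul, sum_pairWeight_insert hX hz]
    ring
  have hbound : ∀ c ∈ L, ∑ a ∈ X.linkVerts (insert c z),
      ∑ b ∈ X.linkVerts (insert c z), X.pairWeight d (insert c z) a b * (φ a * φ b) ≤
      (n + 3) * ((1 - lam) * μ ^ 2 * (n + 2) * (w (insert c z) * φ c ^ 2) +
        lam * ∑ a ∈ L, X.pairWeight d z c a * φ a ^ 2) := by
    intro c hc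
    have hcc : (insert c z).card = z.card + 1 := Finset.card_insert_of_notMem (mem_linkVerts.1 hc).1
    have hm := h c hc φ
    -- The weighted sum of `φ` over the link at `z ∪ {c}` is the row of the eigenvalue equation at
    -- `c`.
    rw [← sum_pairWeight_mul hc, ← sum_pairWeight_mul hc, h2 c hc, hcc] at hm
    push_cast at hm
    have hpos : 0 < (n + 2) * w (insert c z) := mul_pos (by linarith) (hwpos c hc)
    refine le_of_mul_le_mul_left ?_ hpos
    calc _ = (n + 1 + 1) * w (insert c z) * _ := by ring
      _ ≤ _ := hm
      _ = _ := by ring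
  have hfin := Finset.sum_le_sum hbound
  rw [← hQc, ← Finset.mul_sum, Finset.sum_add_distrib, ← Finset.mul_sum, ← Finset.mul_sum, hpS,
    ← hS, hQS] at hfin
  have hq : μ ≤ (1 - lam) * μ ^ 2 + lam := by
    have hpos : 0 < (n + 3) * ((n + 2) * S) := by positivity
    refine le_of_mul_le_mul_left ?_ hpos
    linarith
  -- The inequality `hq` factors as `(1 - μ) (lam - (1 - lam) μ) ≥ 0`, and the first factor is
  -- positive.
  rw [le_div_iff₀ hl]
  nlinarith

end SComplex

end

/-! ### Mixing in all links from the hypotheses on the base -/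

noncomputable section

namespace SComplex

variable {V : Type*} [LinearOrder V] {X : SComplex V} {d : ℕ}

theorem exists_vertex (x : X.CardFace 1) : ∃ v, x.1.1 = {v} := Finset.card_eq_one.1 x.2

/-- The vertex of a `0`-face. -/
def vertexOf (x : X.CardFace 1) : V := (exists_vertex x).choose

theorem vertexOf_spec (x : X.CardFace 1) : x.1.1 = {vertexOf x} := (exists_vertex x).choose_spec

theorem singleton_mem_link {z : X.Face} {v : V} :
    ({v} : Finset V) ∈ (X.link z).faces ↔ v ∈ X.linkVerts z.1 := by
  rw [mem_link, mem_linkVerts, Finset.disjoint_singleton_left, Finset.singleton_union]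

theorem vertexOf_mem {z : X.Face} (x : (X.link z).CardFace 1) : vertexOf x ∈ X.linkVerts z.1 := by
  rw [← singleton_mem_link, ← vertexOf_spec]
  exact x.1.2

theorem sum_vertexOf {z : X.Face} (g : V → ℝ) :
    ∑ x : (X.link z).CardFace 1, g (vertexOf x) = ∑ a ∈ X.linkVerts z.1, g a := by
  refine Finset.sum_bij (fun x _ => vertexOf x) (fun x _ => vertexOf_mem x) ?_ ?_ fun _ _ => rfl
  · intro x _ y _ h
    apply Subtype.ext; apply Subtype.ext
    rw [vertexOf_spec x, vertexOf_spec y, h]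
  · intro a ha
    have h1 := singleton_mem_link.2 ha
    refine ⟨⟨⟨{a}, h1⟩, by simp⟩, Finset.mem_univ _, ?_⟩
    have := vertexOf_spec (X := X.link z) ⟨⟨{a}, h1⟩, by simp⟩
    exact (Finset.singleton_injective this).symm

theorem linkConn_of_isConnected (z : X.Face) (h : (X.link z).IsConnected) : X.LinkConn z.1 := by
  intro φ hφ a ha b hb
  have key : ∀ x y : (X.link z).CardFace 1, φ (vertexOf x) = φ (vertexOf y) := by
    intro x y
    obtain ⟨p⟩ := h.preconnected x y
    induction p with
    | nil => rfl
    | @cons x y w hxy _ ih =>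
      rw [← ih]
      have hne : vertexOf x ≠ vertexOf y := fun he => hxy.1 <| by
        apply Subtype.ext; apply Subtype.ext
        rw [vertexOf_spec x, vertexOf_spec y, he]
      have hf := hxy.2
      rw [vertexOf_spec x, vertexOf_spec y, mem_link, Finset.singleton_union,
        Finset.insert_union, Finset.singleton_union] at hf
      exact hφ _ _ hne (mem_linkVerts.1 (vertexOf_mem x)).1 (mem_linkVerts.1 (vertexOf_mem y)).1 hf.2
  have h1 := singleton_mem_link.2 ha
  have h2 := singleton_mem_link.2 hb
  have e1 := vertexOf_spec (X := X.link z) ⟨⟨{a}, h1⟩, by simp⟩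
  have e2 := vertexOf_spec (X := X.link z) ⟨⟨{b}, h2⟩, by simp⟩
  rw [Finset.singleton_injective e1, Finset.singleton_injective e2]
  exact key _ _

/-- Only a change of normalisation: a vertex of the link has weight `w(z ∪ {a}) / ((|z| + 1) w(z))`
there, and the averaging coefficients become `pairWeight` divided by `(|z| + 2) w(z ∪ {a})`. -/
theorem linkMixing_of_isSpectralExpander (hX : X.IsPure d) (z : X.Face) (hz : z.1.card + 1 = d)
    {lam : ℝ} (hlam : 0 ≤ lam) (h : (X.link z).IsSpectralExpander 1 (Set.Icc (-1) lam)) :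
    X.LinkMixing d z.1 lam := by
  classical
  refine linkMixing_of_eigenvalues_le hX (by omega) hlam ?_
  rintro μ φ ⟨a₀, ha₀, hφ⟩ h1 h2
  have hd1 : d - z.1.card = 1 := by omega
  have hwz := weight_pos hX z.2
  have hv : ∀ x : (X.link z).CardFace 1, (X.link z).weight 1 x.1.1 =
      X.weight d (insert (vertexOf x) z.1) / ((z.1.card + 1) * X.weight d z.1) := by
    intro x
    have := weight_link hX (by omega : z.1.card ≤ d) x.1.2
    rw [hd1, x.2, add_comm 1, Nat.choose_succ_self_right] at this
    rw [eq_div_iff (by positivity)]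
    conv_rhs at this => rw [vertexOf_spec x, Finset.singleton_union]
    rw [← this]; push_cast; ring
  have he : ∀ x y : (X.link z).CardFace 1, (if (X.link z).graph.Adj x y then
      (X.link z).weight 1 (x.1.1 ∪ y.1.1) / (2 * (X.link z).weight 1 x.1.1) * φ (vertexOf y)
      else 0) = X.pairWeight d z.1 (vertexOf x) (vertexOf y) * φ (vertexOf y) /
        ((z.1.card + 2) * X.weight d (insert (vertexOf x) z.1)) := by
    intro x y
    have hx := mem_linkVerts.1 (vertexOf_mem x)
    have hy := mem_linkVerts.1 (vertexOf_mem y)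
    by_cases hadj : (X.link z).graph.Adj x y
    · rw [if_pos hadj]
      have hne : vertexOf x ≠ vertexOf y := fun he => hadj.1 <| by
        apply Subtype.ext; apply Subtype.ext
        rw [vertexOf_spec x, vertexOf_spec y, he]
      have hf := hadj.2
      have hu : x.1.1 ∪ y.1.1 = {vertexOf x, vertexOf y} := by
        rw [vertexOf_spec x, vertexOf_spec y]; rfl
      have hw := weight_link hX (by omega : z.1.card ≤ d) hf
      have hc : (x.1.1 ∪ y.1.1).card = 2 := by rw [hu, Finset.card_pair hne]
      have hu2 : x.1.1 ∪ y.1.1 ∪ z.1 = insert (vertexOf x) (insert (vertexOf y) z.1) := by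
        rw [hu]; simp [Finset.insert_union]
      have hf2 := hf
      rw [mem_link, hu2] at hf2
      rw [hd1, hc, hu2, add_comm 2, Nat.choose_symm_add] at hw
      have hch : ((z.1.card + 2).choose 2 : ℝ) = (z.1.card + 2) * (z.1.card + 1) / 2 := by
        rw [Nat.cast_choose_two]; push_cast; ring
      rw [hch] at hw
      rw [pairWeight, if_pos ⟨hne, hx.1, hy.1, hf2.2⟩, hv x, ← hw]
      have := weight_pos hX hx.2
      field_simp
    · rw [if_neg hadj, pairWeight, if_neg, zero_mul, zero_div]
      rintro ⟨g1, g2, g3, g4⟩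
      apply hadj
      refine ⟨fun he => g1 (he ▸ rfl), ?_⟩
      rw [mem_link, vertexOf_spec x, vertexOf_spec y, Finset.singleton_union,
        Finset.insert_union, Finset.singleton_union]
      refine ⟨?_, g4⟩
      simp [g2, g3]
  have := h μ (fun x => φ (vertexOf x)) ?_ ?_ ?_
  · exact this.2
  · intro h0
    have h3 := singleton_mem_link.2 ha₀
    have e1 := vertexOf_spec (X := X.link z) ⟨⟨{a₀}, h3⟩, by simp⟩
    have := congrFun h0 ⟨⟨{a₀}, h3⟩, by simp⟩
    simp only [Pi.zero_apply] at this
    rw [← Finset.singleton_injective e1] at this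
    exact hφ this
  · simp only [hv]
    rw [sum_vertexOf (fun a => X.weight d (insert a z.1) / ((z.1.card + 1) * X.weight d z.1) * φ a)]
    simp only [div_mul_eq_mul_div, ← Finset.sum_div]
    rw [h1, zero_div]
  · funext x
    have hx := vertexOf_mem x
    have hp := weight_pos hX (mem_linkVerts.1 hx).2
    simp only [adjacency, he]
    rw [sum_vertexOf (fun b => X.pairWeight d z.1 (vertexOf x) b * φ b /
        ((z.1.card + 2) * X.weight d (insert (vertexOf x) z.1))), ← Finset.sum_div, h2 _ hx,
        Pi.smul_apply, smul_eq_mul]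
    field_simp

/-- Each trickling-down step replaces the bound `x` by `x / (1 - x)`; starting from `lam`, the
`j`-th iterate is `lam / (1 - j lam)`. -/
theorem div_div_one_sub {lam : ℝ} {j : ℕ} (h : 1 - j * lam ≠ 0) :
    lam / (1 - j * lam) / (1 - lam / (1 - j * lam)) = lam / (1 - (j + 1 : ℕ) * lam) := by
  rw [div_div, mul_sub, mul_div_cancel₀ _ h]
  push_cast
  congr 1
  ring

theorem linkMixing_of_isCodimTwoSpectralExpander (hX : X.IsPure d)
    (hs : X.IsStronglyConnected d) {lam : ℝ} (hlam : 0 < lam) (hlamd : lam * d ≤ 1)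
    (h : X.IsCodimTwoSpectralExpander d (Set.Icc (-1) lam)) (j : ℕ) :
    ∀ z ∈ X.faces, z.card + j + 1 = d → X.LinkMixing d z (lam / (1 - j * lam)) := by
  induction j with
  | zero =>
    intro z hz hc
    simp only [Nat.cast_zero, zero_mul, sub_zero, div_one]
    exact linkMixing_of_isSpectralExpander hX ⟨z, hz⟩ hc hlam.le (h ⟨z, hz⟩ (by simp; omega))
  | succ j ih =>
    intro z hz hc
    -- The room `j + 2 ≤ d`, together with `lam * d ≤ 1`, keeps the current iterate strictly below
    -- `1`, as the next trickling-down step requires.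
    have hj : lam * (j + 2) ≤ lam * d := by
      refine mul_le_mul_of_nonneg_left ?_ hlam.le
      rw [← hc]; push_cast
      have : (0 : ℝ) ≤ z.card := by positivity
      linarith
    have h1 : 0 < 1 - j * lam := by linarith
    have h2 : lam / (1 - j * lam) < 1 := by rw [div_lt_one h1]; linarith
    have := linkMixing_of_forall_insert hX (z := z) (by omega) (div_nonneg hlam.le h1.le) h2
      (linkConn_of_isConnected ⟨z, hz⟩ (hs ⟨z, hz⟩ (by simp; omega))) fun c hc' => by
        rw [mem_linkVerts] at hc'
        exact ih _ hc'.2 (by rw [Finset.card_insert_of_notMem hc'.1]; omega)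
    rwa [div_div_one_sub h1.ne'] at this

/-- The expander mixing inequality for edges inside `S`, obtained from the indicator function of
`S`: their relative weight is at most the square of that of `S`, plus `lam'` times that of `S`. -/
theorem LinkMixing.sum_le {z : Finset V} {lam lam' : ℝ} (h : X.LinkMixing d z lam) (h0 : 0 ≤ lam)
    (hl : lam ≤ lam') {S : Finset V} (hS : S ⊆ X.linkVerts z) :
    ((z.card + 1) * X.weight d z) * ∑ a ∈ S, ∑ b ∈ S, X.pairWeight d z a b ≤
      (z.card + 2) * ((∑ a ∈ S, X.weight d (insert a z)) ^ 2 +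
        lam' * (((z.card + 1) * X.weight d z) * ∑ a ∈ S, X.weight d (insert a z))) := by
  classical
  have h1 := h (fun v => if v ∈ S then 1 else 0)
  have e : ∀ g : V → ℝ, ∑ a ∈ X.linkVerts z, (if a ∈ S then g a else 0) = ∑ a ∈ S, g a := by
    intro g
    rw [← Finset.sum_filter, Finset.filter_mem_eq_inter, Finset.inter_eq_right.2 hS]
  simp only [mul_ite, mul_one, mul_zero, ite_pow, one_pow, ne_eq, OfNat.ofNat_ne_zero,
    not_false_eq_true, zero_pow] at h1
  rw [e, ← e (fun a => ∑ b ∈ S, X.pairWeight d z a b)] at *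
  have e2 : ∀ a ∈ X.linkVerts z, (∑ b ∈ X.linkVerts z, if b ∈ S then
      (if a ∈ S then X.pairWeight d z a b else 0) else 0) =
      if a ∈ S then ∑ b ∈ S, X.pairWeight d z a b else 0 := by
    intro a _
    rw [e]
    split_ifs <;> simp
  rw [Finset.sum_congr rfl e2] at h1
  refine h1.trans ?_
  have hw := weight_nonneg (X := X) (d := d)
  have hs : 0 ≤ ∑ a ∈ S, X.weight d (insert a z) := Finset.sum_nonneg fun a _ => hw _
  gcongr
  · exact mul_le_of_le_one_left (by positivity) (by linarith)
  · exact mul_nonneg (mul_nonneg (by positivity) (hw z)) hs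

end SComplex

end

/-! ### Fat faces, tame faces and ladders -/

noncomputable section

open scoped Classical in
theorem sum_le_sum_sum_of_cover {α β : Type*} {s : Finset α} {T : Finset β} {U : β → Finset α}
    {w : α → ℝ} (hw : ∀ x, 0 ≤ w x) (h : ∀ x ∈ s, ∃ t ∈ T, x ∈ U t) :
    ∑ x ∈ s, w x ≤ ∑ t ∈ T, ∑ x ∈ U t, w x := by
  calc ∑ x ∈ s, w x ≤ ∑ x ∈ s, ∑ t ∈ T, if x ∈ U t then w x else 0 := by
        refine Finset.sum_le_sum fun x hx => ?_
        obtain ⟨t, ht, hxt⟩ := h x hx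
        refine le_trans (by rw [if_pos hxt]) (Finset.single_le_sum
          (f := fun t => if x ∈ U t then w x else 0) (fun t _ => ?_) ht)
        split_ifs <;> simp [hw x]
    _ = ∑ t ∈ T, ∑ x ∈ s, if x ∈ U t then w x else 0 := Finset.sum_comm
    _ ≤ ∑ t ∈ T, ∑ x ∈ U t, w x := by
        refine Finset.sum_le_sum fun t _ => ?_
        rw [← Finset.sum_filter]
        exact Finset.sum_le_sum_of_subset_of_nonneg
          (fun x hx => (Finset.mem_filter.1 hx).2) fun x _ _ => hw x

theorem sum_le_sum_of_exists {α β : Type*} {s : Finset α} {T : Finset β} {w : α → ℝ} {g : β → ℝ}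
    (hg : ∀ t ∈ T, 0 ≤ g t) (e : β → α) (h : ∀ x ∈ s, ∃ t ∈ T, e t = x ∧ w x ≤ g t) :
    ∑ x ∈ s, w x ≤ ∑ t ∈ T, g t := by
  classical
  rcases isEmpty_or_nonempty β with hβ | hβ
  · have : s = ∅ := Finset.eq_empty_of_forall_notMem fun x hx => isEmptyElim (h x hx).choose
    rw [this, Finset.sum_empty]
    exact Finset.sum_nonneg hg
  choose! f hf1 hf2 hf3 using h
  calc ∑ x ∈ s, w x ≤ ∑ x ∈ s, g (f x) := Finset.sum_le_sum hf3
    _ = ∑ t ∈ s.image f, g t := by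
        rw [Finset.sum_image]
        intro a ha b hb hab
        rw [← hf2 a ha, ← hf2 b hb, hab]
    _ ≤ _ := Finset.sum_le_sum_of_subset_of_nonneg (Finset.image_subset_iff.2 hf1)
        fun t ht _ => hg t ht

open scoped Classical in
theorem sum_sum_filter_le {α β : Type*} {s : Finset α} {T : Finset β} {R : β → α → Prop}
    {w : α → ℝ} (hw : ∀ x, 0 ≤ w x) {C : ℝ} (h : ∀ x ∈ s, ((T.filter fun t => R t x).card : ℝ) ≤ C) :
    ∑ t ∈ T, ∑ x ∈ s.filter (R t), w x ≤ C * ∑ x ∈ s, w x := by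
  simp only [Finset.sum_filter]
  rw [Finset.sum_comm, Finset.mul_sum]
  refine Finset.sum_le_sum fun x hx => ?_
  rw [← Finset.sum_filter, Finset.sum_const, nsmul_eq_mul]
  exact mul_le_mul_of_nonneg_right (h x hx) (hw x)

namespace SComplex

variable {V : Type*} [LinearOrder V] {X : SComplex V} {d : ℕ}

/-- The fat faces of a set `A` of faces with `K` vertices: a face with `K - j - 1` vertices is
fat if the fat faces with `K - j` vertices have relative weight at least `h ^ (2 ^ j)` around
it. -/
def fat (X : SComplex V) (d K : ℕ) (h : ℝ) (A : Finset (Finset V)) : ℕ → Finset (Finset V)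
  | 0 => A
  | j + 1 => X.faces.filter fun z => z.card + (j + 1) = K ∧
      h ^ (2 ^ j) * ((z.card + 1) * X.weight d z) ≤
        ∑ x ∈ (fat X d K h A j).filter (fun x => z ⊆ x), X.weight d x

variable {K : ℕ} {h : ℝ} {A : Finset (Finset V)}

theorem fat_spec (hA : ∀ x ∈ A, x ∈ X.faces ∧ x.card = K) {j : ℕ} {z : Finset V}
    (hz : z ∈ X.fat d K h A j) : z ∈ X.faces ∧ z.card + j = K := by
  cases j with
  | zero => exact hA z hz
  | succ j =>
    simp only [fat, Finset.mem_filter] at hz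
    exact ⟨hz.1, hz.2.1⟩

theorem card_filter_facets_le {x : Finset V} {n : ℕ} (hx : x.card = n + 1)
    (T : Finset (Finset V)) (hT : ∀ z ∈ T, z.card = n) :
    ((T.filter fun z => z ⊆ x).card : ℝ) ≤ n + 1 := by
  have : T.filter (fun z => z ⊆ x) ⊆ x.powersetCard n := by
    intro z hz
    rw [Finset.mem_filter] at hz
    exact Finset.mem_powersetCard.2 ⟨hz.2, hT z hz.1⟩
  have := Finset.card_le_card this
  rw [Finset.card_powersetCard, hx, Nat.choose_succ_self_right] at this
  exact_mod_cast this

/-- The total weight of the fat faces of level `j`. -/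
def fatWeight (X : SComplex V) (d K : ℕ) (h : ℝ) (A : Finset (Finset V)) (j : ℕ) : ℝ :=
  ∑ z ∈ X.fat d K h A j, X.weight d z

theorem fatWeight_nonneg (j : ℕ) : 0 ≤ X.fatWeight d K h A j :=
  Finset.sum_nonneg fun _ _ => weight_nonneg _

theorem sum_fat_filter_le (hA : ∀ x ∈ A, x ∈ X.faces ∧ x.card = K) {j n : ℕ} (hj : n + j + 1 = K)
    (T : Finset (Finset V)) (hT : ∀ z ∈ T, z.card = n) :
    ∑ z ∈ T, ∑ x ∈ (X.fat d K h A j).filter (fun x => z ⊆ x), X.weight d x ≤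
      (n + 1) * X.fatWeight d K h A j := by
  classical
  refine (le_of_eq ?_).trans (sum_sum_filter_le (s := X.fat d K h A j) (T := T)
    (R := fun z x => z ⊆ x) (w := X.weight d) (fun x => weight_nonneg x) (C := n + 1) ?_)
  · exact Finset.sum_congr rfl fun z _ => by congr
  · intro x hx
    have := (fat_spec hA hx).2
    convert card_filter_facets_le (x := x) (n := n) (by omega) T hT

/-- Sum the fatness inequality over the fat faces of the next level. A face with `n + 1` vertices
has `n + 1` facets, which cancels the factor `|z| + 1` in the definition of `fat`. -/
theorem fatWeight_succ_le (hA : ∀ x ∈ A, x ∈ X.faces ∧ x.card = K) (j : ℕ) :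
    h ^ (2 ^ j) * X.fatWeight d K h A (j + 1) ≤ X.fatWeight d K h A j := by
  rcases Nat.lt_or_ge j K with hj | hj
  · obtain ⟨n, hn⟩ : ∃ n, n + j + 1 = K := ⟨K - j - 1, by omega⟩
    have hc : ∀ z ∈ X.fat d K h A (j + 1), z.card = n := fun z hz => by
      have := (fat_spec hA hz).2; omega
    have h1 := sum_fat_filter_le (d := d) (h := h) hA hn (X.fat d K h A (j + 1)) hc
    have h2 : ∑ z ∈ X.fat d K h A (j + 1), h ^ (2 ^ j) * ((n + 1) * X.weight d z) ≤
        ∑ z ∈ X.fat d K h A (j + 1),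
          ∑ x ∈ (X.fat d K h A j).filter (fun x => z ⊆ x), X.weight d x := by
      refine Finset.sum_le_sum fun z hz => ?_
      rw [← hc z hz]
      simp only [fat, Finset.mem_filter] at hz
      exact hz.2.2
    rw [← Finset.mul_sum, ← Finset.mul_sum] at h2
    have h3 : (0 : ℝ) < n + 1 := by positivity
    refine le_of_mul_le_mul_left ?_ h3
    calc _ = h ^ (2 ^ j) * ((n + 1) * X.fatWeight d K h A (j + 1)) := by ring
      _ ≤ _ := h2.trans h1
  · have : X.fatWeight d K h A (j + 1) = 0 := by
      refine Finset.sum_eq_zero fun z hz => ?_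
      have := (fat_spec hA hz).2; omega
    rw [this, mul_zero]
    exact fatWeight_nonneg j

/-- The thresholds of the first `j` levels multiply to `h` to the power `1 + 2 + ⋯ + 2^(j-1) = 2^j -
1`. -/
theorem pow_mul_fatWeight_le (hA : ∀ x ∈ A, x ∈ X.faces ∧ x.card = K) (hh : 0 ≤ h) (j : ℕ) :
    h ^ (2 ^ j - 1) * X.fatWeight d K h A j ≤ X.fatWeight d K h A 0 := by
  induction j with
  | zero => simp
  | succ j ih =>
    refine le_trans ?_ ih
    have : 2 ^ (j + 1) - 1 = (2 ^ j - 1) + 2 ^ j := by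
      have := Nat.one_le_two_pow (n := j); omega
    rw [this, pow_add, mul_assoc]
    exact mul_le_mul_of_nonneg_left (fatWeight_succ_le hA j) (by positivity)

/-- The empty face alone has weight `1`, more than the fat faces of the last level can have in total
when `A` is light. This later makes every terminal face nonempty, so that local expansion around it
is available. -/
theorem empty_not_mem_fat (hX : X.IsPure d) (hA : ∀ x ∈ A, x ∈ X.faces ∧ x.card = K) (hh : 0 ≤ h)
    (hsmall : X.fatWeight d K h A 0 < h ^ (2 ^ K - 1)) : ∅ ∉ X.fat d K h A K := by
  intro he
  have h1 : 1 ≤ X.fatWeight d K h A K := by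
    rw [← weight_empty hX]
    exact Finset.single_le_sum (f := X.weight d) (fun z _ => weight_nonneg z) he
  have h2 := pow_mul_fatWeight_le (d := d) hA hh K
  have h3 : h ^ (2 ^ K - 1) ≤ h ^ (2 ^ K - 1) * X.fatWeight d K h A K :=
    le_mul_of_one_le_right (by positivity) h1
  linarith

open scoped Classical in
/-- The faces that are the union of two fat adjacent faces of level `j` with a non-fat
intersection. -/
def badFaces (X : SComplex V) (d K : ℕ) (h : ℝ) (A : Finset (Finset V)) (j : ℕ) :
    Finset (Finset V) :=
  X.faces.filter fun t => t.card + j = K + 1 ∧ ∃ x ∈ X.fat d K h A j, ∃ x' ∈ X.fat d K h A j,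
    x ≠ x' ∧ x ∪ x' = t ∧ x ∩ x' ∉ X.fat d K h A (j + 1)

theorem exists_of_mem_badFaces (hA : ∀ x ∈ A, x ∈ X.faces ∧ x.card = K) {j : ℕ} {t : Finset V}
    (ht : t ∈ X.badFaces d K h A j) : ∃ z ∈ X.faces, z.card + j + 1 = K ∧
      z ∉ X.fat d K h A (j + 1) ∧ ∃ a b, insert a z ∈ X.fat d K h A j ∧
      insert b z ∈ X.fat d K h A j ∧ a ≠ b ∧ a ∉ z ∧ b ∉ z ∧ t = insert a (insert b z) := by
  simp only [badFaces, Finset.mem_filter] at ht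
  obtain ⟨htf, hc, x, hx, x', hx', hne, hu, hi⟩ := ht
  have hxc := (fat_spec hA hx).2
  have hxc' := (fat_spec hA hx').2
  have hcc := Finset.card_union_add_card_inter x x'
  rw [hu] at hcc
  have cov : ∀ y, x ∩ x' ⊆ y → y.card = (x ∩ x').card + 1 → ∃ a, a ∉ x ∩ x' ∧
      insert a (x ∩ x') = y := by
    intro y hy hyc
    obtain ⟨a, ha, h⟩ := Finset.covBy_iff_exists_insert.1
      (Finset.covBy_iff_card_sdiff_eq_one.2 ⟨hy, by rw [Finset.card_sdiff_of_subset hy]; omega⟩)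
    exact ⟨a, ha, h⟩
  obtain ⟨a, ha, hax⟩ := cov x Finset.inter_subset_left (by omega)
  obtain ⟨b, hb, hbx⟩ := cov x' Finset.inter_subset_right (by omega)
  refine ⟨x ∩ x', X.down_closed (fat_spec hA hx).1 Finset.inter_subset_left, by omega, hi, a, b,
    hax.symm ▸ hx, hbx.symm ▸ hx', ?_, ha, hb, ?_⟩
  · rintro rfl
    exact hne (hax.symm.trans hbx)
  · rw [hbx, ← hu]
    conv_lhs => rw [← hax, Finset.insert_union]
    rw [Finset.union_eq_right.2 Finset.inter_subset_right]

theorem sum_fat_filter_eq (hA : ∀ x ∈ A, x ∈ X.faces ∧ x.card = K) {j : ℕ} {z : Finset V}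
    (hz : z.card + j + 1 = K) :
    ∑ x ∈ (X.fat d K h A j).filter (fun x => z ⊆ x), X.weight d x =
      ∑ a ∈ (X.linkVerts z).filter (fun a => insert a z ∈ X.fat d K h A j),
        X.weight d (insert a z) := by
  symm
  refine Finset.sum_bij (fun a _ => insert a z) ?_ ?_ ?_ fun _ _ => rfl
  · intro a ha
    simp only [Finset.mem_filter] at ha ⊢
    exact ⟨ha.2, Finset.subset_insert _ _⟩
  · intro a ha b hb h
    simp only [Finset.mem_filter, mem_linkVerts] at ha hb
    have : a ∈ insert b z := h ▸ Finset.mem_insert_self a z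
    exact (Finset.mem_insert.1 this).resolve_right ha.1.1
  · intro x hx
    simp only [Finset.mem_filter] at hx
    have hs := fat_spec hA hx.1
    obtain ⟨a, ha, h⟩ := Finset.covBy_iff_exists_insert.1
      (Finset.covBy_iff_card_sdiff_eq_one.2
        ⟨hx.2, by rw [Finset.card_sdiff_of_subset hx.2]; omega⟩)
    refine ⟨a, ?_, h⟩
    simp only [Finset.mem_filter, mem_linkVerts, h]
    exact ⟨⟨ha, hs.1⟩, hx.1⟩

/-- As `z` is not fat, its fat neighbours occupy less than the proportion `h ^ (2 ^ j)` of the link.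
The mixing inequality then says that few edges join two of them. -/
theorem sum_pairWeight_fat_le (hX : X.IsPure d)
    (hA : ∀ x ∈ A, x ∈ X.faces ∧ x.card = K) {lam lam' : ℝ} (hl0 : 0 ≤ lam) (hl1 : lam ≤ lam')
    {j n : ℕ} (hj : n + j + 1 = K) {z : Finset V} (hz : z ∈ X.faces) (hzc : z.card = n)
    (hznf : z ∉ X.fat d K h A (j + 1)) (hmix : X.LinkMixing d z lam) :
    ∑ a ∈ (X.linkVerts z).filter (fun a => insert a z ∈ X.fat d K h A j),
      ∑ b ∈ (X.linkVerts z).filter (fun a => insert a z ∈ X.fat d K h A j),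
        X.pairWeight d z a b ≤ (n + 2) * ((h ^ (2 ^ j) + lam') *
        ∑ x ∈ (X.fat d K h A j).filter (fun x => z ⊆ x), X.weight d x) := by
  have e2 := sum_fat_filter_eq (d := d) (h := h) hA (z := z) (j := j) (by omega)
  have hm := hmix.sum_le hl0 hl1
    (S := (X.linkVerts z).filter (fun a => insert a z ∈ X.fat d K h A j))
    (Finset.filter_subset _ _)
  rw [← e2] at hm
  set σ := ∑ x ∈ (X.fat d K h A j).filter (fun x => z ⊆ x), X.weight d x with hσ
  have hσ0 : 0 ≤ σ := Finset.sum_nonneg fun a _ => weight_nonneg _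
  have hσ1 : σ ≤ h ^ (2 ^ j) * ((z.card + 1) * X.weight d z) := by
    by_contra hlt
    apply hznf
    simp only [fat, Finset.mem_filter]
    exact ⟨hz, by omega, by rw [← hσ]; linarith⟩
  have hwz := weight_pos hX hz
  have hpos : 0 < (z.card + 1 : ℝ) * X.weight d z := by positivity
  refine le_of_mul_le_mul_left (hm.trans ?_) hpos
  rw [hzc] at hσ1 hpos ⊢
  clear_value σ
  generalize h ^ (2 ^ j) = η at hσ1 ⊢
  generalize X.weight d z = ω at hσ1 hpos ⊢
  have h3 := mul_le_mul_of_nonneg_left hσ1 hσ0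
  have hn : (0 : ℝ) ≤ n + 2 := by positivity
  have h4 := mul_le_mul_of_nonneg_left h3 hn
  linarith

open scoped Classical in
theorem sum_badFaces_le_sum (hA : ∀ x ∈ A, x ∈ X.faces ∧ x.card = K) (j : ℕ) :
    ∑ t ∈ X.badFaces d K h A j, X.weight d t ≤
      ∑ z ∈ X.faces.filter (fun z => z.card + j + 1 = K ∧ z ∉ X.fat d K h A (j + 1)),
        ∑ a ∈ (X.linkVerts z).filter (fun a => insert a z ∈ X.fat d K h A j),
          ∑ b ∈ (X.linkVerts z).filter (fun a => insert a z ∈ X.fat d K h A j),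
            X.pairWeight d z a b := by
  have := sum_le_sum_of_exists (s := X.badFaces d K h A j) (w := X.weight d)
    (T := (X.faces.filter (fun z => z.card + j + 1 = K ∧ z ∉ X.fat d K h A (j + 1))).sigma
      fun z => ((X.linkVerts z).filter (fun a => insert a z ∈ X.fat d K h A j)) ×ˢ
        ((X.linkVerts z).filter (fun a => insert a z ∈ X.fat d K h A j)))
    (g := fun t => X.pairWeight d t.1 t.2.1 t.2.2) (fun t _ => pairWeight_nonneg _ _ _)
    (fun t => insert t.2.1 (insert t.2.2 t.1)) ?_
  · refine this.trans (le_of_eq ?_)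
    rw [Finset.sum_sigma]
    exact Finset.sum_congr rfl fun z _ => Finset.sum_product _ _ _
  · intro t ht
    have htf := (Finset.mem_filter.1 ht).1
    obtain ⟨z, hz, hc, hzf, a, b, ha, hb, hab, haz, hbz, rfl⟩ := exists_of_mem_badFaces hA ht
    refine ⟨⟨z, a, b⟩, ?_, rfl, ?_⟩
    · simp only [Finset.mem_sigma, Finset.mem_product, Finset.mem_filter, mem_linkVerts]
      exact ⟨⟨hz, hc, hzf⟩, ⟨⟨haz, (fat_spec hA ha).1⟩, ha⟩, ⟨hbz, (fat_spec hA hb).1⟩, hb⟩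
    · rw [pairWeight, if_pos ⟨hab, haz, hbz, htf⟩]

theorem sum_badFaces_le (hX : X.IsPure d)
    (hA : ∀ x ∈ A, x ∈ X.faces ∧ x.card = K) {lam' : ℝ} (hh : 0 ≤ h)
    (hmix : ∀ z ∈ X.faces, z.card < K → ∃ lam, 0 ≤ lam ∧ lam ≤ lam' ∧ X.LinkMixing d z lam)
    {j n : ℕ} (hj : n + j + 1 = K) :
    ∑ t ∈ X.badFaces d K h A j, X.weight d t ≤
      (n + 2) * (n + 1) * (h ^ (2 ^ j) + lam') * X.fatWeight d K h A j := by
  classical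
  have hl' : 0 ≤ lam' := by
    obtain ⟨lam, h0, h1, -⟩ := hmix ∅ X.empty_mem (by rw [Finset.card_empty]; omega)
    exact h0.trans h1
  refine (sum_badFaces_le_sum hA j).trans ?_
  have hinner : ∀ z ∈ X.faces.filter
      (fun z => z.card + j + 1 = K ∧ z ∉ X.fat d K h A (j + 1)),
      ∑ a ∈ (X.linkVerts z).filter (fun a => insert a z ∈ X.fat d K h A j),
          ∑ b ∈ (X.linkVerts z).filter (fun a => insert a z ∈ X.fat d K h A j),
            X.pairWeight d z a b ≤ (n + 2) * ((h ^ (2 ^ j) + lam') *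
        ∑ x ∈ (X.fat d K h A j).filter (fun x => z ⊆ x), X.weight d x) := by
    intro z hz
    obtain ⟨hzf, hzc, hznf⟩ := Finset.mem_filter.1 hz
    obtain ⟨lam, hl0, hl1, hmz⟩ := hmix z hzf (by omega)
    exact sum_pairWeight_fat_le hX hA hl0 hl1 hj hzf (by omega) hznf hmz
  refine (Finset.sum_le_sum hinner).trans ?_
  rw [← Finset.mul_sum, ← Finset.mul_sum]
  have h1 := sum_fat_filter_le (d := d) (h := h) hA hj (X.faces.filter
      (fun z => z.card + j + 1 = K ∧ z ∉ X.fat d K h A (j + 1)))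
    (fun z hz => by have := (Finset.mem_filter.1 hz).2.1; omega)
  calc _ ≤ ((n : ℝ) + 2) * ((h ^ (2 ^ j) + lam') * ((n + 1) * X.fatWeight d K h A j)) := by
        gcongr
    _ = _ := by ring

/-- A face with `K + 1` vertices is tame if it contains no bad face. -/
def IsTame (X : SComplex V) (d K : ℕ) (h : ℝ) (A : Finset (Finset V)) (y : Finset V) : Prop :=
  ∀ j < K, ∀ t ∈ X.badFaces d K h A j, ¬ t ⊆ y

theorem choose_mul_mul {n j : ℕ} (hj : n + j + 1 = K) :
    (((K + 1).choose (n + 2) : ℝ)) * ((n + 2) * (n + 1)) = (K + 1) * K * (K - 1).choose n := by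
  obtain ⟨L, rfl⟩ : ∃ L, K = L + 1 := ⟨K - 1, by omega⟩
  have h1 := Nat.add_one_mul_choose_eq (L + 1) (n + 1)
  have h2 := Nat.add_one_mul_choose_eq L n
  have h1' : ((L + 1 + 1 : ℝ)) * ((L + 1).choose (n + 1)) =
    ((L + 1 + 1).choose (n + 1 + 1)) * (n + 1 + 1) := by exact_mod_cast h1
  have h2' : ((L + 1 : ℝ)) * (L.choose n) = ((L + 1).choose (n + 1)) * (n + 1) := by
    exact_mod_cast h2
  simp only [Nat.add_sub_cancel]
  push_cast
  rw [show n + 2 = n + 1 + 1 by ring]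
  linear_combination (-(n : ℝ) - 1) * h1' - (L + 2 : ℝ) * h2'

open scoped Classical in
-- A face that is not tame contains a bad face of some level `j`, with `K + 1 - j` vertices. The
-- weight of the bad faces of each level is controlled by mixing, and passing to faces with `K + 1`
-- vertices costs a binomial coefficient. Summing these over the levels produces the power of two.
theorem sum_not_tame_le (hX : X.IsPure d) (hK : K ≤ d)
    (hA : ∀ x ∈ A, x ∈ X.faces ∧ x.card = K) {lam' : ℝ} (hh : 0 ≤ h) (hh1 : h ≤ 1)
    (hlam' : lam' ≤ h ^ (2 ^ (K - 1)))
    (hmix : ∀ z ∈ X.faces, z.card < K → ∃ lam, 0 ≤ lam ∧ lam ≤ lam' ∧ X.LinkMixing d z lam) :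
    ∑ y ∈ X.faces.filter (fun y => y.card = K + 1 ∧ ¬ X.IsTame d K h A y), X.weight d y ≤
      h * (K * (K + 1)) * 2 ^ K * X.fatWeight d K h A 0 := by
  have hcover := sum_le_sum_sum_of_cover
    (s := X.faces.filter (fun y => y.card = K + 1 ∧ ¬ X.IsTame d K h A y))
    (T := (Finset.range K).sigma fun j => X.badFaces d K h A j)
    (U := fun t => X.faces.filter fun y => y.card = K + 1 ∧ t.2 ⊆ y)
    (w := X.weight d) (fun x => weight_nonneg x) (by
      intro y hy
      simp only [Finset.mem_filter, IsTame, not_forall, not_not] at hy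
      obtain ⟨hyf, hyc, j, hj, t, ht, hty⟩ := hy
      exact ⟨⟨j, t⟩, by simp [hj, ht], by simp [hyf, hyc, hty]⟩)
  refine hcover.trans ?_
  rw [Finset.sum_sigma]
  have hterm : ∀ j ∈ Finset.range K, ∑ t ∈ X.badFaces d K h A j,
      ∑ y ∈ X.faces.filter (fun y => y.card = K + 1 ∧ t ⊆ y), X.weight d y ≤
      (K - 1).choose (K - 1 - j) * (2 * h * (K * (K + 1)) * X.fatWeight d K h A 0) := by
    intro j hj
    rw [Finset.mem_range] at hj
    obtain ⟨n, hn⟩ : ∃ n, n + j + 1 = K := ⟨K - j - 1, by omega⟩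
    have h1 : ∀ t ∈ X.badFaces d K h A j,
        ∑ y ∈ X.faces.filter (fun y => y.card = K + 1 ∧ t ⊆ y), X.weight d y =
        (K + 1).choose (n + 2) * X.weight d t := by
      intro t ht
      have htc := (Finset.mem_filter.1 ht).2.1
      rw [sum_weight hX (by omega) (by omega), show t.card = n + 2 by omega]
    rw [Finset.sum_congr rfl h1, ← Finset.mul_sum]
    have h2 := sum_badFaces_le hX hA hh hmix hn
    have hle : h ^ (2 ^ (K - 1)) ≤ h ^ (2 ^ j) :=
      pow_le_pow_of_le_one hh hh1 (Nat.pow_le_pow_right (by norm_num) (by omega))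
    have hfw := fatWeight_nonneg (X := X) (d := d) (K := K) (h := h) (A := A) j
    -- The doubling of exponents pays off here: the proportion gained at level `j` is `h ^ (2 ^ j) =
    -- h * h ^ (2 ^ j - 1)`. The second factor compensates for the possible growth of the fat weight
    -- up to level `j`, so a net factor `h` remains at every level.
    have h3 : (h ^ (2 ^ j) + lam') * X.fatWeight d K h A j ≤ 2 * h * X.fatWeight d K h A 0 := by
      have h4 := pow_mul_fatWeight_le (d := d) hA hh j
      have h5 : h ^ (2 ^ j) = h * h ^ (2 ^ j - 1) := by
        rw [← pow_succ', Nat.sub_add_cancel Nat.one_le_two_pow]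
      calc (h ^ (2 ^ j) + lam') * X.fatWeight d K h A j
          ≤ (h ^ (2 ^ j) + h ^ (2 ^ j)) * X.fatWeight d K h A j := by gcongr; linarith
        _ = 2 * h * (h ^ (2 ^ j - 1) * X.fatWeight d K h A j) := by rw [h5]; ring
        _ ≤ _ := by gcongr
    calc ((K + 1).choose (n + 2) : ℝ) * ∑ t ∈ X.badFaces d K h A j, X.weight d t
        ≤ ((K + 1).choose (n + 2) : ℝ) * ((n + 2) * (n + 1) * (h ^ (2 ^ j) + lam') *
            X.fatWeight d K h A j) := by gcongr
      _ = ((K + 1).choose (n + 2) : ℝ) * ((n + 2) * (n + 1)) *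
          ((h ^ (2 ^ j) + lam') * X.fatWeight d K h A j) := by ring
      _ ≤ ((K + 1).choose (n + 2) : ℝ) * ((n + 2) * (n + 1)) *
          (2 * h * X.fatWeight d K h A 0) := by gcongr
      _ = _ := by
        rw [choose_mul_mul hn, show K - 1 - j = n by omega]; ring
  refine (Finset.sum_le_sum hterm).trans ?_
  rw [← Finset.sum_mul]
  rcases Nat.eq_zero_or_pos K with rfl | hKpos
  · simp
  · obtain ⟨L, rfl⟩ : ∃ L, K = L + 1 := ⟨K - 1, by omega⟩
    have : ∑ j ∈ Finset.range (L + 1), ((L + 1 - 1).choose (L + 1 - 1 - j) : ℝ) = 2 ^ L := by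
      simp only [Nat.add_sub_cancel]
      have e : ∀ j ∈ Finset.range (L + 1), (L.choose (L - j) : ℝ) = L.choose j := by
        intro j hj
        rw [Nat.choose_symm (by simpa [Nat.lt_succ_iff] using hj)]
      rw [Finset.sum_congr rfl e]
      exact_mod_cast Nat.sum_range_choose L
    rw [this, pow_succ]
    exact le_of_eq (by ring)

/-- There is a chain of fat faces, each of codimension one in the preceding one, that leads from
the element `x` of `A` to the fat face `z` of level `j`. -/
def Ladder (X : SComplex V) (d K : ℕ) (h : ℝ) (A : Finset (Finset V)) :
    ℕ → Finset V → Finset V → Prop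
  | 0, x, z => x = z ∧ z ∈ A
  | j + 1, x, z => z ∈ X.fat d K h A (j + 1) ∧ ∃ z', z ⊆ z' ∧ Ladder X d K h A j x z'

theorem Ladder.mem_fat : ∀ {j : ℕ} {x z : Finset V}, X.Ladder d K h A j x z → z ∈ X.fat d K h A j
  | 0, _, _, hl => hl.2
  | _ + 1, _, _, hl => hl.1

theorem Ladder.subset : ∀ {j : ℕ} {x z : Finset V}, X.Ladder d K h A j x z → z ⊆ x
  | 0, _, _, hl => hl.1 ▸ Finset.Subset.refl _
  | _ + 1, _, _, hl => by
    obtain ⟨_, z', hz, hl'⟩ := hl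
    exact hz.trans hl'.subset

theorem inter_mem_fat (hA : ∀ x ∈ A, x ∈ X.faces ∧ x.card = K) {y : Finset V} (hy : y ∈ X.faces)
    (ht : X.IsTame d K h A y) {j : ℕ} (hj : j < K) {x x' : Finset V}
    (hx : x ∈ X.fat d K h A j) (hx' : x' ∈ X.fat d K h A j) (hne : x ≠ x') (hxy : x ∪ x' ⊆ y)
    (hc : (x ∪ x').card + j = K + 1) : x ∩ x' ∈ X.fat d K h A (j + 1) := by
  classical
  by_contra hi
  refine ht j hj (x ∪ x') ?_ hxy
  simp only [badFaces, Finset.mem_filter]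
  exact ⟨X.down_closed hy hxy, hc, x, hx, x', hx', hne, rfl, hi⟩

/-- Deleting `v` from every rung gives a ladder from `y - v` to `z - v`, one level further down.
Inductively, a rung `z` and the already shortened previous rung `z' - v` are fat of the same level.
Their union is `z'`, inside the tame face `y`, so their intersection `z - v` is fat of the next
level. -/
theorem Ladder.erase (hA : ∀ x ∈ A, x ∈ X.faces ∧ x.card = K) {y : Finset V} (hy : y ∈ X.faces)
    (hyc : y.card = K + 1) (ht : X.IsTame d K h A y) {v : V} (hv : v ∈ y) (hyv : y.erase v ∈ A) :
    ∀ {j : ℕ} {x z : Finset V}, X.Ladder d K h A j x z → x ⊆ y → v ∈ z →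
      X.Ladder d K h A (j + 1) (y.erase v) (z.erase v)
  | 0, x, z, hl, hxy, hvz => by
    obtain ⟨rfl, hxA⟩ := hl
    have hxc := (hA x hxA).2
    have hu : x ∪ y.erase v = y := by
      refine Finset.Subset.antisymm (Finset.union_subset hxy (Finset.erase_subset _ _)) ?_
      intro a ha
      by_cases hav : a = v
      · exact Finset.mem_union_left _ (hav ▸ hvz)
      · exact Finset.mem_union_right _ (Finset.mem_erase.2 ⟨hav, ha⟩)
    have hi : x ∩ y.erase v = x.erase v := by
      rw [Finset.inter_erase, Finset.inter_eq_left.2 hxy]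
    have hne : x ≠ y.erase v := fun e => by
      rw [e] at hvz; exact (Finset.mem_erase.1 hvz).1 rfl
    have hK : 0 < K := by rw [← hxc]; exact Finset.card_pos.2 ⟨v, hvz⟩
    have := inter_mem_fat hA hy ht (j := 0) hK hxA hyv hne (by rw [hu]) (by rw [hu, hyc])
    rw [hi] at this
    exact ⟨this, y.erase v, Finset.erase_subset_erase _ hxy, rfl, hyv⟩
  | j + 1, x, z, hl, hxy, hvz => by
    obtain ⟨hz, z', hzz', hl'⟩ := hl
    have ih := hl'.erase hA hy hyc ht hv hyv hxy (hzz' hvz)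
    have hzc := (fat_spec hA hz).2
    have hzc' := (fat_spec hA hl'.mem_fat).2
    have hK : 0 < z.card := Finset.card_pos.2 ⟨v, hvz⟩
    have hsub : z ∪ z'.erase v ⊆ z' := Finset.union_subset hzz' (Finset.erase_subset _ _)
    have hu : z ∪ z'.erase v = z' := by
      refine Finset.Subset.antisymm hsub ?_
      intro a ha
      by_cases hav : a = v
      · exact Finset.mem_union_left _ (hav ▸ hvz)
      · exact Finset.mem_union_right _ (Finset.mem_erase.2 ⟨hav, ha⟩)
    have hi : z ∩ z'.erase v = z.erase v := by
      rw [Finset.inter_erase, Finset.inter_eq_left.2 hzz']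
    have hne : z ≠ z'.erase v := fun e => by
      rw [e] at hvz; exact (Finset.mem_erase.1 hvz).1 rfl
    have := inter_mem_fat hA hy ht (j := j + 1) (by omega) hz ih.mem_fat hne
      (by rw [hu]; exact hl'.subset.trans hxy) (by rw [hu]; omega)
    rw [hi] at this
    exact ⟨this, z'.erase v, Finset.erase_subset_erase _ hzz', ih⟩

/-- Follow the ladder upward from `z` to the first rung containing `v`. The rung just below it
arises by deleting `v`, so `Ladder.erase` connects it with `y - v`, and the lower rungs can be kept.
If no rung contains `v`, then `x` is already `y - v`. -/
theorem Ladder.exchange (hA : ∀ x ∈ A, x ∈ X.faces ∧ x.card = K) {y : Finset V} (hy : y ∈ X.faces)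
    (hyc : y.card = K + 1) (ht : X.IsTame d K h A y) {v : V} (hv : v ∈ y) (hyv : y.erase v ∈ A) :
    ∀ {j : ℕ} {x z : Finset V}, X.Ladder d K h A j x z → x ⊆ y → v ∉ z →
      X.Ladder d K h A j (y.erase v) z
  | 0, x, z, hl, hxy, hvz => by
    obtain ⟨rfl, hxA⟩ := hl
    have hxc := (hA x hxA).2
    have : x = y.erase v := by
      refine Finset.eq_of_subset_of_card_le ?_ (by rw [Finset.card_erase_of_mem hv]; omega)
      intro a ha
      exact Finset.mem_erase.2 ⟨fun e => hvz (e ▸ ha), hxy ha⟩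
    exact ⟨this.symm, hxA⟩
  | j + 1, x, z, hl, hxy, hvz => by
    obtain ⟨hz, z', hzz', hl'⟩ := hl
    by_cases hvz' : v ∈ z'
    · have h1 := hl'.erase hA hy hyc ht hv hyv hxy hvz'
      have hzc := (fat_spec hA hz).2
      have hzc' := (fat_spec hA hl'.mem_fat).2
      have : z = z'.erase v := by
        refine Finset.eq_of_subset_of_card_le ?_ (by rw [Finset.card_erase_of_mem hvz']; omega)
        intro a ha
        exact Finset.mem_erase.2 ⟨fun e => hvz (e ▸ ha), hzz' ha⟩
      rw [this]
      exact h1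
    · exact ⟨hz, z', hzz', hl'.exchange hA hy hyc ht hv hyv hxy hvz'⟩

/-- A fat face none of whose facets is fat. -/
def IsTerminal (X : SComplex V) (d K : ℕ) (h : ℝ) (A : Finset (Finset V)) (j : ℕ)
    (z : Finset V) : Prop :=
  ∀ v ∈ z, z.erase v ∉ X.fat d K h A (j + 1)

/-- A ladder that cannot end could be prolonged indefinitely, but each rung loses a vertex and level
`K + 1` is void. -/
theorem exists_ladder_terminal (hA : ∀ x ∈ A, x ∈ X.faces ∧ x.card = K)
    {x : Finset V} (hx : x ∈ A) : ∃ j z, X.Ladder d K h A j x z ∧ X.IsTerminal d K h A j z := by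
  by_contra hc
  push Not at hc
  have key : ∀ j, ∃ z, X.Ladder d K h A j x z := by
    intro j
    induction j with
    | zero => exact ⟨x, rfl, hx⟩
    | succ j ih =>
      obtain ⟨z, hz⟩ := ih
      have := hc j z hz
      simp only [IsTerminal, not_forall, not_not] at this
      obtain ⟨v, hv, hvf⟩ := this
      exact ⟨z.erase v, hvf, z, Finset.erase_subset _ _, hz⟩
  obtain ⟨z, hz⟩ := key (K + 1)
  have := (fat_spec hA hz.mem_fat).2
  omega

end SComplex

end

/-! ### From local expansion to expansion of light locally minimal cochains -/

noncomputable section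

namespace AugSheaf

variable {𝔽 : Type*} [Field 𝔽] {V : Type*} [LinearOrder V] {X : SComplex V} {d : ℕ}

/-- The cochain `f` is supported on the faces containing `z`. -/
def SuppOver (F : AugSheaf 𝔽 X) {n : ℕ} (z : Finset V) (f : F.Cochain n) : Prop :=
  ∀ x, f x ≠ 0 → z ⊆ x.1.1

/-- The cochains supported on the faces containing `z` which are minimal modulo the coboundaries
of such cochains have coboundaries of relative weight at least `ε`. -/
def StarExpansion (F : AugSheaf 𝔽 X) (w : Finset V → ℝ) (k : ℕ) (ε : ℝ) (z : Finset V) : Prop :=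
  ∀ f : F.Cochain (k + 1), F.SuppOver z f →
    (∀ g : F.Cochain k, F.SuppOver z g → F.suppNorm w f ≤ F.suppNorm w (f + F.coboundary k g)) →
    ε * F.suppNorm w f ≤ F.suppNorm w (F.coboundary (k + 1) f)

/-- The cochain `f` is locally minimal: its weight cannot be decreased by adding the coboundary
of a cochain that is supported on the faces containing a given vertex. -/
def IsLocallyMinimal (F : AugSheaf 𝔽 X) (w : Finset V → ℝ) (k : ℕ) (f : F.Cochain (k + 1)) :
    Prop :=
  ∀ v, ∀ g : F.Cochain k, F.SuppOver {v} g →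
    F.suppNorm w f ≤ F.suppNorm w (f + F.coboundary k g)

theorem suppNorm_nonneg (F : AugSheaf 𝔽 X) {n : ℕ} {w : Finset V → ℝ} (hw : ∀ s, 0 ≤ w s)
    (f : F.Cochain n) : 0 ≤ F.suppNorm w f :=
  Finset.sum_nonneg fun _ _ => hw _

theorem suppNorm_add_le (F : AugSheaf 𝔽 X) {n : ℕ} {w : Finset V → ℝ} (hw : ∀ s, 0 ≤ w s)
    (f g : F.Cochain n) : F.suppNorm w (f + g) ≤ F.suppNorm w f + F.suppNorm w g := by
  unfold suppNorm
  refine (Finset.sum_le_sum_of_subset_of_nonneg (F.supp_add f g) fun _ _ _ => hw _).trans ?_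
  rw [← Finset.sum_union_inter]
  exact le_add_of_nonneg_right (Finset.sum_nonneg fun _ _ => hw _)

open scoped Classical in
/-- The part of a cochain that is supported on the faces satisfying `P`. -/
def restrict (F : AugSheaf 𝔽 X) {n : ℕ} (P : Finset V → Prop) (f : F.Cochain n) : F.Cochain n :=
  fun x => if P x.1.1 then f x else 0

theorem supp_restrict (F : AugSheaf 𝔽 X) {n : ℕ} (P : Finset V → Prop) [DecidablePred P]
    (f : F.Cochain n) : F.supp (F.restrict P f) = (F.supp f).filter P := by
  ext s
  simp only [mem_supp, Finset.mem_filter, restrict]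
  constructor
  · rintro ⟨x, hx, rfl⟩
    split_ifs at hx with h
    · exact ⟨⟨x, hx, rfl⟩, h⟩
    · exact absurd rfl hx
  · rintro ⟨⟨x, hx, rfl⟩, h⟩
    exact ⟨x, by rwa [if_pos h], rfl⟩

/-- Minimality passes to parts of a cochain. The weight of `f` is the sum of the weights of its two
parts, and putting the omitted part back raises the weight of `restrict P f + b` by at most the
weight of that part. -/
theorem suppNorm_restrict_le_add (F : AugSheaf 𝔽 X) {n : ℕ} {w : Finset V → ℝ}
    (hw : ∀ s, 0 ≤ w s) (P : Finset V → Prop) (f b : F.Cochain n)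
    (h : F.suppNorm w f ≤ F.suppNorm w (f + b)) :
    F.suppNorm w (F.restrict P f) ≤ F.suppNorm w (F.restrict P f + b) := by
  classical
  have h1 : F.restrict P f + F.restrict (fun s => ¬ P s) f = f := by
    funext x
    simp only [Pi.add_apply, restrict]
    split_ifs <;> simp_all
  have h2 : F.suppNorm w (F.restrict P f) + F.suppNorm w (F.restrict (fun s => ¬ P s) f) =
      F.suppNorm w f := by
    unfold suppNorm
    rw [supp_restrict, supp_restrict, Finset.sum_filter_add_sum_filter_not]
  have h3 := F.suppNorm_add_le hw (F.restrict P f + b) (F.restrict (fun s => ¬ P s) f)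
  rw [add_right_comm, h1] at h3
  linarith

open scoped Classical in
-- Split `f` along the terminal faces `z` that its support reaches by ladders. Each piece lives on
-- the star of `z` and is minimal there, so star expansion bounds it by its coboundary. These
-- coboundaries live on the support of `df` and on faces that are not tame, and a face with `k + 2`
-- vertices is charged by at most `2^(k+2)` of its subsets `z`.
theorem suppNorm_le_of_isLocallyMinimal (F : AugSheaf 𝔽 X) {k : ℕ} (hX : X.IsPure d)
    (hkd : k + 1 ≤ d) {ε h lam' : ℝ} (hh : 0 ≤ h) (hh1 : h ≤ 1) (hε : 0 ≤ ε)
    (hlam' : lam' ≤ h ^ (2 ^ k))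
    (hmix : ∀ z ∈ X.faces, z.card < k + 1 →
      ∃ lam, 0 ≤ lam ∧ lam ≤ lam' ∧ X.LinkMixing d z lam)
    (hstar : ∀ z ∈ X.faces, z.Nonempty → F.StarExpansion (X.weight d) k ε z)
    (f : F.Cochain (k + 1)) (hf : F.IsLocallyMinimal (X.weight d) k f)
    (hsmall : F.suppNorm (X.weight d) f < h ^ (2 ^ (k + 1) - 1)) :
    ε * F.suppNorm (X.weight d) f ≤ 2 ^ (k + 2) *
      (F.suppNorm (X.weight d) (F.coboundary (k + 1) f) +
        h * ((k + 1) * (k + 2)) * 2 ^ (k + 1) * F.suppNorm (X.weight d) f) := by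
  set w := X.weight d with hw
  have hw0 : ∀ s, 0 ≤ w s := fun s => SComplex.weight_nonneg s
  set A := F.supp f with hAdef
  have hA : ∀ x ∈ A, x ∈ X.faces ∧ x.card = (k + 1) := fun x hx => F.supp_subset_faces hx
  have hfw : X.fatWeight d (k + 1) h A 0 = F.suppNorm w f := rfl
  have hempty := SComplex.empty_not_mem_fat hX hA hh (by rw [hfw]; exact hsmall)
  set T := X.faces.filter fun z => z.Nonempty ∧
    ∃ x, X.Ladder d (k + 1) h A ((k + 1) - z.card) x z ∧ X.IsTerminal d (k + 1) h A ((k + 1) - z.card) z with hT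
  -- The level of a terminal face is determined by its size. The pieces may overlap; only that they
  -- cover the support is needed.
  let fz : Finset V → F.Cochain (k + 1) := fun z => F.restrict (X.Ladder d (k + 1) h A ((k + 1) - z.card) · z) f
  have h1 : F.suppNorm w f ≤ ∑ z ∈ T, F.suppNorm w (fz z) := by
    refine sum_le_sum_sum_of_cover hw0 fun x hx => ?_
    obtain ⟨j, z, hl, ht⟩ := SComplex.exists_ladder_terminal (d := d) (h := h) hA hx
    have hzf := SComplex.fat_spec hA hl.mem_fat
    have hj : (k + 1) - z.card = j := by omega
    have hne : z.Nonempty := by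
      rw [Finset.nonempty_iff_ne_empty]
      rintro rfl
      rw [Finset.card_empty] at hj
      have := hl.mem_fat
      rw [← hj, Nat.sub_zero] at this
      exact hempty this
    refine ⟨z, ?_, ?_⟩
    · rw [hT, Finset.mem_filter]
      exact ⟨hzf.1, hne, x, by rw [hj]; exact hl, by rw [hj]; exact ht⟩
    · rw [supp_restrict, Finset.mem_filter]
      exact ⟨hx, by rw [hj]; exact hl⟩
  have hsub : ∀ z, F.SuppOver z (fz z) := by
    intro z x hx
    simp only [fz, restrict] at hx
    split_ifs at hx with hc
    · exact hc.subset
    · exact absurd rfl hx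
  have h2 : ∀ z ∈ T, ε * F.suppNorm w (fz z) ≤ F.suppNorm w (F.coboundary (k + 1) (fz z)) := by
    intro z hz
    rw [hT, Finset.mem_filter] at hz
    obtain ⟨hzf, hzne, x, hl, ht⟩ := hz
    refine hstar z hzf hzne (fz z) (hsub z) fun g hg => ?_
    obtain ⟨v, hv⟩ := hzne
    exact F.suppNorm_restrict_le_add hw0 _ _ _
      (hf v g fun x hx => Finset.singleton_subset_iff.2 (hg x hx hv))
  set D := X.faces.filter (fun y => y.card = (k + 1) + 1 ∧ ¬ X.IsTame d (k + 1) h A y) ∪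
    F.supp (F.coboundary (k + 1) f) with hD
  -- If one facet of a tame `y` has a ladder to `z`, then all facets of `y` in the support do, by
  -- exchange; hence `f` and `fz z` agree on all facets of `y`, and so do their coboundaries at `y`.
  have h3 : ∀ z ∈ T, F.supp (F.coboundary (k + 1) (fz z)) ⊆ D.filter (fun y => z ⊆ y) := by
    intro z hz y hy
    rw [hT, Finset.mem_filter] at hz
    obtain ⟨hzf, hzne, -, -, ht⟩ := hz
    obtain ⟨y, hy', rfl⟩ := (mem_supp F).1 hy
    obtain ⟨v, hv, hfv⟩ := coboundary_ne_zero F hy'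
    rw [Finset.mem_filter, hD, Finset.mem_union, Finset.mem_filter]
    refine ⟨?_, (hsub z _ hfv).trans (facet_le y v hv)⟩
    by_cases htame : X.IsTame d (k + 1) h A y.1.1
    · right
      rw [coe_mem_supp, ← coboundary_congr F (f := fz z)]
      · exact hy'
      · intro v' hv'
        simp only [fz, restrict] at hfv ⊢
        split_ifs at hfv with hlad
        · by_cases hfv' : f (facet y v' hv') = 0
          · rw [hfv', ite_self]
          · rw [if_pos]
            have hmem : y.1.1.erase v' ∈ A := (coe_mem_supp F (facet y v' hv')).2 hfv'
            -- Otherwise `Ladder.erase` would produce a fat facet `z - v'`, against terminality.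
            have hvz : v' ∉ z := fun hvz => ht v' hvz
              (hlad.erase hA y.1.2 y.2 htame hv' hmem (facet_le y v hv) hvz).mem_fat
            exact hlad.exchange hA y.1.2 y.2 htame hv' hmem (facet_le y v hv) hvz
        · exact absurd rfl hfv
    · exact Or.inl ⟨y.1.2, y.2, htame⟩
  have h4 : ∑ z ∈ T, ∑ y ∈ D.filter (fun y => z ⊆ y), w y ≤ 2 ^ ((k + 1) + 1) * ∑ y ∈ D, w y := by
    refine (le_of_eq ?_).trans (sum_sum_filter_le (s := D) (T := T) (R := fun z y => z ⊆ y) hw0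
      (C := 2 ^ ((k + 1) + 1)) ?_)
    · exact Finset.sum_congr rfl fun z _ => by congr
    · intro y hy
      have hyc : y.card = (k + 1) + 1 := by
        rw [hD, Finset.mem_union, Finset.mem_filter] at hy
        rcases hy with hy | hy
        · exact hy.2.1
        · exact (F.supp_subset_faces hy).2
      have : (T.filter fun z => z ⊆ y) ⊆ y.powerset := by
        intro z hz
        exact Finset.mem_powerset.2 (Finset.mem_filter.1 hz).2
      have := Finset.card_le_card this
      rw [Finset.card_powerset, hyc] at this
      have h7 : ((T.filter fun z => z ⊆ y).card : ℝ) ≤ 2 ^ (k + 1 + 1) := by exact_mod_cast this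
      convert h7
  have h5 : ∑ y ∈ D, w y ≤ h * (((k : ℝ) + 1) * (k + 1 + 1)) * 2 ^ (k + 1) * F.suppNorm w f +
      F.suppNorm w (F.coboundary (k + 1) f) := by
    have h6 := SComplex.sum_not_tame_le hX hkd hA hh hh1 (lam' := lam')
      (by simpa using hlam') hmix
    rw [hfw] at h6
    push_cast at h6
    refine le_trans ?_ (add_le_add_left h6 _)
    rw [hD]
    unfold suppNorm
    rw [← Finset.sum_union_inter]
    exact le_add_of_nonneg_right (Finset.sum_nonneg fun _ _ => hw0 _)
  calc ε * F.suppNorm w f ≤ ε * ∑ z ∈ T, F.suppNorm w (fz z) := by gcongr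
    _ = ∑ z ∈ T, ε * F.suppNorm w (fz z) := Finset.mul_sum _ _ _
    _ ≤ ∑ z ∈ T, F.suppNorm w (F.coboundary (k + 1) (fz z)) := Finset.sum_le_sum h2
    _ ≤ ∑ z ∈ T, ∑ y ∈ D.filter (fun y => z ⊆ y), w y := Finset.sum_le_sum fun z hz =>
        Finset.sum_le_sum_of_subset_of_nonneg (h3 z hz) fun _ _ _ => hw0 _
    _ ≤ _ := h4
    _ ≤ 2 ^ ((k + 1) + 1) * (h * (((k : ℝ) + 1) * (k + 1 + 1)) * 2 ^ (k + 1) * F.suppNorm w f +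
      F.suppNorm w (F.coboundary (k + 1) f)) := by gcongr
    _ = _ := by ring

end AugSheaf

end

/-! ### Coverings: lifting faces, weights and spectral gaps -/

noncomputable section

namespace SMap

variable {U W V : Type*} [LinearOrder U] [LinearOrder W] [LinearOrder V]
variable {Z : SComplex U} {Y : SComplex W} {X : SComplex V} {u : SMap Y X} {d : ℕ}

theorem isCovering_id : (SMap.id X).IsCovering := by
  refine ⟨fun v hv => ⟨v, hv, rfl⟩, fun w _ => ?_⟩
  simp only [SMap.id, Finset.image_id']
  exact Set.bijOn_id _

theorem IsCovering.comp {v : SMap Z Y} (hu : u.IsCovering) (hv : v.IsCovering) :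
    (u.comp v).IsCovering := by
  refine ⟨fun x hx => ?_, fun z hz => ?_⟩
  · obtain ⟨y, hy, rfl⟩ := hu.1 x hx
    obtain ⟨z, hz, rfl⟩ := hv.1 y hy
    exact ⟨z, hz, rfl⟩
  · have h1 := hv.2 z hz
    have h2 := hu.2 (v.toFun z) (by simpa using v.map_mem _ hz)
    have := h2.comp h1
    refine this.congr fun y _ => ?_
    simp [SMap.comp, Finset.image_image, Function.comp_def]

theorem IsCovering.injOn (hu : u.IsCovering) {y : Finset W} (hy : y ∈ Y.faces) :
    Set.InjOn u.toFun y :=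
  Finset.card_image_iff.1 (hu.dimPreserving ⟨y, hy⟩)

theorem IsCovering.card_image (hu : u.IsCovering) {y : Finset W} (hy : y ∈ Y.faces) :
    (y.image u.toFun).card = y.card := hu.dimPreserving ⟨y, hy⟩

theorem IsCovering.eq_of_image_eq (hu : u.IsCovering) {z y y' : Finset W} (hz : z.Nonempty)
    (hy : y ∈ Y.faces) (hy' : y' ∈ Y.faces) (hzy : z ⊆ y) (hzy' : z ⊆ y')
    (h : y.image u.toFun = y'.image u.toFun) : y = y' := by
  obtain ⟨w, hw⟩ := hz
  exact (hu.2 w (Y.down_closed hy (by simpa using hzy hw))).injOn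
    ⟨hy, hzy hw⟩ ⟨hy', hzy' hw⟩ h

/-- The face `x` is lifted through a single vertex `w` of `z`; uniqueness of lifts through `w` then
forces the lift to contain all of `z`. -/
theorem IsCovering.exists_lift (hu : u.IsCovering) {z : Finset W} (hz : z.Nonempty)
    (hzY : z ∈ Y.faces) {x : Finset V} (hx : x ∈ X.faces) (hzx : z.image u.toFun ⊆ x) :
    ∃ y ∈ Y.faces, z ⊆ y ∧ y.image u.toFun = x := by
  obtain ⟨w, hw⟩ := hz
  obtain ⟨y, ⟨hy, hwy⟩, hyx⟩ := (hu.2 w (Y.down_closed hzY (by simpa using hw))).surjOn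
    ⟨hx, hzx (Finset.mem_image_of_mem _ hw)⟩
  refine ⟨y, hy, ?_, hyx⟩
  dsimp only at hyx
  -- The part of `y` lying over `u z` is a lift of `u z` through `w`, and so is `z`.
  have : y.filter (fun a => u.toFun a ∈ z.image u.toFun) = z := by
    refine hu.eq_of_image_eq (z := {w}) (Finset.singleton_nonempty w)
      (Y.down_closed hy (Finset.filter_subset _ _)) hzY ?_ (by simpa using hw) ?_
    · simpa [hwy] using ⟨w, hw, rfl⟩
    · ext v
      simp only [Finset.mem_image, Finset.mem_filter]
      constructor
      · rintro ⟨a, ⟨_, h⟩, rfl⟩; exact h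
      · intro h
        have hv : v ∈ y.image u.toFun := hyx ▸ hzx (Finset.mem_image.2 h)
        obtain ⟨a, ha, rfl⟩ := Finset.mem_image.1 hv
        exact ⟨a, ⟨ha, h⟩, rfl⟩
  rw [← this]
  exact Finset.filter_subset _ _

theorem IsCovering.exists_face (hu : u.IsCovering) {x : Finset V} (hx : x ∈ X.faces) :
    ∃ y ∈ Y.faces, y.image u.toFun = x := by
  rcases x.eq_empty_or_nonempty with rfl | ⟨v, hv⟩
  · exact ⟨∅, Y.empty_mem, by simp⟩
  · obtain ⟨w, hw, rfl⟩ := hu.1 v (X.down_closed hx (by simpa using hv))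
    obtain ⟨y, hy, -, h⟩ := hu.exists_lift (Finset.singleton_nonempty w) hw hx (by simpa using hv)
    exact ⟨y, hy, h⟩

theorem IsCovering.isPure (hu : u.IsCovering) (hX : X.IsPure d) : Y.IsPure d := by
  intro y hy
  rcases y.eq_empty_or_nonempty with rfl | hne
  · obtain ⟨x, hx, -, hc⟩ := hX ∅ X.empty_mem
    obtain ⟨y, hy, rfl⟩ := hu.exists_face hx
    exact ⟨y, hy, Finset.empty_subset _, by rw [← hc, hu.card_image hy]⟩
  · obtain ⟨x, hx, hyx, hc⟩ := hX _ (u.map_mem y hy)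
    obtain ⟨t, ht, hyt, rfl⟩ := hu.exists_lift hne hy hx hyx
    exact ⟨t, ht, hyt, by rw [← hc, hu.card_image ht]⟩

theorem IsCovering.card_filter_star (hu : u.IsCovering) {z : Finset W} (hz : z.Nonempty)
    (hzY : z ∈ Y.faces) (n : ℕ) :
    (Y.faces.filter fun y => y.card = n ∧ z ⊆ y).card =
      (X.faces.filter fun x => x.card = n ∧ z.image u.toFun ⊆ x).card := by
  refine Finset.card_bij (fun y _ => y.image u.toFun) ?_ ?_ ?_
  · intro y hy
    simp only [Finset.mem_filter] at hy ⊢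
    exact ⟨u.map_mem y hy.1, by rw [hu.card_image hy.1]; exact hy.2.1,
      Finset.image_subset_image hy.2.2⟩
  · intro y hy y' hy' h
    simp only [Finset.mem_filter] at hy hy'
    exact hu.eq_of_image_eq hz hy.1 hy'.1 hy.2.2 hy'.2.2 h
  · intro x hx
    simp only [Finset.mem_filter] at hx
    obtain ⟨y, hy, hzy, rfl⟩ := hu.exists_lift hz hzY hx.1 hx.2.2
    exact ⟨y, by simp [hy, hzy, ← hx.2.1, hu.card_image hy], rfl⟩

theorem IsCovering.topCount_eq (hu : u.IsCovering) {z : Finset W} (hz : z.Nonempty)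
    (hzY : z ∈ Y.faces) : Y.topCount d z = X.topCount d (z.image u.toFun) :=
  hu.card_filter_star hz hzY (d + 1)

/-- The ratio between the weights of the faces of a covering and those of the base. -/
def weightRatio (u : SMap Y X) (d : ℕ) : ℝ := (X.topCount d ∅ : ℝ) / (Y.topCount d ∅ : ℝ)

theorem IsCovering.weightRatio_pos (hu : u.IsCovering) (hX : X.IsPure d) :
    0 < u.weightRatio d := by
  have h1 := SComplex.topCount_pos hX X.empty_mem
  have h2 := SComplex.topCount_pos (hu.isPure hX) Y.empty_mem
  unfold weightRatio
  positivity

theorem IsCovering.weight_eq (hu : u.IsCovering) (hX : X.IsPure d) {z : Finset W}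
    (hz : z.Nonempty) (hzY : z ∈ Y.faces) :
    Y.weight d z = u.weightRatio d * X.weight d (z.image u.toFun) := by
  rw [SComplex.weight_eq, SComplex.weight_eq, hu.topCount_eq hz hzY, hu.card_image hzY, weightRatio]
  have h1 := SComplex.topCount_pos hX X.empty_mem
  have h2 := SComplex.topCount_pos (hu.isPure hX) Y.empty_mem
  have h3 := Nat.choose_pos (SComplex.card_le_of_mem (hu.isPure hX) hzY)
  field_simp

theorem IsCovering.injOn_linkVerts (hu : u.IsCovering) {z : Finset W} (hz : z.Nonempty) :
    Set.InjOn u.toFun (Y.linkVerts z) := by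
  intro a ha b hb h
  rw [Finset.mem_coe, SComplex.mem_linkVerts] at ha hb
  have : insert a z = insert b z := hu.eq_of_image_eq hz ha.2 hb.2 (Finset.subset_insert _ _)
    (Finset.subset_insert _ _) (by rw [Finset.image_insert, Finset.image_insert, h])
  have h2 : a ∈ insert b z := this ▸ Finset.mem_insert_self a z
  exact (Finset.mem_insert.1 h2).resolve_right ha.1

theorem IsCovering.not_mem_image (hu : u.IsCovering) {z : Finset W} {a : W}
    (ha : a ∈ Y.linkVerts z) : u.toFun a ∉ z.image u.toFun := by
  rw [SComplex.mem_linkVerts] at ha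
  intro h
  obtain ⟨c, hc, hca⟩ := Finset.mem_image.1 h
  have := hu.injOn ha.2 (Finset.mem_insert_of_mem hc) (Finset.mem_insert_self a z) hca
  exact ha.1 (this ▸ hc)

theorem IsCovering.image_linkVerts (hu : u.IsCovering) {z : Finset W} (hz : z.Nonempty)
    (hzY : z ∈ Y.faces) :
    (Y.linkVerts z).image u.toFun = X.linkVerts (z.image u.toFun) := by
  ext v
  rw [Finset.mem_image, SComplex.mem_linkVerts]
  constructor
  · rintro ⟨a, ha, rfl⟩
    refine ⟨hu.not_mem_image ha, ?_⟩
    rw [← Finset.image_insert]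
    exact u.map_mem _ (SComplex.mem_linkVerts.1 ha).2
  · rintro ⟨hv, hf⟩
    obtain ⟨y, hy, hzy, hyv⟩ := hu.exists_lift hz hzY hf (Finset.subset_insert _ _)
    have : v ∈ y.image u.toFun := hyv ▸ Finset.mem_insert_self _ _
    obtain ⟨a, ha, rfl⟩ := Finset.mem_image.1 this
    refine ⟨a, SComplex.mem_linkVerts.2 ⟨fun h => hv (Finset.mem_image_of_mem _ h),
      Y.down_closed hy (Finset.insert_subset ha hzy)⟩, rfl⟩

theorem IsCovering.pairWeight_eq (hu : u.IsCovering) (hX : X.IsPure d) {z : Finset W}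
    (hz : z.Nonempty) {a b : W} (ha : a ∈ Y.linkVerts z)
    (hb : b ∈ Y.linkVerts z) : Y.pairWeight d z a b =
      u.weightRatio d * X.pairWeight d (z.image u.toFun) (u.toFun a) (u.toFun b) := by
  have hiff : (a ≠ b ∧ a ∉ z ∧ b ∉ z ∧ insert a (insert b z) ∈ Y.faces) ↔
      (u.toFun a ≠ u.toFun b ∧ u.toFun a ∉ z.image u.toFun ∧ u.toFun b ∉ z.image u.toFun ∧
        insert (u.toFun a) (insert (u.toFun b) (z.image u.toFun)) ∈ X.faces) := by
    have ha' := SComplex.mem_linkVerts.1 ha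
    have hb' := SComplex.mem_linkVerts.1 hb
    constructor
    · rintro ⟨h1, h2, h3, h4⟩
      refine ⟨fun h => h1 (hu.injOn_linkVerts hz ha hb h), hu.not_mem_image ha,
        hu.not_mem_image hb, ?_⟩
      rw [← Finset.image_insert, ← Finset.image_insert]
      exact u.map_mem _ h4
    · rintro ⟨h1, h2, h3, h4⟩
      refine ⟨fun h => h1 (h ▸ rfl), ha'.1, hb'.1, ?_⟩
      obtain ⟨y, hy, hzy, hyv⟩ := hu.exists_lift (z := insert b z)
        (Finset.insert_nonempty _ _) hb'.2 h4
        (by rw [Finset.image_insert]; exact Finset.subset_insert _ _)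
      have : u.toFun a ∈ y.image u.toFun := hyv ▸ Finset.mem_insert_self _ _
      obtain ⟨a', ha'y, haa'⟩ := Finset.mem_image.1 this
      have hzy' : z ⊆ y := (Finset.subset_insert _ _).trans hzy
      have hmem : a' ∈ Y.linkVerts z := SComplex.mem_linkVerts.2
        ⟨fun h => h2 (haa' ▸ Finset.mem_image_of_mem _ h),
          Y.down_closed hy (Finset.insert_subset ha'y hzy')⟩
      have : a' = a := hu.injOn_linkVerts hz hmem ha haa'
      subst this
      exact Y.down_closed hy (Finset.insert_subset ha'y hzy)
  unfold SComplex.pairWeight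
  by_cases h : a ≠ b ∧ a ∉ z ∧ b ∉ z ∧ insert a (insert b z) ∈ Y.faces
  · rw [if_pos h, if_pos (hiff.1 h), hu.weight_eq hX (Finset.insert_nonempty _ _) h.2.2.2,
      Finset.image_insert, Finset.image_insert]
  · rw [if_neg h, if_neg (fun h' => h (hiff.2 h')), mul_zero]

/-- The covering identifies the two links and multiplies all weights of nonempty faces by
`weightRatio`. Every term of the mixing inequality is quadratic in the weights, so the inequality is
merely multiplied by the square of this ratio. -/
theorem IsCovering.linkMixing (hu : u.IsCovering) (hX : X.IsPure d) {z : Finset W}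
    (hz : z.Nonempty) (hzY : z ∈ Y.faces) {lam : ℝ}
    (h : X.LinkMixing d (z.image u.toFun) lam) : Y.LinkMixing d z lam := by
  classical
  intro φ
  let ψ : V → ℝ := fun v => if hv : ∃ a ∈ Y.linkVerts z, u.toFun a = v then φ hv.choose else 0
  have hψ : ∀ a ∈ Y.linkVerts z, ψ (u.toFun a) = φ a := by
    intro a ha
    have hex : ∃ a' ∈ Y.linkVerts z, u.toFun a' = u.toFun a := ⟨a, ha, rfl⟩
    simp only [ψ, dif_pos hex]
    rw [hu.injOn_linkVerts hz hex.choose_spec.1 ha hex.choose_spec.2]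
  have hsum : ∀ g : V → ℝ, ∑ v ∈ X.linkVerts (z.image u.toFun), g v =
      ∑ a ∈ Y.linkVerts z, g (u.toFun a) := by
    intro g
    rw [← hu.image_linkVerts hz hzY, Finset.sum_image (hu.injOn_linkVerts hz)]
  have key := h ψ
  rw [hsum, hsum, hsum, hu.card_image hzY] at key
  simp only [hsum] at key
  set c := u.weightRatio d with hc
  have hc0 := hu.weightRatio_pos hX
  have e1 : ∀ a ∈ Y.linkVerts z, Y.weight d (insert a z) =
      c * X.weight d (insert (u.toFun a) (z.image u.toFun)) := by
    intro a ha
    rw [hu.weight_eq hX (Finset.insert_nonempty _ _) (SComplex.mem_linkVerts.1 ha).2,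
      Finset.image_insert]
  have f1 : ∑ a ∈ Y.linkVerts z, ∑ b ∈ Y.linkVerts z, Y.pairWeight d z a b * (φ a * φ b) =
      c * ∑ a ∈ Y.linkVerts z, ∑ b ∈ Y.linkVerts z,
        X.pairWeight d (z.image u.toFun) (u.toFun a) (u.toFun b) *
          (ψ (u.toFun a) * ψ (u.toFun b)) := by
    rw [Finset.mul_sum]
    refine Finset.sum_congr rfl fun a ha => ?_
    rw [Finset.mul_sum]
    refine Finset.sum_congr rfl fun b hb => ?_
    rw [hu.pairWeight_eq hX hz ha hb, hψ a ha, hψ b hb, mul_assoc]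
  have f2 : ∑ a ∈ Y.linkVerts z, Y.weight d (insert a z) * φ a = c * ∑ a ∈ Y.linkVerts z,
      X.weight d (insert (u.toFun a) (z.image u.toFun)) * ψ (u.toFun a) := by
    rw [Finset.mul_sum]
    exact Finset.sum_congr rfl fun a ha => by rw [e1 a ha, hψ a ha, mul_assoc]
  have f3 : ∑ a ∈ Y.linkVerts z, Y.weight d (insert a z) * φ a ^ 2 = c * ∑ a ∈ Y.linkVerts z,
      X.weight d (insert (u.toFun a) (z.image u.toFun)) * ψ (u.toFun a) ^ 2 := by
    rw [Finset.mul_sum]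
    exact Finset.sum_congr rfl fun a ha => by rw [e1 a ha, hψ a ha, mul_assoc]
  rw [f1, f2, f3, hu.weight_eq hX hz hzY]
  have := mul_le_mul_of_nonneg_left key (sq_nonneg c)
  calc _ = c ^ 2 * _ := by rw [sq]; ring
    _ ≤ _ := this
    _ = _ := by ring

/-- Nonempty faces inherit mixing from the base. The link of the empty face is `Y` itself, which
does not come from the base; its mixing follows by one more trickling-down step from the vertex
links and the connectedness of `Y`. Since `j + 1 ≤ d` and `lam * d ≤ 1`, each denominator `1 - j
lam` is at least `1 / d`, which gives the common bound `d * lam`. -/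
theorem IsCovering.linkMixing_of_base (hu : u.IsCovering) (hX : X.IsPure d) (hd : 2 ≤ d)
    (hs : X.IsStronglyConnected d) (hY : Y.IsConnected) {lam : ℝ} (hlam : 0 < lam)
    (hlamd : lam * d ≤ 1) (h : X.IsCodimTwoSpectralExpander d (Set.Icc (-1) lam))
    {z : Finset W} (hz : z ∈ Y.faces) (hzd : z.card < d) :
    ∃ lam', 0 ≤ lam' ∧ lam' ≤ d * lam ∧ Y.LinkMixing d z lam' := by
  have base : ∀ z ∈ Y.faces, z.Nonempty → ∀ j : ℕ, z.card + j + 1 = d →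
      Y.LinkMixing d z (lam / (1 - j * lam)) := by
    intro z hz hne j hj
    refine hu.linkMixing hX hne hz ?_
    exact SComplex.linkMixing_of_isCodimTwoSpectralExpander hX hs hlam hlamd h j _ (u.map_mem z hz)
      (by rw [hu.card_image hz, hj])
  obtain ⟨j, hj⟩ : ∃ j, z.card + j + 1 = d := ⟨d - z.card - 1, by omega⟩
  have hjd : (j : ℝ) + 1 ≤ d := by rw [← hj]; push_cast; linarith [(Nat.cast_nonneg z.card : (0:ℝ) ≤ z.card)]
  have hd0 : (0 : ℝ) < d := by positivity
  have hj1 : 1 / (d : ℝ) ≤ 1 - j * lam := by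
    rw [div_le_iff₀ hd0]
    nlinarith
  have hpos : 0 < 1 - j * lam := lt_of_lt_of_le (by positivity) hj1
  refine ⟨lam / (1 - j * lam), by positivity, ?_, ?_⟩
  · rw [div_le_iff₀ hpos]
    have := mul_le_mul_of_nonneg_left hj1 (mul_nonneg hd0.le hlam.le)
    calc lam = d * lam * (1 / d) := by field_simp
      _ ≤ _ := this
  · rcases z.eq_empty_or_nonempty with rfl | hne
    swap
    · exact base z hz hne j hj
    rw [Finset.card_empty] at hj
    obtain ⟨i, rfl⟩ : ∃ i, j = i + 1 := ⟨j - 1, by omega⟩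
    have hi : 0 < 1 - i * lam := by
      have : (i : ℝ) * lam ≤ (i + 1 : ℕ) * lam := by
        gcongr; simp
      linarith
    have := SComplex.linkMixing_of_forall_insert (hu.isPure hX) (z := ∅) (by simp; omega)
      (div_nonneg hlam.le hi.le) (by
        rw [div_lt_one hi]; push_cast at hpos; linarith) ?_
      (fun c hc => base _ (SComplex.mem_linkVerts.1 hc).2 (Finset.insert_nonempty _ _) i (by
        rw [Finset.card_insert_of_notMem (by simp)]; simp; omega))
    · rwa [SComplex.div_div_one_sub hi.ne'] at this
    · have hl : Y.link Y.emptyFace = Y := by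
        obtain ⟨f, h1, h2⟩ := Y
        simp [SComplex.link, SComplex.emptyFace]
      exact SComplex.linkConn_of_isConnected Y.emptyFace (by rw [hl]; exact hY)

end SMap

end

/-! ### Local coboundary expansion on the stars of a covering -/

noncomputable section

namespace AugSheaf

variable {𝔽 : Type*} [Field 𝔽] {W V : Type*} [LinearOrder W] [LinearOrder V]
variable {Y : SComplex W} {X : SComplex V} {d : ℕ}

theorem mass_eq_one (F : AugSheaf 𝔽 X) (hX : X.IsPure d) {n : ℕ} (hn : n ≤ d + 1)
    (hF : ∀ x : X.CardFace n, Nontrivial (F.obj x.1)) : F.mass d n = 1 := by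
  classical
  have h1 : ∀ x : X.CardFace n, (⨆ s : F.obj x.1, F.sectionNorm d x.1 s) = X.weight d x.1.1 := by
    intro x
    obtain ⟨s, hs⟩ := exists_ne (0 : F.obj x.1)
    have hle : ∀ s : F.obj x.1, F.sectionNorm d x.1 s ≤ X.weight d x.1.1 := by
      intro s
      unfold sectionNorm
      split_ifs
      · exact SComplex.weight_nonneg _
      · exact le_rfl
    refine le_antisymm (ciSup_le hle) ?_
    refine le_trans (le_of_eq ?_) (le_ciSup ⟨_, Set.forall_mem_range.2 hle⟩ s)
    simp [sectionNorm, hs]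
  unfold mass
  simp only [h1]
  have h2 := SComplex.sum_weight hX (x := ∅) (m := n) (by simp) hn
  simp only [Finset.card_empty, Nat.choose_zero_right, Nat.cast_one, one_mul,
    SComplex.weight_empty hX, Finset.empty_subset, and_true] at h2
  rw [← h2]
  refine Finset.sum_bij (fun x _ => x.1.1) ?_ ?_ ?_ fun _ _ => rfl
  · intro x _
    exact Finset.mem_filter.2 ⟨x.1.2, x.2⟩
  · intro x _ y _ h
    exact Subtype.ext (Subtype.ext h)
  · intro x hx
    rw [Finset.mem_filter] at hx
    exact ⟨⟨⟨x, hx.1⟩, hx.2⟩, Finset.mem_univ _, rfl⟩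

theorem wsNorm_nonneg (F : AugSheaf 𝔽 X) {n : ℕ} (f : F.Cochain n) : 0 ≤ F.wsNorm d n f := by
  rw [wsNorm_eq_suppNorm]
  exact F.suppNorm_nonneg (fun s => SComplex.weight_nonneg s) f

/-- For nonzero sections the masses in both dimensions are `1`, and for a cochain minimal modulo
coboundaries the quotient norm is the norm. -/
theorem wsNorm_le_coboundary (F : AugSheaf 𝔽 X) (hX : X.IsPure d) {n : ℕ} (hn : n ≤ d)
    (hF : ∀ x : X.Face, x.1.card = n ∨ x.1.card = n + 1 → Nontrivial (F.obj x)) {ε : ℝ}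
    (hε : 0 ≤ ε) (h : F.IsCoboundaryExpander d n ε) (f : F.Cochain n)
    (hf : ∀ b ∈ F.coboundaries n, F.wsNorm d n f ≤ F.wsNorm d n (f + b)) :
    ε * F.wsNorm d n f ≤ F.wsNorm d (n + 1) (F.coboundary n f) := by
  have h1 := h f
  rw [F.mass_eq_one hX (by omega) fun x => hF x.1 (Or.inr x.2),
    F.mass_eq_one hX (by omega) fun x => hF x.1 (Or.inl x.2), mul_one, mul_one] at h1
  refine le_trans (mul_le_mul_of_nonneg_left ?_ hε) h1
  exact le_ciInf fun b => hf b.1 b.2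

section Lift

variable (F : AugSheaf 𝔽 X) (u : SMap Y X)

/-- The comparison of the sections of the induced sheaf on a link with those of the pullback. -/
def liftMap (z : Y.Face) (y : Y.Face) (x : (X.link (u.face z)).Face) (hz : z.1 ⊆ y.1)
    (hx : x.1 = y.1.image u.toFun \ z.1.image u.toFun) :
    (F.link (u.face z)).obj x →ₗ[𝔽] (F.pullback u).obj y :=
  F.res (x := linkFace (u.face z) x) (y := u.face y) (le_of_eq (by
    apply Subtype.ext
    simp only [linkFace, SMap.face, hx]
    exact Finset.sdiff_union_of_subset (Finset.image_subset_image hz)))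

/-- Cochains on the link of the base give cochains on the covering, supported on the faces
containing `z`. -/
def lift (z : Y.Face) (n N : ℕ) :
    (F.link (u.face z)).Cochain n →ₗ[𝔽] (F.pullback u).Cochain N :=
  transfer (F.link (u.face z)) (F.pullback u) u.toFun z.1 (liftMap F u z) n N

variable {F u}

theorem liftMap_injective (z : Y.Face) (y : Y.Face) (x : (X.link (u.face z)).Face)
    (hz : z.1 ⊆ y.1) (hx : x.1 = y.1.image u.toFun \ z.1.image u.toFun) :
    Function.Injective (liftMap F u z y x hz hx) := by
  have hle : u.face y ≤ linkFace (u.face z) x := le_of_eq (by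
    apply Subtype.ext
    simp only [linkFace, SMap.face, hx]
    exact (Finset.sdiff_union_of_subset (Finset.image_subset_image hz)).symm)
  exact Function.LeftInverse.injective (g := F.res hle) fun s =>
    (F.res_res _ _ _).trans (F.res_refl _ _)

theorem sdiff_mem_link (z : Y.Face) {y : Finset W} (hy : y ∈ Y.faces) (hz : z.1 ⊆ y) :
    y.image u.toFun \ z.1.image u.toFun ∈ (X.link (u.face z)).faces := by
  rw [SComplex.mem_link]
  refine ⟨Finset.sdiff_disjoint, ?_⟩
  simp only [SMap.face]
  rw [Finset.sdiff_union_of_subset (Finset.image_subset_image hz)]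
  exact u.map_mem y hy

theorem suppOver_lift (z : Y.Face) {n N : ℕ} (g : (F.link (u.face z)).Cochain n) :
    (F.pullback u).SuppOver z.1 (lift F u z n N g) := by
  intro y hy
  by_contra hc
  exact hy (transfer_apply_of_not _ _ hc)

theorem coboundary_lift (hu : u.IsCovering) (z : Y.Face) {n N : ℕ} (hN : N = n + z.1.card)
    (g : (F.link (u.face z)).Cochain n) :
    (F.pullback u).coboundary N (lift F u z n N g) =
      lift F u z (n + 1) (N + 1) ((F.link (u.face z)).coboundary n g) := by
  refine coboundary_transfer (fun y hy => hu.injOn hy) (fun y hy hz => sdiff_mem_link z hy hz)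
    ?_ hN g
  intro y y' x x' hy hx hz hz' h h' s
  exact (F.res_res _ _ _).trans (F.res_res _ _ _).symm

/-- Each face of the link of the base has exactly one lift containing `z`, so the value of `f`
there, corrected by the sign, can be read off unambiguously. Together with `suppNorm_lift` this
identifies cochains over `z` with cochains of the link, up to one factor in the norm. -/
theorem exists_lift_eq (hu : u.IsCovering) (z : Y.Face) (hz : z.1.Nonempty) {n N : ℕ}
    (hN : N = n + z.1.card) {f : (F.pullback u).Cochain N} (hf : (F.pullback u).SuppOver z.1 f) :
    ∃ g, lift F u z n N g = f := by
  have key : ∀ x : (X.link (u.face z)).CardFace n, ∃ s : (F.link (u.face z)).obj x.1,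
      ∀ (y : Y.CardFace N) (hzy : z.1 ⊆ y.1.1)
        (hx : x.1.1 = y.1.1.image u.toFun \ z.1.image u.toFun),
        transferSign u.toFun z.1 y.1.1 • liftMap F u z y.1 x.1 hzy hx s = f y := by
    intro x
    have hx := SComplex.mem_link.1 x.1.2
    obtain ⟨y, hy, hzy, hyx⟩ := hu.exists_lift hz z.2 hx.2 Finset.subset_union_right
    have hx' : x.1.1 = y.image u.toFun \ z.1.image u.toFun := by
      rw [hyx]; exact (Finset.union_sdiff_cancel_right hx.1).symm
    have hyc : y.card = N := by
      rw [← hu.card_image hy, hyx, Finset.card_union_of_disjoint hx.1, x.2, hN,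
        ← hu.card_image z.2]
      rfl
    have hle : u.face ⟨y, hy⟩ ≤ linkFace (u.face z) x.1 := le_of_eq (Subtype.ext hyx)
    refine ⟨transferSign u.toFun z.1 y • F.res hle (f ⟨⟨y, hy⟩, hyc⟩), ?_⟩
    intro y' hzy' hxy'
    have : y' = ⟨⟨y, hy⟩, hyc⟩ := by
      apply Subtype.ext; apply Subtype.ext
      refine hu.eq_of_image_eq hz y'.1.2 hy hzy' hzy ?_
      rw [hyx, hxy']
      exact (Finset.sdiff_union_of_subset (Finset.image_subset_image hzy')).symm
    subst this
    have h1 : liftMap F u z ⟨y, hy⟩ x.1 hzy' hxy' (F.res hle (f ⟨⟨y, hy⟩, hyc⟩)) =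
        f ⟨⟨y, hy⟩, hyc⟩ := (F.res_res _ _ _).trans (F.res_refl _ _)
    have h2 : liftMap F u z ⟨y, hy⟩ x.1 hzy' hxy' (transferSign u.toFun z.1 y •
        F.res hle (f ⟨⟨y, hy⟩, hyc⟩)) = transferSign u.toFun z.1 y • f ⟨⟨y, hy⟩, hyc⟩ :=
      (map_zsmul (liftMap F u z ⟨y, hy⟩ x.1 hzy' hxy') _ _).trans (congrArg _ h1)
    refine (congrArg _ h2).trans ?_
    rw [smul_smul, transferSign_mul_self, one_smul]
  choose g hg using key
  refine ⟨g, ?_⟩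
  funext y
  by_cases hzy : z.1 ⊆ y.1.1
  · have hc : (y.1.1.image u.toFun \ z.1.image u.toFun).card = n := by
      rw [Finset.card_sdiff_of_subset (Finset.image_subset_image hzy), hu.card_image y.1.2,
        hu.card_image z.2, y.2]
      omega
    unfold lift
    rw [transfer_apply g y ⟨⟨_, sdiff_mem_link z y.1.2 hzy⟩, hc⟩ hzy rfl]
    exact hg _ y hzy rfl
  · have h1 : f y = 0 := by
      by_contra hne
      exact hzy (hf y hne)
    rw [h1]
    exact transfer_apply_of_not _ _ hzy

/-- Faces over `z` correspond bijectively to faces of the link; the factor combines the weight ratio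
of the covering with that of `SComplex.weight_link`, which depends only on the dimensions. -/
theorem suppNorm_lift (hu : u.IsCovering) (hX : X.IsPure d) (z : Y.Face) (hz : z.1.Nonempty)
    (hzd : z.1.card ≤ d) {n N : ℕ} (hN : N = n + z.1.card)
    (g : (F.link (u.face z)).Cochain n) :
    (F.pullback u).suppNorm (Y.weight d) (lift F u z n N g) =
      u.weightRatio d * X.weight d (u.face z).1 * (N.choose z.1.card *
        (F.link (u.face z)).wsNorm (d - z.1.card) n g) := by
  rw [wsNorm_eq_suppNorm]
  unfold suppNorm
  have hc : (u.face z).1.card = z.1.card := hu.card_image z.2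
  rw [Finset.mul_sum, Finset.mul_sum]
  refine Finset.sum_bij (fun y _ => y.image u.toFun \ z.1.image u.toFun) ?_ ?_ ?_ ?_
  · intro y₀ hy₀
    obtain ⟨y, hy, rfl⟩ := (mem_supp _).1 hy₀
    have hzy := suppOver_lift z g y hy
    have hcard : (y.1.1.image u.toFun \ z.1.image u.toFun).card = n := by
      rw [Finset.card_sdiff_of_subset (Finset.image_subset_image hzy), hu.card_image y.1.2,
        hu.card_image z.2, y.2]
      omega
    refine (coe_mem_supp _ ⟨⟨_, sdiff_mem_link z y.1.2 hzy⟩, hcard⟩).2 fun h0 => hy ?_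
    unfold lift
    rw [transfer_apply g y ⟨⟨_, sdiff_mem_link z y.1.2 hzy⟩, hcard⟩ hzy rfl, h0, map_zero,
      smul_zero]
  · intro y₀ hy₀ y₁ hy₁ h
    obtain ⟨y, hy, rfl⟩ := (mem_supp _).1 hy₀
    obtain ⟨y', hy', rfl⟩ := (mem_supp _).1 hy₁
    have hzy := suppOver_lift z g y hy
    have hzy' := suppOver_lift z g y' hy'
    refine hu.eq_of_image_eq hz y.1.2 y'.1.2 hzy hzy' ?_
    rw [← Finset.sdiff_union_of_subset (Finset.image_subset_image (f := u.toFun) hzy), h,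
      Finset.sdiff_union_of_subset (Finset.image_subset_image hzy')]
  · intro x₀ hx₀
    obtain ⟨x, hx, rfl⟩ := (mem_supp _).1 hx₀
    have hx' := SComplex.mem_link.1 x.1.2
    obtain ⟨y, hy, hzy, hyx⟩ := hu.exists_lift hz z.2 hx'.2 Finset.subset_union_right
    have hxy : x.1.1 = y.image u.toFun \ z.1.image u.toFun := by
      rw [hyx]; exact (Finset.union_sdiff_cancel_right hx'.1).symm
    have hyc : y.card = N := by
      rw [← hu.card_image hy, hyx, Finset.card_union_of_disjoint hx'.1, x.2, hN, hc]
    refine ⟨y, (coe_mem_supp _ ⟨⟨y, hy⟩, hyc⟩).2 ?_, hxy.symm⟩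
    unfold lift
    rw [transfer_apply g ⟨⟨y, hy⟩, hyc⟩ x hzy hxy]
    intro h0
    apply hx
    have h1 : transferSign u.toFun z.1 y • transferSign u.toFun z.1 y •
        liftMap F u z ⟨y, hy⟩ x.1 hzy hxy (g x) = 0 := by
      rw [h0, smul_zero]
    rw [smul_smul, transferSign_mul_self, one_smul] at h1
    exact liftMap_injective z _ _ hzy hxy (h1.trans (map_zero _).symm)
  · intro y₀ hy₀
    obtain ⟨y, hy, rfl⟩ := (mem_supp _).1 hy₀
    have hzy := suppOver_lift z g y hy
    have hcard : (y.1.1.image u.toFun \ z.1.image u.toFun).card = n := by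
      rw [Finset.card_sdiff_of_subset (Finset.image_subset_image hzy), hu.card_image y.1.2,
        hu.card_image z.2, y.2]
      omega
    have h1 := SComplex.weight_link hX (z := u.face z) (by rw [hc]; exact hzd)
      (sdiff_mem_link z y.1.2 hzy)
    rw [hc, hcard, ← hN] at h1
    have hne : y.1.1.Nonempty := hz.mono hzy
    rw [hu.weight_eq hX hne y.1.2]
    have h2 : y.1.1.image u.toFun \ z.1.image u.toFun ∪ (u.face z).1 = y.1.1.image u.toFun :=
      Finset.sdiff_union_of_subset (Finset.image_subset_image hzy)
    rw [h2] at h1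
    rw [← h1]
    ring

theorem expansionMin_le {k i : ℕ} (hi : i ≤ k) (ε : ℕ → ℝ) :
    expansionMin k ε ≤ ((k : ℝ) + 2) * ε i / ((k : ℝ) + 1 - (i : ℝ)) :=
  Finset.inf'_le (fun i : ℕ => ((k : ℝ) + 2) * ε i / ((k : ℝ) + 1 - (i : ℝ)))
    (Finset.mem_range.2 (by omega))

theorem expansionMin_pos {k : ℕ} {ε : ℕ → ℝ} (hε : ∀ i ≤ k, 0 < ε i) : 0 < expansionMin k ε := by
  unfold expansionMin
  refine (Finset.lt_inf'_iff _).2 ?_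
  intro i hi
  have hi' : i ≤ k := by simpa [Nat.lt_succ_iff] using hi
  have h1 : (i : ℝ) ≤ k := by exact_mod_cast hi'
  have := hε i hi'
  have h2 : (0 : ℝ) < k + 1 - i := by linarith
  positivity

/-- Cochains over `z` and their coboundaries are lifts from the link of the base, where expansion is
assumed with constant `ε i`, `i = |z| - 1`. The norms of degrees `k` and `k + 1` are scaled by
`(k+1).choose (i+1)` and `(k+2).choose (i+1)`, and the quotient of these is the factor `(k + 2) / (k
+ 1 - i)` in `expansionMin`. -/
theorem starExpansion_pullback (hu : u.IsCovering) (hX : X.IsPure d) {k : ℕ} (hk : k + 1 ≤ d)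
    (hF : ∀ x : X.Face, x.1.card = k + 1 ∨ x.1.card = k + 2 → Nontrivial (F.obj x))
    {ε : ℕ → ℝ} (hε : ∀ i ≤ k, 0 < ε i)
    (h : ∀ i ≤ k, F.IsLocalCoboundaryExpander d i k (ε i)) {z : Finset W} (hzY : z ∈ Y.faces)
    (hz : z.Nonempty) :
    (F.pullback u).StarExpansion (Y.weight d) k (expansionMin k ε) z := by
  intro f hf hmin
  have hw0 : ∀ s, 0 ≤ Y.weight d s := fun s => SComplex.weight_nonneg s
  -- No face with `k + 1` vertices contains such a `z`, so the cochain is zero.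
  by_cases hzk : k + 1 < z.card
  · have : (F.pullback u).supp f = ∅ := by
      refine Finset.eq_empty_of_forall_notMem fun s hs => ?_
      obtain ⟨x, hx, rfl⟩ := (mem_supp _).1 hs
      have := Finset.card_le_card (hf x hx)
      rw [x.2] at this
      omega
    unfold suppNorm
    rw [this, Finset.sum_empty, mul_zero]
    exact Finset.sum_nonneg fun _ _ => hw0 _
  obtain ⟨i, hi⟩ : ∃ i, z.card = i + 1 := ⟨z.card - 1, by have := hz.card_pos; omega⟩
  have hik : i ≤ k := by omega
  let zf : Y.Face := ⟨z, hzY⟩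
  have hN : k + 1 = (k - i) + zf.1.card := by simp only [zf, hi]; omega
  obtain ⟨g, hg⟩ := exists_lift_eq hu zf hz hN hf
  have hzc : (u.face zf).1.card = i + 1 := (hu.card_image hzY).trans hi
  have hwz := SComplex.weight_pos hX (u.face zf).2
  have hr := hu.weightRatio_pos hX
  have n1 := suppNorm_lift hu hX zf hz (by simp only [zf, hi]; omega) hN g
  have n2 := suppNorm_lift hu hX zf hz (by simp only [zf, hi]; omega)
    (show k + 1 + 1 = (k - i + 1) + zf.1.card by omega) ((F.link (u.face zf)).coboundary (k - i) g)
  rw [← coboundary_lift hu zf hN, hg] at n2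
  rw [hg] at n1
  have hzi : zf.1.card = i + 1 := hi
  rw [hzi] at n1 n2
  have hch1 : 0 < (k + 1).choose (i + 1) := Nat.choose_pos (by omega)
  have hloc := wsNorm_le_coboundary (F.link (u.face zf)) (d := d - (i + 1)) (n := k - i)
    (by have := SComplex.isPure_link hX (u.face zf) (by omega); rwa [hzc] at this)
    (by omega) ?_ (hε i hik).le (h i hik (u.face zf) hzc) g ?_
  · set α := u.weightRatio d * X.weight d (u.face zf).1 with hα
    have hα0 : 0 < α := mul_pos hr hwz
    rw [n1, n2]
    have hn0 := wsNorm_nonneg (d := d - (i + 1)) (F.link (u.face zf)) g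
    have hik' : (i : ℝ) ≤ k := by exact_mod_cast hik
    have hpos : (0 : ℝ) < k + 1 - i := by linarith
    have hchoose : ((k : ℝ) + 2) * (k + 1).choose (i + 1) =
        (k + 1 + 1).choose (i + 1) * (k + 1 - i) := by
      have h0 := Nat.choose_mul_succ_eq (k + 1) (i + 1)
      have h1 : ((k + 1).choose (i + 1) : ℝ) * ((k + 1 + 1 : ℕ) : ℝ) =
          (k + 1 + 1).choose (i + 1) * ((k + 1 + 1 - (i + 1) : ℕ) : ℝ) := by exact_mod_cast h0
      rw [Nat.cast_sub (by omega)] at h1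
      push_cast at h1 ⊢
      linarith
    calc expansionMin k ε * (α * ((k + 1).choose (i + 1) *
          (F.link (u.face zf)).wsNorm (d - (i + 1)) (k - i) g))
        ≤ (((k : ℝ) + 2) * ε i / ((k : ℝ) + 1 - i)) * (α * ((k + 1).choose (i + 1) *
          (F.link (u.face zf)).wsNorm (d - (i + 1)) (k - i) g)) := by
          gcongr
          exact expansionMin_le hik ε
      _ = α * (((k : ℝ) + 2) * (k + 1).choose (i + 1) / (k + 1 - i) * (ε i *
          (F.link (u.face zf)).wsNorm (d - (i + 1)) (k - i) g)) := by
          field_simp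
      _ = α * ((k + 1 + 1).choose (i + 1) * (ε i *
          (F.link (u.face zf)).wsNorm (d - (i + 1)) (k - i) g)) := by
          rw [hchoose, mul_div_cancel_right₀ _ hpos.ne']
      _ ≤ _ := by gcongr
  · intro x hx
    refine hF (linkFace (u.face zf) x) ?_
    have hd := (SComplex.mem_link.1 x.2).1
    simp only [linkFace]
    rw [Finset.card_union_of_disjoint hd, hzc]
    omega
  · intro b hb
    -- A coboundary in the link lifts to the coboundary of a cochain over `z`. In the lowest degree
    -- the coboundaries are zero by convention, and `g' = 0` serves.
    have hb' : ∃ g' : (F.pullback u).Cochain k, (F.pullback u).SuppOver z g' ∧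
        lift F u zf (k - i) (k + 1) b = (F.pullback u).coboundary k g' := by
      rcases Nat.eq_zero_or_pos (k - i) with h0 | h0
      · refine ⟨0, fun x hx => absurd rfl hx, ?_⟩
        rw [map_zero]
        have : b = 0 := by
          revert b
          rw [h0]
          intro b hb
          simpa [coboundaries] using hb
        rw [this, map_zero]
      · obtain ⟨n, hn⟩ : ∃ n, k - i = n + 1 := ⟨k - i - 1, by omega⟩
        have hk' : k = n + zf.1.card := by omega
        clear hmin
        have : ∃ b' : (F.link (u.face zf)).Cochain n, lift F u zf (k - i) (k + 1) b =
            lift F u zf (n + 1) (k + 1) ((F.link (u.face zf)).coboundary n b') := by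
          clear n1 n2 hg hN g
          revert b
          rw [hn]
          intro b hb
          obtain ⟨b', rfl⟩ := hb
          exact ⟨b', rfl⟩
        obtain ⟨b', hb'⟩ := this
        refine ⟨lift F u zf n k b', suppOver_lift zf b', ?_⟩
        rw [hb', coboundary_lift hu zf hk']
    obtain ⟨g', hg', hlb⟩ := hb'
    have hm := hmin g' hg'
    rw [← hlb, ← hg, ← map_add,
      suppNorm_lift hu hX zf hz (by simp only [zf, hi]; omega) hN,
      suppNorm_lift hu hX zf hz (by simp only [zf, hi]; omega) hN, hzi] at hm
    have hα0 : 0 < u.weightRatio d * X.weight d (u.face zf).1 := mul_pos hr hwz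
    have hc0 : (0 : ℝ) < (k + 1).choose (i + 1) := by exact_mod_cast hch1
    exact le_of_mul_le_mul_left (le_of_mul_le_mul_left hm hα0) hc0

end Lift

end AugSheaf

end

/-! ### Vanishing of light locally minimal cocycles -/

noncomputable section

namespace AugSheaf

variable {𝔽 : Type*} [Field 𝔽] {W V : Type*} [LinearOrder W] [LinearOrder V]
variable {Y : SComplex W} {X : SComplex V} {d : ℕ}

/-- Test the expansion on a cochain supported on one face `z` with `k + 1` vertices. It is trivially
minimal, as no smaller face contains `z`, and its coboundary lives on the cofaces of `z`, whose
total weight is `(k + 2) w(z)`. The bound is needed to make `fatScale` at most `1`. -/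
theorem StarExpansion.le_add_two (F : AugSheaf 𝔽 X) (hX : X.IsPure d) {k : ℕ} (hk : k + 1 ≤ d)
    (hF : ∀ x : X.Face, x.1.card = k + 1 → Nontrivial (F.obj x)) {ε : ℝ}
    (h : ∀ z ∈ X.faces, z.Nonempty → F.StarExpansion (X.weight d) k ε z) : ε ≤ k + 2 := by
  classical
  obtain ⟨t, ht, -, htc⟩ := hX ∅ X.empty_mem
  obtain ⟨z, hzt, hzc⟩ := Finset.exists_subset_card_eq (show k + 1 ≤ t.card by omega)
  have hzX := X.down_closed ht hzt
  have hzne : z.Nonempty := by rw [← Finset.card_pos]; omega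
  let zc : X.CardFace (k + 1) := ⟨⟨z, hzX⟩, hzc⟩
  obtain ⟨s, hs⟩ := @exists_ne _ (hF zc.1 zc.2) (0 : F.obj zc.1)
  let f : F.Cochain (k + 1) := Pi.single zc s
  have hfz : ∀ x, f x ≠ 0 → x = zc := by
    intro x hx
    by_contra hne
    exact hx (by simp only [f]; rw [Pi.single_eq_of_ne hne])
  have hsupp : F.supp f = {z} := by
    ext y
    rw [mem_supp, Finset.mem_singleton]
    constructor
    · rintro ⟨x, hx, rfl⟩
      rw [hfz x hx]
    · rintro rfl
      exact ⟨zc, by simpa [f] using hs, rfl⟩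
  have hover : F.SuppOver z f := by
    intro x hx
    rw [hfz x hx]
  have h1 := h z hzX hzne f hover (fun g hg => by
    have : g = 0 := by
      funext x
      by_contra hne
      have := Finset.card_le_card (hg x hne)
      rw [hzc, x.2] at this
      omega
    rw [this, map_zero, add_zero])
  have hwpos := SComplex.weight_pos hX hzX
  have h2 : F.suppNorm (X.weight d) (F.coboundary (k + 1) f) ≤ (k + 2) * X.weight d z := by
    have h3 := SComplex.sum_weight hX (x := z) (m := k + 2) (by omega) (by omega)
    rw [hzc, Nat.choose_succ_self_right] at h3
    push_cast at h3
    have h4 : (k : ℝ) + 1 + 1 = k + 2 := by ring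
    rw [← h4, ← h3]
    refine Finset.sum_le_sum_of_subset_of_nonneg ?_ fun _ _ _ => SComplex.weight_nonneg _
    intro y hy
    obtain ⟨y', hy', rfl⟩ := (mem_supp _).1 hy
    obtain ⟨v, hv, hne⟩ := coboundary_ne_zero F hy'
    refine Finset.mem_filter.2 ⟨y'.1.2, y'.2, ?_⟩
    exact (hover _ hne).trans (facet_le y' v hv)
  unfold suppNorm at h1 h2
  rw [hsupp, Finset.sum_singleton] at h1
  exact le_of_mul_le_mul_right (h1.trans h2) hwpos

/-- The scale at which the local expansion of dimension `k` takes effect. -/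
def fatScale (k : ℕ) (ε : ℝ) : ℝ := ε / (((k : ℝ) + 1) ^ 2 * 2 ^ (2 * k + 6))

theorem fatScale_pos {k : ℕ} {ε : ℝ} (hε : 0 < ε) : 0 < fatScale k ε := by
  unfold fatScale; positivity

theorem fatScale_le_one {k : ℕ} {ε : ℝ} (hε : ε ≤ k + 2) : fatScale k ε ≤ 1 := by
  unfold fatScale
  rw [div_le_one (by positivity)]
  have h1 : (1 : ℝ) ≤ 2 ^ (2 * k) := one_le_pow₀ (by norm_num)
  have h2 : (64 : ℝ) ≤ 2 ^ (2 * k + 6) := by rw [pow_add]; linarith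
  have h3 : (0 : ℝ) ≤ k := k.cast_nonneg
  calc ε ≤ k + 2 := hε
    _ ≤ ((k : ℝ) + 1) ^ 2 * 64 := by nlinarith
    _ ≤ _ := by gcongr

/-- A locally minimal cocycle of small weight on a covering vanishes. -/
theorem eq_zero_of_isLocallyMinimal (F : AugSheaf 𝔽 X) {u : SMap Y X} (hu : u.IsCovering)
    (hX : X.IsPure d) (hd : 2 ≤ d) (hs : X.IsStronglyConnected d) (hY : Y.IsConnected) {k : ℕ}
    (hk : k + 1 ≤ d)
    (hF : ∀ x : X.Face, x.1.card = k + 1 ∨ x.1.card = k + 2 → Nontrivial (F.obj x))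
    {ε : ℕ → ℝ} (hε : ∀ i ≤ k, 0 < ε i)
    (h : ∀ i ≤ k, F.IsLocalCoboundaryExpander d i k (ε i)) {lam : ℝ} (hlam : 0 < lam)
    (hlam1 : d * lam ≤ 1) (hlam2 : d * lam ≤ fatScale k (expansionMin k ε) ^ (2 ^ k))
    (hspec : X.IsCodimTwoSpectralExpander d (Set.Icc (-1) lam))
    (f : (F.pullback u).Cochain (k + 1)) (hf : (F.pullback u).IsLocallyMinimal (Y.weight d) k f)
    (hsmall : (F.pullback u).suppNorm (Y.weight d) f <
      fatScale k (expansionMin k ε) ^ (2 ^ (k + 1) - 1))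
    (hcoc : (F.pullback u).coboundary (k + 1) f = 0) : f = 0 := by
  classical
  have hYp := hu.isPure hX
  have hε0 := expansionMin_pos hε
  set E := expansionMin k ε with hE
  have hstar : ∀ z ∈ Y.faces, z.Nonempty → (F.pullback u).StarExpansion (Y.weight d) k E z :=
    fun z hz hne => starExpansion_pullback hu hX hk hF hε h hz hne
  have hE2 : E ≤ k + 2 := StarExpansion.le_add_two (F.pullback u) hYp hk
    (fun x hx => hF (u.face x) (Or.inl ((hu.card_image x.2).trans hx))) hstar
  have key := (F.pullback u).suppNorm_le_of_isLocallyMinimal hYp hk (fatScale_pos hε0).le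
    (fatScale_le_one hE2) hε0.le hlam2
    (fun z hz hc => hu.linkMixing_of_base hX hd hs hY hlam (by rwa [mul_comm] at hlam1) hspec hz
      (by omega)) hstar f hf hsmall
  have hzero : (F.pullback u).suppNorm (Y.weight d) ((F.pullback u).coboundary (k + 1) f) = 0 := by
    rw [hcoc]
    unfold suppNorm
    refine Finset.sum_eq_zero fun s hs => ?_
    obtain ⟨x, hx, -⟩ := (mem_supp _).1 hs
    exact absurd rfl hx
  rw [hzero, zero_add] at key
  have hN0 := (F.pullback u).suppNorm_nonneg (w := Y.weight d)
    (fun s => SComplex.weight_nonneg s) f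
  -- The denominator of `fatScale` is designed for this: the error term becomes `(k + 2) / (8 (k +
  -- 1))` times `E`, so it can be absorbed into the left-hand side.
  have hb : (2 : ℝ) ^ (k + 2) * (fatScale k E * (((k : ℝ) + 1) * (k + 2)) * 2 ^ (k + 1)) ≤
      E / 2 := by
    have h3 : (0 : ℝ) ≤ k := k.cast_nonneg
    have e1 : (2 : ℝ) ^ (2 * k + 6) = 8 * (2 ^ (k + 2) * 2 ^ (k + 1)) := by
      rw [← pow_add]
      have : k + 2 + (k + 1) = 2 * k + 3 := by ring
      rw [this, pow_add, pow_add]; norm_num; ring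
    have e2 : (2 : ℝ) ^ (k + 2) * (fatScale k E * (((k : ℝ) + 1) * (k + 2)) * 2 ^ (k + 1)) =
        E * ((k + 2) / (8 * (k + 1))) := by
      unfold fatScale
      rw [e1]
      field_simp
    have e3 : ((k : ℝ) + 2) / (8 * (k + 1)) ≤ 1 / 2 := by
      rw [div_le_div_iff₀ (by positivity) (by norm_num)]
      linarith
    rw [e2]
    nlinarith
  have hN : (F.pullback u).suppNorm (Y.weight d) f ≤ 0 := by
    nlinarith
  by_contra hne
  obtain ⟨x, hx⟩ := Function.ne_iff.1 hne
  have hpos : 0 < (F.pullback u).suppNorm (Y.weight d) f :=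
    lt_of_lt_of_le (SComplex.weight_pos hYp x.1.2)
      (Finset.single_le_sum (f := Y.weight d) (fun _ _ => SComplex.weight_nonneg _)
        ((coe_mem_supp _ x).2 hx))
  linarith

end AugSheaf

end

/-! ### Bounded degree, counting and local improvements -/

noncomputable section

namespace SComplex

variable {W V : Type*} [LinearOrder W] [LinearOrder V] {Y : SComplex W} {X : SComplex V}
  {d n Q : ℕ}

/-- Every nonempty face lies in at most `Q` faces. -/
def HasDegreeLE (Y : SComplex W) (Q : ℕ) : Prop :=
  ∀ z ∈ Y.faces, z.Nonempty → (Y.faces.filter fun y => z ⊆ y).card ≤ Q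

/-- The star of a nonempty face embeds into the base, so the number of faces of the base bounds the
degrees on all levels at once. -/
theorem _root_.SMap.IsCovering.hasDegreeLE {u : SMap Y X} (hu : u.IsCovering) :
    Y.HasDegreeLE X.faces.card := by
  intro z _ hne
  refine Finset.card_le_card_of_injOn (fun y => y.image u.toFun) ?_ ?_
  · intro y hy
    exact u.map_mem y (Finset.mem_filter.1 hy).1
  · intro y hy y' hy' h
    exact hu.eq_of_image_eq hne (Finset.mem_filter.1 hy).1 (Finset.mem_filter.1 hy').1
      (Finset.mem_filter.1 hy).2 (Finset.mem_filter.1 hy').2 h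

theorem topCount_le (hQ : Y.HasDegreeLE Q) {z : Finset W} (hz : z ∈ Y.faces) (hne : z.Nonempty) :
    Y.topCount d z ≤ Q := by
  refine le_trans (Finset.card_le_card ?_) (hQ z hz hne)
  intro y hy
  rw [Finset.mem_filter] at hy ⊢
  exact ⟨hy.1, hy.2.2⟩

theorem card_cardFace (Y : SComplex W) (n : ℕ) :
    Fintype.card (Y.CardFace n) = (Y.faces.filter fun y => y.card = n).card := by
  rw [← Finset.card_univ]
  refine Finset.card_bij (fun x _ => x.1.1) ?_ ?_ ?_
  · intro x _
    exact Finset.mem_filter.2 ⟨x.1.2, x.2⟩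
  · intro x _ y _ h
    exact Subtype.ext (Subtype.ext h)
  · intro x hx
    rw [Finset.mem_filter] at hx
    exact ⟨⟨⟨x, hx.1⟩, hx.2⟩, Finset.mem_univ _, rfl⟩

theorem card_le_of_forall_exists_subset (hQ : Y.HasDegreeLE Q) {A B : Finset (Finset W)}
    (hA : ∀ x ∈ A, x ∈ Y.faces ∧ x.Nonempty) (hB : ∀ y ∈ B, y ∈ Y.faces ∧ ∃ x ∈ A, x ⊆ y) :
    B.card ≤ Q * A.card := by
  have h1 : B ⊆ A.biUnion fun x => Y.faces.filter fun y => x ⊆ y := by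
    intro y hy
    obtain ⟨h1, x, hx, hxy⟩ := hB y hy
    exact Finset.mem_biUnion.2 ⟨x, hx, Finset.mem_filter.2 ⟨h1, hxy⟩⟩
  refine (Finset.card_le_card h1).trans ?_
  rw [mul_comm]
  exact Finset.card_biUnion_le_card_mul _ _ _ fun x hx => hQ x (hA x hx).1 (hA x hx).2

theorem card_cardFace_succ_le (hQ : Y.HasDegreeLE Q) (hn : 1 ≤ n) :
    Fintype.card (Y.CardFace (n + 1)) ≤ Q * Fintype.card (Y.CardFace n) := by
  rw [card_cardFace, card_cardFace]
  refine card_le_of_forall_exists_subset hQ ?_ ?_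
  · intro x hx
    rw [Finset.mem_filter] at hx
    exact ⟨hx.1, Finset.card_pos.1 (by omega)⟩
  · intro y hy
    rw [Finset.mem_filter] at hy
    obtain ⟨x, hxy, hx⟩ := Finset.exists_subset_card_eq (show n ≤ y.card by omega)
    exact ⟨hy.1, x, Finset.mem_filter.2 ⟨Y.down_closed hy.1 hxy, hx⟩, hxy⟩

theorem exists_superset_card (hY : Y.IsPure d) {x : Finset W} (hx : x ∈ Y.faces) (hxn : x.card ≤ n)
    (hn : n ≤ d + 1) : ∃ y ∈ Y.faces, x ⊆ y ∧ y.card = n := by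
  obtain ⟨t, ht, hxt, hc⟩ := hY x hx
  obtain ⟨y, hxy, hyt, hyc⟩ := Finset.exists_subsuperset_card_eq hxt hxn (by omega)
  exact ⟨y, Y.down_closed ht hyt, hxy, hyc⟩

theorem card_cardFace_le_succ (hY : Y.IsPure d) (hn : n ≤ d) :
    Fintype.card (Y.CardFace n) ≤ (n + 1) * Fintype.card (Y.CardFace (n + 1)) := by
  rw [card_cardFace, card_cardFace, mul_comm]
  have h1 : (Y.faces.filter fun y => y.card = n) ⊆
      (Y.faces.filter fun y => y.card = n + 1).biUnion fun y => y.powersetCard n := by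
    intro x hx
    rw [Finset.mem_filter] at hx
    obtain ⟨y, hy, hxy, hyc⟩ := exists_superset_card hY hx.1 (show x.card ≤ n + 1 by omega)
      (by omega)
    exact Finset.mem_biUnion.2 ⟨y, Finset.mem_filter.2 ⟨hy, hyc⟩,
      Finset.mem_powersetCard.2 ⟨hxy, hx.2⟩⟩
  refine (Finset.card_le_card h1).trans (Finset.card_biUnion_le_card_mul _ _ _ fun y hy => ?_)
  rw [Finset.card_powersetCard, (Finset.mem_filter.1 hy).2, Nat.choose_succ_self_right]

theorem cardFace_nonempty (hY : Y.IsPure d) (hn : n ≤ d + 1) : Nonempty (Y.CardFace n) := by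
  obtain ⟨y, hy, -, hc⟩ := exists_superset_card hY Y.empty_mem (n := n) (by simp) hn
  exact ⟨⟨⟨y, hy⟩, hc⟩⟩

/-- The set of vertices. -/
def verts (Y : SComplex W) : Finset W := Y.faces.biUnion fun y => y

theorem mem_verts {v : W} : v ∈ Y.verts ↔ {v} ∈ Y.faces := by
  unfold verts
  rw [Finset.mem_biUnion]
  constructor
  · rintro ⟨y, hy, hv⟩
    exact Y.down_closed hy (by simpa using hv)
  · intro h
    exact ⟨{v}, h, by simp⟩

theorem card_verts_le (hY : Y.IsPure d) (hn : 1 ≤ n) (hnd : n ≤ d + 1) :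
    Y.verts.card ≤ n * Fintype.card (Y.CardFace n) := by
  rw [card_cardFace, mul_comm]
  have h1 : Y.verts ⊆ (Y.faces.filter fun y => y.card = n).biUnion fun y => y := by
    intro v hv
    obtain ⟨y, hy, hvy, hyc⟩ := exists_superset_card hY (mem_verts.1 hv) (n := n) (by simpa) hnd
    exact Finset.mem_biUnion.2 ⟨y, Finset.mem_filter.2 ⟨hy, hyc⟩, by simpa using hvy⟩
  refine (Finset.card_le_card h1).trans (Finset.card_biUnion_le_card_mul _ _ _ fun y hy => ?_)
  exact (Finset.mem_filter.1 hy).2.le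

/-- The faces with `n` vertices that lie in a face containing `v`. -/
def window (Y : SComplex W) (n : ℕ) (v : W) : Finset (Y.CardFace n) :=
  Finset.univ.filter fun x => insert v x.1.1 ∈ Y.faces

theorem card_window_le (hQ : Y.HasDegreeLE Q) (v : W) : (Y.window n v).card ≤ 2 * Q := by
  by_cases hv : {v} ∈ Y.faces
  · have hst := hQ {v} hv (Finset.singleton_nonempty v)
    set S := Y.faces.filter fun y => {v} ⊆ y with hS
    have h1 : (Y.window n v).image (fun x => x.1.1) ⊆ S ∪ S.image fun y => y.erase v := by
      intro x' hx'
      obtain ⟨x, hx, rfl⟩ := Finset.mem_image.1 hx'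
      have hx2 := (Finset.mem_filter.1 hx).2
      rw [Finset.mem_union]
      by_cases hvx : v ∈ x.1.1
      · exact Or.inl (Finset.mem_filter.2 ⟨x.1.2, by simpa using hvx⟩)
      · exact Or.inr (Finset.mem_image.2 ⟨_, Finset.mem_filter.2 ⟨hx2, by simp⟩,
          Finset.erase_insert hvx⟩)
    rw [← Finset.card_image_of_injective (Y.window n v)
      (f := fun x => x.1.1) fun x y h => Subtype.ext (Subtype.ext h)]
    refine (Finset.card_le_card h1).trans ((Finset.card_union_le _ _).trans ?_)
    have := Finset.card_image_le (s := S) (f := fun y => y.erase v)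
    omega
  · have : Y.window n v = ∅ := by
      refine Finset.eq_empty_of_forall_notMem fun x hx => hv ?_
      exact Y.down_closed (Finset.mem_filter.1 hx).2 (by simp)
    rw [this]; simp

/-- The vertices whose window meets that of `v`. -/
def nearby (Y : SComplex W) (n : ℕ) (v : W) : Finset W :=
  (Y.window n v).biUnion fun x => Y.verts.filter fun t => insert t x.1.1 ∈ Y.faces

theorem card_nearby_le (hY : Y.IsPure d) (hQ : Y.HasDegreeLE Q) (hn : 1 ≤ n) (v : W) :
    (Y.nearby n v).card ≤ 2 * Q * (Q * (d + 1)) := by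
  refine (Finset.card_biUnion_le_card_mul _ _ (Q * (d + 1)) fun x _ => ?_).trans
    (Nat.mul_le_mul_right _ (card_window_le hQ v))
  have h1 : (Y.verts.filter fun t => insert t x.1.1 ∈ Y.faces) ⊆
      (Y.faces.filter fun y => x.1.1 ⊆ y).biUnion fun y => y := by
    intro t ht
    exact Finset.mem_biUnion.2 ⟨insert t x.1.1, Finset.mem_filter.2
      ⟨(Finset.mem_filter.1 ht).2, Finset.subset_insert _ _⟩, Finset.mem_insert_self _ _⟩
  have hx : x.1.1.Nonempty := Finset.card_pos.1 (by rw [x.2]; omega)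
  refine (Finset.card_le_card h1).trans ((Finset.card_biUnion_le_card_mul _ _ (d + 1)
    fun y hy => ?_).trans (Nat.mul_le_mul_right _ (hQ x.1.1 x.1.2 hx)))
  exact card_le_of_mem hY (Finset.mem_filter.1 hy).1

end SComplex

namespace AugSheaf

variable {𝔽 : Type*} [Field 𝔽] {V : Type*} [LinearOrder V] {X : SComplex V} {d n Q : ℕ}

section Count

variable (F : AugSheaf 𝔽 X)

/-- The number of pairs of a face in the support and a top face containing it. -/
def suppCount (d : ℕ) (f : F.Cochain n) : ℕ := ∑ s ∈ F.supp f, X.topCount d s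

theorem suppNorm_eq_suppCount (f : F.Cochain n) : F.suppNorm (X.weight d) f =
    F.suppCount d f / (((d + 1).choose n : ℝ) * (X.topCount d ∅ : ℝ)) := by
  unfold suppNorm suppCount
  push_cast
  rw [Finset.sum_div]
  refine Finset.sum_congr rfl fun s hs => ?_
  rw [SComplex.weight_eq, (F.supp_subset_faces hs).2]

theorem suppCount_le (hQ : X.HasDegreeLE Q) (hn : 1 ≤ n) (f : F.Cochain n) :
    F.suppCount d f ≤ Q * (F.supp f).card := by
  unfold suppCount
  rw [mul_comm, ← smul_eq_mul]
  refine Finset.sum_le_card_nsmul _ _ _ fun s hs => ?_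
  have := F.supp_subset_faces hs
  exact SComplex.topCount_le hQ this.1 (Finset.card_pos.1 (by omega))

theorem card_cardFace_le_choose (hX : X.IsPure d) :
    Fintype.card (X.CardFace n) ≤ (d + 1).choose n * X.topCount d ∅ := by
  have h1 := SComplex.sum_topCount (X := X) (d := d) (x := ∅) (m := n) (by simp)
  simp only [Finset.empty_subset, and_true, Finset.card_empty, Nat.sub_zero] at h1
  rw [SComplex.card_cardFace, mul_comm, ← h1, Finset.card_eq_sum_ones]
  exact Finset.sum_le_sum fun s hs => SComplex.topCount_pos hX (Finset.mem_filter.1 hs).1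

/-- Converts weighted norms into proportions of faces: a support face lies in at most `Q` top faces,
and there are at most `(d + 1).choose n` times as many faces with `n` vertices as top faces. -/
theorem suppNorm_mul_card_le (hX : X.IsPure d) (hQ : X.HasDegreeLE Q) (hn : 1 ≤ n) (hnd : n ≤ d + 1)
    (f : F.Cochain n) :
    F.suppNorm (X.weight d) f * Fintype.card (X.CardFace n) ≤ Q * (F.supp f).card := by
  have h1 : (F.suppCount d f : ℝ) ≤ Q * (F.supp f).card := by
    exact_mod_cast F.suppCount_le hQ hn f
  have h2 : (Fintype.card (X.CardFace n) : ℝ) ≤ (d + 1).choose n * X.topCount d ∅ := by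
    exact_mod_cast card_cardFace_le_choose hX
  have h3 : (0 : ℝ) < (d + 1).choose n * X.topCount d ∅ :=
    mul_pos (by exact_mod_cast Nat.choose_pos hnd)
      (by exact_mod_cast SComplex.topCount_pos hX X.empty_mem)
  refine le_trans ?_ h1
  rw [suppNorm_eq_suppCount, div_mul_eq_mul_div, div_le_iff₀ h3]
  gcongr

theorem card_supp_coboundary_le (hQ : X.HasDegreeLE Q) (hn : 1 ≤ n) (f : F.Cochain n) :
    (F.supp (F.coboundary n f)).card ≤ Q * (F.supp f).card := by
  refine SComplex.card_le_of_forall_exists_subset hQ ?_ ?_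
  · intro x hx
    have := F.supp_subset_faces hx
    exact ⟨this.1, Finset.card_pos.1 (by omega)⟩
  · intro y₀ hy₀
    obtain ⟨y, hy, rfl⟩ := (mem_supp _).1 hy₀
    obtain ⟨v, hv, hne⟩ := coboundary_ne_zero F hy
    exact ⟨y.1.2, _, (coe_mem_supp _ _).2 hne, facet_le y v hv⟩

theorem card_supp_le_of_suppOver (hQ : X.HasDegreeLE Q) {v : V} {f : F.Cochain n}
    (hf : F.SuppOver {v} f) : (F.supp f).card ≤ Q := by
  rcases (F.supp f).eq_empty_or_nonempty with h | ⟨s, hs⟩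
  · rw [h]; simp
  · have key : ∀ s ∈ F.supp f, s ∈ X.faces ∧ {v} ⊆ s := by
      intro s hs
      obtain ⟨x, hx, rfl⟩ := (mem_supp _).1 hs
      exact ⟨x.1.2, hf x hx⟩
    refine le_trans (Finset.card_le_card fun s hs => Finset.mem_filter.2 (key s hs))
      (hQ {v} (X.down_closed (key s hs).1 (key s hs).2) (Finset.singleton_nonempty v))

end Count

section Improve

variable (F : AugSheaf 𝔽 X)

open scoped Classical in
/-- A cochain supported on the faces containing `v` whose coboundary decreases the support of the
cochain `t`, if there is one, and zero otherwise. -/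
def correction (d : ℕ) (v : V) (t : F.Cochain (n + 1)) : F.Cochain n :=
  if h : ∃ c : F.Cochain n, F.SuppOver {v} c ∧
      F.suppCount d (t + F.coboundary n c) < F.suppCount d t then h.choose else 0

/-- The local improvement of the cochain `f` at the vertex `v`. -/
def improve (d : ℕ) (v : V) (f : F.Cochain n) : F.Cochain n :=
  f + F.correction d v (F.restrict (fun s => v ∈ s) (F.coboundary n f))

theorem suppOver_correction (v : V) (t : F.Cochain (n + 1)) :
    F.SuppOver {v} (F.correction d v t) := by
  unfold correction
  split_ifs with h
  · exact h.choose_spec.1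
  · exact fun x hx => absurd rfl hx

theorem suppCount_eq_add_restrict (P : Finset V → Prop) (t : F.Cochain n) :
    F.suppCount d t = F.suppCount d (F.restrict P t) +
      F.suppCount d (F.restrict (fun s => ¬ P s) t) := by
  classical
  unfold suppCount
  rw [supp_restrict, supp_restrict, Finset.sum_filter_add_sum_filter_not]

theorem restrict_add (P : Finset V → Prop) (f g : F.Cochain n) :
    F.restrict P (f + g) = F.restrict P f + F.restrict P g := by
  funext x
  simp only [restrict, Pi.add_apply]
  split_ifs <;> simp

theorem suppOver_coboundary {v : V} {c : F.Cochain n} (hc : F.SuppOver {v} c) :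
    F.SuppOver {v} (F.coboundary n c) := by
  intro y hy
  obtain ⟨a, ha, hne⟩ := coboundary_ne_zero F hy
  exact (hc _ hne).trans (facet_le y a ha)

theorem suppCount_restrict_add {v : V} {c : F.Cochain n} (hc : F.SuppOver {v} c)
    (t : F.Cochain n) : F.suppCount d (t + c) =
      F.suppCount d (F.restrict (fun s => v ∈ s) t + c) +
        F.suppCount d (F.restrict (fun s => ¬ v ∈ s) t) := by
  have h1 : F.restrict (fun s => v ∈ s) c = c := by
    funext x
    simp only [restrict]
    split_ifs with h
    · rfl
    · by_contra hne
      exact h (by simpa using hc x (Ne.symm hne))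
  have h2 : F.restrict (fun s => ¬ v ∈ s) c = 0 := by
    funext x
    simp only [restrict]
    split_ifs with h
    · rfl
    · by_contra hne
      exact h (by simpa using hc x hne)
  rw [suppCount_eq_add_restrict F (fun s => v ∈ s) (t + c), restrict_add, restrict_add, h1, h2,
    add_zero]

theorem improve_eq_or_lt (v : V) (f : F.Cochain n) : F.improve d v f = f ∨
    F.suppCount d (F.coboundary n (F.improve d v f)) < F.suppCount d (F.coboundary n f) := by
  unfold improve
  by_cases h : ∃ c : F.Cochain n, F.SuppOver {v} c ∧
      F.suppCount d (F.restrict (fun s => v ∈ s) (F.coboundary n f) + F.coboundary n c) <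
        F.suppCount d (F.restrict (fun s => v ∈ s) (F.coboundary n f))
  · right
    have h1 : F.correction d v (F.restrict (fun s => v ∈ s) (F.coboundary n f)) = h.choose :=
      dif_pos h
    rw [h1, map_add, suppCount_restrict_add F (suppOver_coboundary F h.choose_spec.1),
      suppCount_eq_add_restrict F (fun s => v ∈ s) (F.coboundary n f)]
    exact Nat.add_lt_add_right h.choose_spec.2 _
  · left
    have h1 : F.correction d v (F.restrict (fun s => v ∈ s) (F.coboundary n f)) = 0 := dif_neg h
    rw [h1, add_zero]

/-- If some `c` over `v` lowered the count, the chosen correction would do so too, and therefore be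
nonzero; but a fixed cochain has correction zero. -/
theorem suppCount_le_of_improve_eq {v : V} {f : F.Cochain n} (hf : F.improve d v f = f)
    {c : F.Cochain n} (hc : F.SuppOver {v} c) :
    F.suppCount d (F.coboundary n f) ≤ F.suppCount d (F.coboundary n f + F.coboundary n c) := by
  by_contra! hlt
  rw [suppCount_restrict_add F (suppOver_coboundary F hc),
    suppCount_eq_add_restrict F (fun s => v ∈ s) (F.coboundary n f)] at hlt
  have h : ∃ c : F.Cochain n, F.SuppOver {v} c ∧
      F.suppCount d (F.restrict (fun s => v ∈ s) (F.coboundary n f) + F.coboundary n c) <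
        F.suppCount d (F.restrict (fun s => v ∈ s) (F.coboundary n f)) :=
    ⟨c, hc, by omega⟩
  have h1 : F.correction d v (F.restrict (fun s => v ∈ s) (F.coboundary n f)) = h.choose :=
    dif_pos h
  unfold improve at hf
  rw [h1] at hf
  have h2 : h.choose = 0 := by simpa using hf
  have h3 := h.choose_spec.2
  rw [h2, map_zero, add_zero] at h3
  exact lt_irrefl _ h3

theorem isLocallyMinimal_of_improve_eq {f : F.Cochain (n + 1)}
    (hf : ∀ v ∈ X.verts, F.improve d v f = f) :
    F.IsLocallyMinimal (X.weight d) (n + 1) (F.coboundary (n + 1) f) := by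
  intro v g hg
  by_cases hv : v ∈ X.verts
  · rw [suppNorm_eq_suppCount, suppNorm_eq_suppCount]
    gcongr
    exact F.suppCount_le_of_improve_eq (hf v hv) hg
  · have : g = 0 := by
      funext x
      by_contra hne
      exact hv (SComplex.mem_verts.2 (X.down_closed x.1.2 (hg x hne)))
    rw [this, map_zero, add_zero]

theorem improve_apply_of_not_mem {v : V} (f : F.Cochain n) {x : X.CardFace n}
    (hx : x ∉ X.window n v) : F.improve d v f x = f x := by
  unfold improve
  rw [Pi.add_apply]
  have : F.correction d v (F.restrict (fun s => v ∈ s) (F.coboundary n f)) x = 0 := by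
    by_contra hne
    have h1 := F.suppOver_correction v _ x hne
    refine hx (Finset.mem_filter.2 ⟨Finset.mem_univ _, ?_⟩)
    rw [Finset.insert_eq_of_mem (by simpa using h1)]
    exact x.1.2
  rw [this, add_zero]

/-- The correction is chosen as a function of the restriction of `df` to the star of `v` alone, so
equal data on the window give the same correction. This is what makes the decoder local. -/
theorem improve_congr {v : V} {f g : F.Cochain n} (h : ∀ x ∈ X.window n v, f x = g x)
    {x : X.CardFace n} (hx : f x = g x) : F.improve d v f x = F.improve d v g x := by
  unfold improve
  have : F.restrict (fun s => v ∈ s) (F.coboundary n f) =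
      F.restrict (fun s => v ∈ s) (F.coboundary n g) := by
    funext y
    simp only [restrict]
    split_ifs with hv
    · refine coboundary_congr F fun a ha => h _ (Finset.mem_filter.2 ⟨Finset.mem_univ _, ?_⟩)
      exact X.down_closed y.1.2 (Finset.insert_subset hv (facet_le y a ha))
    · rfl
  rw [Pi.add_apply, Pi.add_apply, this, hx]

theorem card_supp_improve_sub_le (hQ : X.HasDegreeLE Q) (v : V) (f : F.Cochain n) :
    (F.supp (F.improve d v f - f)).card ≤ Q := by
  unfold improve
  rw [add_sub_cancel_left]
  exact F.card_supp_le_of_suppOver hQ (F.suppOver_correction v _)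

end Improve

end AugSheaf

end

/-! ### Testability, distance and correctness of decoding -/

noncomputable section

namespace AugSheaf

variable {𝔽 : Type*} [Field 𝔽] {V : Type*} [LinearOrder V] {X : SComplex V} {d n k m Q : ℕ}

section Reach

variable (F : AugSheaf 𝔽 X)

/-- The cochain `g` is obtained from `f` by local improvements. -/
def Improves (d : ℕ) (f g : F.Cochain n) : Prop :=
  Relation.ReflTransGen (fun f g => ∃ v ∈ X.verts, F.improve d v f = g) f g

variable {F}

theorem card_supp_sub_le (f g h : F.Cochain n) :
    (F.supp (f - h)).card ≤ (F.supp (f - g)).card + (F.supp (g - h)).card := by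
  rw [← sub_add_sub_cancel f g h]
  exact (Finset.card_le_card (F.supp_add _ _)).trans (Finset.card_union_le _ _)

/-- An effective improvement changes at most `Q` values and lowers the integer `suppCount` by at
least one, so the left-hand side does not increase along the process. -/
theorem Improves.card_supp_le (hQ : X.HasDegreeLE Q) {f g : F.Cochain n} (h : F.Improves d f g) :
    (F.supp (g - f)).card + Q * F.suppCount d (F.coboundary n g) ≤
      Q * F.suppCount d (F.coboundary n f) := by
  induction h with
  | refl =>
    rw [sub_self]
    have : F.supp (0 : F.Cochain n) = ∅ := by
      refine Finset.eq_empty_of_forall_notMem fun s hs => ?_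
      obtain ⟨x, hx, -⟩ := (mem_supp _).1 hs
      exact hx rfl
    simp [this]
  | @tail g g' _ h2 ih =>
    obtain ⟨v, _, rfl⟩ := h2
    rcases F.improve_eq_or_lt (d := d) v g with h | h
    · rwa [h]
    · have h3 := F.card_supp_improve_sub_le (d := d) hQ v g
      have h4 := card_supp_sub_le (F.improve d v g) g f
      have h5 : Q * (F.suppCount d (F.coboundary n (F.improve d v g)) + 1) ≤
        Q * F.suppCount d (F.coboundary n g) := Nat.mul_le_mul_left _ h
      rw [mul_add] at h5
      omega

theorem Improves.suppCount_le {f g : F.Cochain n} (h : F.Improves d f g) :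
    F.suppCount d (F.coboundary n g) ≤ F.suppCount d (F.coboundary n f) := by
  induction h with
  | refl => exact le_rfl
  | @tail g g' _ h2 ih =>
    obtain ⟨v, _, rfl⟩ := h2
    rcases F.improve_eq_or_lt (d := d) v g with h | h
    · rwa [h]
    · omega

theorem exists_improves (f : F.Cochain n) :
    ∃ g, F.Improves d f g ∧ ∀ v ∈ X.verts, F.improve d v g = g := by
  induction hN : F.suppCount d (F.coboundary n f) using Nat.strong_induction_on generalizing f with
  | _ N ih =>
    by_cases hf : ∀ v ∈ X.verts, F.improve d v f = f
    · exact ⟨f, Relation.ReflTransGen.refl, hf⟩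
    · push Not at hf
      obtain ⟨v, hv, hne⟩ := hf
      have hlt := (F.improve_eq_or_lt (d := d) v f).resolve_left hne
      obtain ⟨g, hg, hfix⟩ := ih _ (by rw [← hN]; exact hlt) (F.improve d v f) rfl
      exact ⟨g, Relation.ReflTransGen.head ⟨v, hv, rfl⟩ hg, hfix⟩

/-- Locally minimal cocycles of degree `k` and weight less than `θ` vanish. -/
def SmallCocyclesVanish (F : AugSheaf 𝔽 X) (d k : ℕ) (θ : ℝ) : Prop :=
  ∀ f : F.Cochain (k + 1), F.IsLocallyMinimal (X.weight d) k f →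
    F.suppNorm (X.weight d) f < θ → F.coboundary (k + 1) f = 0 → f = 0

/-- At a fixed point `dg` is a locally minimal cocycle, and it is no heavier than `df`; so it
vanishes when `df` is light. -/
theorem Improves.coboundary_eq_zero {θ : ℝ}
    (hθ : F.SmallCocyclesVanish d (n + 1) θ) {f g : F.Cochain (n + 1)} (h : F.Improves d f g)
    (hg : ∀ v ∈ X.verts, F.improve d v g = g)
    (hf : F.suppNorm (X.weight d) (F.coboundary (n + 1) f) < θ) : F.coboundary (n + 1) g = 0 := by
  refine hθ _ (F.isLocallyMinimal_of_improve_eq hg) (lt_of_le_of_lt ?_ hf)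
    (F.coboundary_coboundary g)
  rw [suppNorm_eq_suppCount, suppNorm_eq_suppCount]
  have := h.suppCount_le
  gcongr

end Reach

section Code

variable {F : AugSheaf 𝔽 X} (e : F.Framing k m)

theorem toCochain_sub_apply_ne_zero (f g : X.CardFace (k + 1) → (Fin m → 𝔽))
    (x : X.CardFace (k + 1)) : (toCochain e f - toCochain e g) x ≠ 0 ↔ f x ≠ g x := by
  rw [Pi.sub_apply, sub_ne_zero]
  exact (e x).symm.injective.ne_iff

theorem relHamming_eq (f g : X.CardFace (k + 1) → (Fin m → 𝔽)) :
    relHamming f g = ((F.supp (toCochain e f - toCochain e g)).card : ℝ) /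
      Fintype.card (X.CardFace (k + 1)) := by
  classical
  unfold relHamming
  congr 2
  unfold supp
  rw [Finset.card_image_of_injective _ fun x y h => Subtype.ext (Subtype.ext h)]
  unfold hammingDist
  congr 1
  ext x
  simp only [Finset.mem_filter, toCochain_sub_apply_ne_zero]

/-- The word corresponding to a cochain. -/
def ofCochain (f : F.Cochain (k + 1)) : X.CardFace (k + 1) → (Fin m → 𝔽) := fun x => e x (f x)

theorem toCochain_ofCochain (f : F.Cochain (k + 1)) : toCochain e (ofCochain e f) = f := by
  funext x
  exact (e x).symm_apply_apply _

theorem ofCochain_toCochain (f : X.CardFace (k + 1) → (Fin m → 𝔽)) :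
    ofCochain e (toCochain e f) = f := by
  funext x
  exact (e x).apply_symm_apply _

theorem mem_cocycleCode {f : X.CardFace (k + 1) → (Fin m → 𝔽)} :
    f ∈ cocycleCode e ↔ F.coboundary (k + 1) (toCochain e f) = 0 := LinearMap.mem_ker

theorem card_query_le (y : X.CardFace (k + 2)) :
    (Finset.univ.filter fun x : X.CardFace (k + 1) => x.1 ≤ y.1).card ≤ k + 2 := by
  have h1 : ((Finset.univ.filter fun x : X.CardFace (k + 1) => x.1 ≤ y.1).image
      fun x => x.1.1) ⊆ y.1.1.powersetCard (k + 1) := by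
    intro s hs
    obtain ⟨x, hx, rfl⟩ := Finset.mem_image.1 hs
    exact Finset.mem_powersetCard.2 ⟨(Finset.mem_filter.1 hx).2, x.2⟩
  have h2 := Finset.card_le_card h1
  rw [Finset.card_image_of_injective _ fun x y h => Subtype.ext (Subtype.ext h),
    Finset.card_powersetCard, y.2, Nat.choose_succ_self_right] at h2
  exact h2

theorem distToCode_le {ι A : Type*} [Fintype ι] {C : Set (ι → A)} {g : ι → A} (hg : g ∈ C)
    (f : ι → A) : distToCode f C ≤ relHamming f g := by
  refine ciInf_le ⟨0, ?_⟩ (⟨g, hg⟩ : C)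
  rintro _ ⟨g, rfl⟩
  unfold relHamming
  positivity

theorem relHamming_le_one {ι A : Type*} [Fintype ι] (f g : ι → A) : relHamming f g ≤ 1 := by
  classical
  unfold relHamming
  refine div_le_one_of_le₀ ?_ (Nat.cast_nonneg _)
  exact_mod_cast hammingDist_le_card_fintype

theorem rejectProb_cocycleTester (f : X.CardFace (k + 1) → (Fin m → 𝔽)) :
    (cocycleTester e).rejectProb f = ((F.supp (F.coboundary (k + 1) (toCochain e f))).card : ℝ) /
      Fintype.card (X.CardFace (k + 2)) := by
  classical
  unfold Tester.rejectProb
  unfold supp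
  rw [Finset.card_image_of_injective _ fun x y h => Subtype.ext (Subtype.ext h)]
  rfl

/-- If `df` is light, improvement leads to a codeword after changing at most `Q² |supp df|` letters,
and a further `Q` compares the numbers of `(k+1)`-faces and `k`-faces. If `df` is heavy, the
rejection probability is at least `θ / Q` outright, while the distance to the code is at most `1`.
-/
theorem isTestable_cocycleCode (hX : X.IsPure d) (hQ : X.HasDegreeLE Q) (hQ1 : 1 ≤ Q)
    (hk : k + 1 ≤ d) {θ : ℝ} (hθ0 : 0 < θ) (hθ : F.SmallCocyclesVanish d (k + 1) θ) :
    IsTestable (cocycleCode e) (cocycleTester e) (k + 2) (min (θ / Q) (1 / (Q : ℝ) ^ 3)) := by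
  refine ⟨card_query_le, ?_, ?_⟩
  · intro f hf y
    exact congrFun ((mem_cocycleCode e).1 hf) y
  intro f _
  have hQ0 : (0 : ℝ) < Q := by exact_mod_cast hQ1
  have hn1 : (0 : ℝ) < Fintype.card (X.CardFace (k + 1)) := by
    have := SComplex.cardFace_nonempty hX (show k + 1 ≤ d + 1 by omega)
    exact_mod_cast Fintype.card_pos
  have hn2 : (0 : ℝ) < Fintype.card (X.CardFace (k + 2)) := by
    have := SComplex.cardFace_nonempty hX (show k + 2 ≤ d + 1 by omega)
    exact_mod_cast Fintype.card_pos
  have hdist0 : 0 ≤ distToCode f (cocycleCode e) :=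
    Real.iInf_nonneg fun g => by unfold relHamming; positivity
  rw [rejectProb_cocycleTester]
  set t := F.coboundary (k + 1) (toCochain e f) with ht
  have hnorm := F.suppNorm_mul_card_le hX hQ (n := k + 2) (by omega) (by omega) t
  by_cases hsmall : F.suppNorm (X.weight d) t < θ
  · obtain ⟨g, hg, hfix⟩ := exists_improves (d := d) (toCochain e f)
    have hg0 := hg.coboundary_eq_zero hθ hfix hsmall
    have hmem : ofCochain e g ∈ cocycleCode e := by
      rw [mem_cocycleCode, toCochain_ofCochain]
      exact hg0
    have h1 := distToCode_le hmem f
    rw [relHamming_eq e, toCochain_ofCochain] at h1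
    have h2 := hg.card_supp_le hQ
    have h3 := F.suppCount_le (d := d) hQ (n := k + 2) (by omega) t
    have hneg : F.supp (toCochain e f - g) = F.supp (g - toCochain e f) := by
      ext s
      rw [mem_supp, mem_supp]
      refine exists_congr fun x => and_congr_left fun _ => ?_
      rw [Pi.sub_apply, Pi.sub_apply, sub_ne_zero, sub_ne_zero, ne_comm]
    rw [hneg] at h1
    have h4 : (F.supp (g - toCochain e f)).card ≤ Q * (Q * (F.supp t).card) :=
      ((Nat.le_add_right _ _).trans h2).trans (Nat.mul_le_mul_left _ h3)
    have h4' : ((F.supp (g - toCochain e f)).card : ℝ) ≤ Q * (Q * (F.supp t).card) := by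
      exact_mod_cast h4
    have h5 : (Fintype.card (X.CardFace (k + 2)) : ℝ) ≤
        Q * Fintype.card (X.CardFace (k + 1)) := by
      exact_mod_cast SComplex.card_cardFace_succ_le hQ (n := k + 1) (by omega)
    calc min (θ / Q) (1 / (Q : ℝ) ^ 3) * distToCode f (cocycleCode e)
        ≤ 1 / (Q : ℝ) ^ 3 * (Q * (Q * (F.supp t).card) / Fintype.card (X.CardFace (k + 1))) := by
          refine mul_le_mul (min_le_right _ _) (h1.trans ?_) hdist0 (by positivity)
          gcongr
      _ = (F.supp t).card / (Q * Fintype.card (X.CardFace (k + 1))) := by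
          field_simp
      _ ≤ _ := by gcongr
  · push Not at hsmall
    have h0 : (0 : X.CardFace (k + 1) → (Fin m → 𝔽)) ∈ cocycleCode e := by
      rw [mem_cocycleCode]
      have : toCochain e (0 : X.CardFace (k + 1) → (Fin m → 𝔽)) = 0 := by
        funext x
        exact map_zero (e x).symm
      rw [this, map_zero]
    have h1 := (distToCode_le h0 f).trans (relHamming_le_one f 0)
    calc min (θ / Q) (1 / (Q : ℝ) ^ 3) * distToCode f (cocycleCode e)
        ≤ θ / Q * 1 := mul_le_mul (min_le_left _ _) h1 hdist0 (by positivity)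
      _ ≤ _ := by
          rw [mul_one, div_le_div_iff₀ hQ0 hn2, mul_comm (_ : ℝ) (Q : ℝ)]
          exact le_trans (by gcongr) hnorm

theorem hasRelDistance_cocycleCode (hX : X.IsPure d) (hQ : X.HasDegreeLE Q) (hQ1 : 1 ≤ Q)
    (hk : k ≤ d) {θ : ℝ} (hθ : ∀ f : F.Cochain (k + 1), F.suppNorm (X.weight d) f < θ →
      F.coboundary (k + 1) f = 0 → f = 0) : HasRelDistance (cocycleCode e) (θ / Q) := by
  intro f hf g hg hne
  have hQ0 : (0 : ℝ) < Q := by exact_mod_cast hQ1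
  have hn1 : (0 : ℝ) < Fintype.card (X.CardFace (k + 1)) := by
    have := SComplex.cardFace_nonempty hX (show k + 1 ≤ d + 1 by omega)
    exact_mod_cast Fintype.card_pos
  rw [mem_cocycleCode] at hf hg
  have hnorm := F.suppNorm_mul_card_le hX hQ (n := k + 1) (by omega) (by omega)
    (toCochain e f - toCochain e g)
  rw [relHamming_eq e, div_le_div_iff₀ hQ0 hn1, mul_comm (_ : ℝ) (Q : ℝ)]
  refine le_trans ?_ hnorm
  gcongr
  by_contra! hlt
  have h0 := hθ _ hlt (by rw [map_sub, hf, hg, sub_zero])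
  apply hne
  rw [← ofCochain_toCochain e f, ← ofCochain_toCochain e g, sub_eq_zero.1 h0]

/-- With `D` errors, `df = d(f - g)` is supported on at most `Q D` faces, so it is light and `f'` is
a codeword. Improvement moves `f` by at most `Q³ D` letters, so `f'` and `g` differ in at most `(1 +
Q³) D` places, fewer than two distinct codewords can. -/
theorem eq_of_improves (hX : X.IsPure d) (hQ : X.HasDegreeLE Q) (hQ1 : 1 ≤ Q)
    (hk : k + 1 ≤ d) {θ δ η : ℝ} (hθ : F.SmallCocyclesVanish d (k + 1) θ)
    (hδ : HasRelDistance (cocycleCode e) δ) (hη1 : η * ((Q : ℝ) ^ 2 * (k + 2)) ≤ θ)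
    (hη2 : η * (1 + (Q : ℝ) ^ 3) ≤ δ) {f g f' : X.CardFace (k + 1) → (Fin m → 𝔽)}
    (hg : g ∈ cocycleCode e) (hfg : relHamming f g < η)
    (h : F.Improves d (toCochain e f) (toCochain e f'))
    (hfix : ∀ v ∈ X.verts, F.improve d v (toCochain e f') = toCochain e f') : f' = g := by
  have hQ0 : (0 : ℝ) < Q := by exact_mod_cast hQ1
  have hn1 : (0 : ℝ) < Fintype.card (X.CardFace (k + 1)) := by
    have := SComplex.cardFace_nonempty hX (show k + 1 ≤ d + 1 by omega)
    exact_mod_cast Fintype.card_pos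
  have hn2 : (0 : ℝ) < Fintype.card (X.CardFace (k + 2)) := by
    have := SComplex.cardFace_nonempty hX (show k + 2 ≤ d + 1 by omega)
    exact_mod_cast Fintype.card_pos
  set t := F.coboundary (k + 1) (toCochain e f) with ht
  have hgz := (mem_cocycleCode e).1 hg
  rw [relHamming_eq e, div_lt_iff₀ hn1] at hfg
  set D := (F.supp (toCochain e f - toCochain e g)).card with hD
  have h1 : (F.supp t).card ≤ Q * D := by
    have h1 := F.card_supp_coboundary_le hQ (by omega) (toCochain e f - toCochain e g)
    rwa [map_sub, hgz, sub_zero] at h1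
  have h1' : ((F.supp t).card : ℝ) ≤ Q * D := by exact_mod_cast h1
  have hnorm := F.suppNorm_mul_card_le hX hQ (n := k + 2) (by omega) (by omega) t
  have h2 : (Fintype.card (X.CardFace (k + 1)) : ℝ) ≤
      (k + 2) * Fintype.card (X.CardFace (k + 2)) := by
    have := SComplex.card_cardFace_le_succ hX (n := k + 1) (by omega)
    have h' : (Fintype.card (X.CardFace (k + 1)) : ℝ) ≤
      ((k + 1 + 1 : ℕ) : ℝ) * Fintype.card (X.CardFace (k + 1 + 1)) := by exact_mod_cast this
    push_cast at h'
    linarith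
  have hη0 : 0 ≤ η := by
    by_contra! hneg
    have : η * Fintype.card (X.CardFace (k + 1)) < 0 := mul_neg_of_neg_of_pos hneg hn1
    have : (0 : ℝ) ≤ D := Nat.cast_nonneg _
    linarith
  have hsmall : F.suppNorm (X.weight d) t < θ := by
    refine lt_of_mul_lt_mul_right ?_ hn2.le
    calc F.suppNorm (X.weight d) t * Fintype.card (X.CardFace (k + 2))
        ≤ Q * (F.supp t).card := hnorm
      _ ≤ Q * (Q * D) := by gcongr
      _ < Q * (Q * (η * Fintype.card (X.CardFace (k + 1)))) := by gcongr
      _ ≤ Q * (Q * (η * ((k + 2) * Fintype.card (X.CardFace (k + 2))))) := by gcongr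
      _ = η * ((Q : ℝ) ^ 2 * (k + 2)) * Fintype.card (X.CardFace (k + 2)) := by ring
      _ ≤ _ := by gcongr
  have hf' : f' ∈ cocycleCode e := by
    rw [mem_cocycleCode]
    exact h.coboundary_eq_zero hθ hfix hsmall
  by_contra hne
  have h3 := hδ f' hf' g hg hne
  rw [relHamming_eq e, le_div_iff₀ hn1] at h3
  have h4 := card_supp_sub_le (toCochain e f') (toCochain e f) (toCochain e g)
  have h5 := h.card_supp_le hQ
  have h6 := F.suppCount_le (d := d) hQ (n := k + 2) (by omega) t
  have h7 : (F.supp (toCochain e f' - toCochain e g)).card ≤ Q * (Q * (Q * D)) + D := by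
    refine h4.trans (Nat.add_le_add_right (((Nat.le_add_right _ _).trans h5).trans ?_) _)
    exact Nat.mul_le_mul_left _ (h6.trans (Nat.mul_le_mul_left _ h1))
  have h7' : ((F.supp (toCochain e f' - toCochain e g)).card : ℝ) ≤ Q * (Q * (Q * D)) + D := by
    exact_mod_cast h7
  have h8 : (1 + (Q : ℝ) ^ 3) * D < (1 + (Q : ℝ) ^ 3) * (η * Fintype.card (X.CardFace (k + 1))) := by
    gcongr
  have h9 : η * (1 + (Q : ℝ) ^ 3) * Fintype.card (X.CardFace (k + 1)) ≤
      δ * Fintype.card (X.CardFace (k + 1)) := by gcongr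
  have h10 : (Q : ℝ) * (Q * (Q * D)) + D = (1 + (Q : ℝ) ^ 3) * D := by ring
  rw [h10] at h7'
  nlinarith

end Code

end AugSheaf

end

noncomputable section

/-! ## Task systems and their execution on a random access machine -/

/-- A system of elementary tasks on words: every task reads the letter at its position, replaces
it, and schedules at most two tasks. -/
structure TaskSystem (ι A τ : Type*) where
  pos : τ → ι
  out : τ → A → A
  next : τ → A → List τ
  length_next_le : ∀ t a, (next t a).length ≤ 2

open scoped Classical in
/-- Executing the scheduled tasks on the word `f` ends after `k` tasks with the word `f'`. -/
inductive TaskSystem.Runs {ι A τ : Type*} (S : TaskSystem ι A τ) :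
    ℕ → (ι → A) → List τ → (ι → A) → Prop
  | nil (f : ι → A) : S.Runs 0 f [] f
  | cons {k : ℕ} {f f' : ι → A} {t : τ} {l : List τ} :
      S.Runs k (Function.update f (S.pos t) (S.out t (f (S.pos t))))
        (S.next t (f (S.pos t)) ++ l) f' → S.Runs (k + 1) f (t :: l) f'

namespace RamRuns

variable {N : ℕ} {P : RamProg} {s s' : ℕ → ℕ} {t : ℕ}

theorem load_seq {a b v : ℕ} (hv : s (s b) = v) (h : RamRuns N P (Function.update s a v) t s') :
    RamRuns N (.seq (.load a b) P) s (t + 1) s' := by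
  rw [add_comm]
  subst hv
  exact .seq (.load a b s) h

theorem store_seq {a b v w : ℕ} (hv : s b = v) (hw : s a = w)
    (h : RamRuns N P (Function.update s w v) t s') :
    RamRuns N (.seq (.store a b) P) s (t + 1) s' := by
  rw [add_comm]
  subst hv hw
  exact .seq (.store a b s) h

theorem add_seq {a b c v : ℕ} (hv : s b + s c = v) (hN : v < N)
    (h : RamRuns N P (Function.update s a v) t s') :
    RamRuns N (.seq (.add a b c) P) s (t + 1) s' := by
  rw [add_comm]
  subst hv
  have := RamRuns.add (N := N) a b c s
  rw [Nat.mod_eq_of_lt hN] at this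
  exact .seq this h

theorem sub_of_eq {a b c v : ℕ} (hv : s b - s c = v) (h : s' = Function.update s a v) :
    RamRuns N (.sub a b c) s 1 s' := by
  subst hv h
  exact .sub a b c s

end RamRuns

/-- The memory with given registers, at the addresses below `16`. -/
def joinMemory (r M : ℕ → ℕ) (a : ℕ) : ℕ := if a < 16 then r a else M a

section JoinMemory

variable {r M : ℕ → ℕ} {a v : ℕ}

theorem joinMemory_self (s : ℕ → ℕ) : joinMemory s s = s := by
  funext a; simp [joinMemory]

theorem joinMemory_low (h : a < 16) : joinMemory r M a = r a := if_pos h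

theorem joinMemory_high (h : 16 ≤ a) : joinMemory r M a = M a := if_neg (by omega)

theorem update_joinMemory_low (h : a < 16) :
    Function.update (joinMemory r M) a v = joinMemory (Function.update r a v) M := by
  funext x
  simp only [joinMemory, Function.update_apply]
  split_ifs <;> first | rfl | omega

theorem update_joinMemory_high (h : 16 ≤ a) :
    Function.update (joinMemory r M) a v = joinMemory r (Function.update M a v) := by
  funext x
  simp only [joinMemory, Function.update_apply]
  split_ifs <;> first | rfl | omega

end JoinMemory

/-- Execute the task whose table begins at `M[0]`, with the stack pointer in `M[1]`, and pop the
next one; `M[5]` is the size of the alphabet and `M[6] = 1`. -/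
def taskBody : RamProg :=
  .seq (.load 2 0) <| .seq (.load 3 2) <| .seq (.add 4 0 3) <| .seq (.add 4 4 6) <|
  .seq (.load 7 4) <| .seq (.store 2 7) <| .seq (.add 4 4 5) <| .seq (.load 8 4) <|
  .seq (.add 4 4 5) <| .seq (.load 7 4) <| .seq (.add 9 1 6) <| .seq (.store 9 7) <|
  .seq (.add 4 4 5) <| .seq (.load 7 4) <| .seq (.add 9 9 6) <| .seq (.store 9 7) <|
  .seq (.add 1 1 8) <| .seq (.load 0 1) <| .sub 1 1 6

/-- Here `M₁`, `M₂`, `M₃` are the memory above the registers after the letter is written and after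
each of the two pushes. Both successor words are always written above the stack; only advancing the
stack pointer by `c` decides how many of them count, which avoids branching. -/
theorem taskBody_runs {N : ℕ} {s M₁ M₂ M₃ : ℕ → ℕ} {p sp w a q o c c₁ c₂ : ℕ} (h0 : s 0 = p)
    (h1 : s 1 = sp) (h5 : s 5 = q) (h6 : s 6 = 1) (hp : 16 ≤ p) (hsp : 16 ≤ sp) (hw : 16 ≤ w)
    (hpw : s p = w) (hwa : s w = a) (ho : s (p + a + 1) = o)
    (hM₁ : M₁ = Function.update s w o) (hc : M₁ (p + a + 1 + q) = c)
    (hc₁ : M₁ (p + a + 1 + q + q) = c₁) (hM₂ : M₂ = Function.update M₁ (sp + 1) c₁)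
    (hc₂ : M₂ (p + a + 1 + q + q + q) = c₂) (hM₃ : M₃ = Function.update M₂ (sp + 1 + 1) c₂)
    (hN1 : p + a + 1 + q + q + q < N) (hN2 : sp + 1 + 1 < N) (hN3 : sp + c < N) :
    ∃ r, RamRuns N taskBody s 19 (joinMemory r M₃) ∧ r 0 = M₃ (sp + c) ∧ r 1 = sp + c - 1 ∧
      r 5 = q ∧ r 6 = 1 := by
  have key : ∀ (r₀ : ℕ → ℕ), r₀ 0 = p → r₀ 1 = sp → r₀ 5 = q → r₀ 6 = 1 →
      ∃ r, RamRuns N taskBody (joinMemory r₀ s) 19 (joinMemory r M₃) ∧ r 0 = M₃ (sp + c) ∧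
        r 1 = sp + c - 1 ∧ r 5 = q ∧ r 6 = 1 := by
    intro r₀ h0 h1 h5 h6
    refine ⟨?_, ?_, ?_⟩
    rotate_left
    · unfold taskBody
      refine RamRuns.load_seq (v := w) (by
        rw [joinMemory_low (a := 0) (by norm_num), h0, joinMemory_high hp, hpw]) ?_
      rw [update_joinMemory_low (by norm_num)]
      refine RamRuns.load_seq (v := a) (by
        rw [joinMemory_low (a := 2) (by norm_num)]
        simp only [Function.update_self]
        rw [joinMemory_high hw, hwa]) ?_
      rw [update_joinMemory_low (by norm_num)]
      refine RamRuns.add_seq (v := p + a) (by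
        rw [joinMemory_low (a := 0) (by norm_num), joinMemory_low (a := 3) (by norm_num)]
        simp [h0]) (by omega) ?_
      rw [update_joinMemory_low (by norm_num)]
      refine RamRuns.add_seq (v := p + a + 1) (by
        rw [joinMemory_low (a := 4) (by norm_num), joinMemory_low (a := 6) (by norm_num)]
        simp [h6]) (by omega) ?_
      rw [update_joinMemory_low (by norm_num)]
      refine RamRuns.load_seq (v := o) (by
        rw [joinMemory_low (a := 4) (by norm_num)]
        simp only [Function.update_self]
        rw [joinMemory_high (by omega), ho]) ?_
      rw [update_joinMemory_low (by norm_num)]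
      refine RamRuns.store_seq (v := o) (w := w) (by
        rw [joinMemory_low (a := 7) (by norm_num)]
        simp) (by
        rw [joinMemory_low (a := 2) (by norm_num)]
        simp) ?_
      rw [update_joinMemory_high hw, ← hM₁]
      refine RamRuns.add_seq (v := p + a + 1 + q) (by
        rw [joinMemory_low (a := 4) (by norm_num), joinMemory_low (a := 5) (by norm_num)]
        simp [h5]) (by omega) ?_
      rw [update_joinMemory_low (by norm_num)]
      refine RamRuns.load_seq (v := c) (by
        rw [joinMemory_low (a := 4) (by norm_num)]
        simp only [Function.update_self]
        rw [joinMemory_high (by omega), hc]) ?_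
      rw [update_joinMemory_low (by norm_num)]
      refine RamRuns.add_seq (v := p + a + 1 + q + q) (by
        rw [joinMemory_low (a := 4) (by norm_num), joinMemory_low (a := 5) (by norm_num)]
        simp [h5]) (by omega) ?_
      rw [update_joinMemory_low (by norm_num)]
      refine RamRuns.load_seq (v := c₁) (by
        rw [joinMemory_low (a := 4) (by norm_num)]
        simp only [Function.update_self]
        rw [joinMemory_high (by omega), hc₁]) ?_
      rw [update_joinMemory_low (by norm_num)]
      refine RamRuns.add_seq (v := sp + 1) (by
        rw [joinMemory_low (a := 1) (by norm_num), joinMemory_low (a := 6) (by norm_num)]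
        simp [h1, h6]) (by omega) ?_
      rw [update_joinMemory_low (by norm_num)]
      refine RamRuns.store_seq (v := c₁) (w := sp + 1) (by
        rw [joinMemory_low (a := 7) (by norm_num)]
        simp) (by
        rw [joinMemory_low (a := 9) (by norm_num)]
        simp) ?_
      rw [update_joinMemory_high (by omega), ← hM₂]
      refine RamRuns.add_seq (v := p + a + 1 + q + q + q) (by
        rw [joinMemory_low (a := 4) (by norm_num), joinMemory_low (a := 5) (by norm_num)]
        simp [h5]) (by omega) ?_
      rw [update_joinMemory_low (by norm_num)]
      refine RamRuns.load_seq (v := c₂) (by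
        rw [joinMemory_low (a := 4) (by norm_num)]
        simp only [Function.update_self]
        rw [joinMemory_high (by omega), hc₂]) ?_
      rw [update_joinMemory_low (by norm_num)]
      refine RamRuns.add_seq (v := sp + 1 + 1) (by
        rw [joinMemory_low (a := 9) (by norm_num), joinMemory_low (a := 6) (by norm_num)]
        simp [h6]) (by omega) ?_
      rw [update_joinMemory_low (by norm_num)]
      refine RamRuns.store_seq (v := c₂) (w := sp + 1 + 1) (by
        rw [joinMemory_low (a := 7) (by norm_num)]
        simp) (by
        rw [joinMemory_low (a := 9) (by norm_num)]
        simp) ?_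
      rw [update_joinMemory_high (by omega), ← hM₃]
      refine RamRuns.add_seq (v := sp + c) (by
        rw [joinMemory_low (a := 1) (by norm_num), joinMemory_low (a := 8) (by norm_num)]
        simp [h1]) (by omega) ?_
      rw [update_joinMemory_low (by norm_num)]
      refine RamRuns.load_seq (v := M₃ (sp + c)) (by
        rw [joinMemory_low (a := 1) (by norm_num)]
        simp only [Function.update_self]
        rw [joinMemory_high (by omega)]) ?_
      rw [update_joinMemory_low (by norm_num)]
      refine RamRuns.sub_of_eq (v := sp + c - 1) (by
        rw [joinMemory_low (a := 1) (by norm_num), joinMemory_low (a := 6) (by norm_num)]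
        simp [h6]) ?_
      rw [update_joinMemory_low (by norm_num)]
    · refine ⟨?_, ?_, ?_, ?_⟩
      · simp
      · simp
      · simp [h5]
      · simp [h6]
  obtain ⟨r, hr⟩ := key s h0 h1 h5 h6
  rw [joinMemory_self] at hr
  exact ⟨r, hr⟩

/-- The stack with bottom `b` and top `sp` holds the given words, the first one at the top. -/
def StackAt (b : ℕ) (M : ℕ → ℕ) : ℕ → List ℕ → Prop
  | sp, [] => sp + 1 = b
  | sp, x :: l => b ≤ sp ∧ M sp = x ∧ StackAt b M (sp - 1) l

section StackAt

variable {b : ℕ} {M M' : ℕ → ℕ}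

theorem StackAt.add_one {sp : ℕ} {l : List ℕ} (hb : 1 ≤ b) (h : StackAt b M sp l) :
    sp + 1 = b + l.length := by
  induction l generalizing sp with
  | nil => exact h
  | cons x l ih =>
    have := ih h.2.2
    have := h.1
    simp only [List.length_cons]
    omega

theorem StackAt.congr {sp : ℕ} {l : List ℕ} (h : StackAt b M sp l)
    (hM : ∀ a, b ≤ a → a ≤ sp → M' a = M a) : StackAt b M' sp l := by
  induction l generalizing sp with
  | nil => exact h
  | cons x l ih =>
    exact ⟨h.1, (hM _ h.1 le_rfl).trans h.2.1, ih h.2.2 fun a h1 h2 => hM a h1 (by omega)⟩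

theorem stackAt_of_reverse (hb : 1 ≤ b) (l : List ℕ)
    (h : ∀ j < l.length, M (b + j) = l.reverse.getD j 0) : StackAt b M (b + l.length - 1) l := by
  induction l with
  | nil => simp [StackAt]; omega
  | cons x l ih =>
    refine ⟨by simp only [List.length_cons]; omega, ?_, ?_⟩
    · have := h l.length (by simp)
      simp only [List.length_cons]
      rw [show b + (l.length + 1) - 1 = b + l.length by omega, this]
      simp
    · have : b + (x :: l).length - 1 - 1 = b + l.length - 1 := by
        simp only [List.length_cons]; omega
      rw [this]
      refine ih fun j hj => ?_
      rw [h j (by simp only [List.length_cons]; omega), List.reverse_cons,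
        List.getD_append _ _ _ _ (by simpa using hj)]

end StackAt

end

/-! ### Memory layout of a task system and linear running time -/

noncomputable section

namespace TaskSystem

section Layout

variable {ι A τ : Type*} {n q M : ℕ} (S : TaskSystem ι A τ) (pos : ι ≃ Fin n) (enc : A ≃ Fin q)
  (tenc : τ ≃ Fin M)

/-- The first address of the table of a task. -/
def taskAddr (n q : ℕ) (tenc : τ ≃ Fin M) (t : τ) : ℕ := 16 + n + tenc t * (1 + 4 * q)

/-- The bottom of the stack. -/
def stackBase (n q M : ℕ) : ℕ := 16 + n + M * (1 + 4 * q)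

/-- The offset of a field in the table of a task. -/
def fieldOffset (enc : A ≃ Fin q) : Option (Fin 4 × A) → ℕ
  | none => 0
  | some (i, a) => enc a + 1 + i * q

/-- The address of a field of the table of a task. -/
def fieldAddr (t : τ) (j : Option (Fin 4 × A)) : ℕ := taskAddr n q tenc t + fieldOffset enc j

/-- The contents of a field of the table of a task. -/
def fieldVal (t : τ) : Option (Fin 4 × A) → ℕ
  | none => 16 + pos (S.pos t)
  | some (0, a) => enc (S.out t a)
  | some (1, a) => (S.next t a).length
  | some (2, a) => ((S.next t a).map (taskAddr n q tenc)).getLastD 0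
  | some (3, a) => ((S.next t a).map (taskAddr n q tenc)).headD 0

/-- The words representing a list of scheduled tasks. -/
def stackWords (n q : ℕ) (tenc : τ ≃ Fin M) (l : List τ) : List ℕ :=
  l.map (taskAddr n q tenc) ++ [0]

theorem fieldOffset_lt (j : Option (Fin 4 × A)) : fieldOffset enc j < 1 + 4 * q := by
  rcases j with _ | ⟨i, a⟩
  · simp only [fieldOffset]; omega
  · have h1 := (enc a).2
    have h2 : (i : ℕ) * q ≤ 3 * q := Nat.mul_le_mul_right _ (by omega)
    simp only [fieldOffset]; omega

theorem eq_of_mul_add_eq {K a b r s : ℕ} (hr : r < K) (hs : s < K)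
    (h : a * K + r = b * K + s) : a = b ∧ r = s := by
  have h1 : (a * K + r) / K = (b * K + s) / K := by rw [h]
  rw [mul_comm a, mul_comm b, Nat.mul_add_div (by omega), Nat.mul_add_div (by omega),
    Nat.div_eq_of_lt hr, Nat.div_eq_of_lt hs] at h1
  have h2 : a = b := by omega
  subst h2
  exact ⟨rfl, by omega⟩

theorem fieldOffset_injective : Function.Injective (fieldOffset enc) := by
  rintro (_ | ⟨i, a⟩) (_ | ⟨i', a'⟩) h
  · rfl
  · simp only [fieldOffset] at h; omega
  · simp only [fieldOffset] at h; omega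
  · simp only [fieldOffset] at h
    obtain ⟨h1, h2⟩ := eq_of_mul_add_eq (a := (i : ℕ)) (b := i') (enc a).2 (enc a').2 (by omega)
    rw [Fin.ext h1, enc.injective (Fin.ext h2)]

/-- Table blocks have length `1 + 4 q`, and within a block the offsets are digits in base `q`.
Injectivity makes the description of `ramTable` by extension along `fieldAddr` consistent. -/
theorem fieldAddr_injective :
    Function.Injective fun x : τ × Option (Fin 4 × A) => fieldAddr (n := n) enc tenc x.1 x.2 := by
  rintro ⟨t, j⟩ ⟨t', j'⟩ h
  simp only [fieldAddr, taskAddr] at h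
  obtain ⟨h1, h2⟩ := eq_of_mul_add_eq (fieldOffset_lt enc j) (fieldOffset_lt enc j')
    (show (tenc t : ℕ) * (1 + 4 * q) + _ = (tenc t' : ℕ) * (1 + 4 * q) + _ by omega)
  rw [tenc.injective (Fin.ext h1), fieldOffset_injective enc h2]

theorem le_fieldAddr (t : τ) (j : Option (Fin 4 × A)) :
    16 + n ≤ fieldAddr (n := n) enc tenc t j := by
  simp only [fieldAddr, taskAddr]; omega

theorem fieldAddr_lt (t : τ) (j : Option (Fin 4 × A)) :
    fieldAddr (n := n) enc tenc t j < stackBase n q M := by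
  have h1 := fieldOffset_lt enc j
  have h2 : ((tenc t : ℕ) + 1) * (1 + 4 * q) ≤ M * (1 + 4 * q) :=
    Nat.mul_le_mul_right _ (tenc t).2
  rw [add_mul, one_mul] at h2
  simp only [fieldAddr, taskAddr, stackBase]
  omega

theorem taskAddr_lt (t : τ) : taskAddr n q tenc t < stackBase n q M := by
  have h2 : ((tenc t : ℕ) + 1) * (1 + 4 * q) ≤ M * (1 + 4 * q) :=
    Nat.mul_le_mul_right _ (tenc t).2
  rw [add_mul, one_mul] at h2
  simp only [taskAddr, stackBase]
  omega

theorem stackWords_lt (l : List τ) {x : ℕ} (hx : x ∈ stackWords n q tenc l) :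
    x < stackBase n q M := by
  simp only [stackWords, List.mem_append, List.mem_map, List.mem_singleton] at hx
  rcases hx with ⟨t, _, rfl⟩ | rfl
  · exact taskAddr_lt tenc t
  · simp [stackBase]

/-- The memory `s` represents the word `f` with the list `l` of scheduled tasks. -/
structure Represents (s : ℕ → ℕ) (f : ι → A) (l : List τ) : Prop where
  reg5 : s 5 = q
  reg6 : s 6 = 1
  word : ∀ i, s (16 + pos i) = enc (f i)
  table : ∀ t j, s (fieldAddr (n := n) enc tenc t j) = S.fieldVal pos enc tenc t j
  stack : ∃ x l', stackWords n q tenc l = x :: l' ∧ s 0 = x ∧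
    StackAt (stackBase n q M) s (s 1) l'

variable {S pos enc tenc}

open scoped Classical in
-- Letters lie below the tables and the tables below the stack, so the letter write and the two
-- pushes disturb nothing else. The last successor is pushed before the first, so that the first is
-- on top.
theorem Represents.step {N : ℕ} {s : ℕ → ℕ} {f : ι → A} {t : τ} {l : List τ}
    (h : S.Represents pos enc tenc s f (t :: l)) (hN : stackBase n q M + l.length + 3 < N) :
    ∃ s', RamRuns N taskBody s 19 s' ∧
      S.Represents pos enc tenc s' (Function.update f (S.pos t) (S.out t (f (S.pos t))))
        (S.next t (f (S.pos t)) ++ l) := by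
  obtain ⟨x, l', hl, h0, hst⟩ := h.stack
  have hx : taskAddr n q tenc t = x := by
    simp only [stackWords, List.map_cons, List.cons_append, List.cons.injEq] at hl
    exact hl.1
  have hl' : stackWords n q tenc l = l' := by
    simp only [stackWords, List.map_cons, List.cons_append, List.cons.injEq] at hl
    exact hl.2
  subst hl' hx
  have hb16 : 16 + n ≤ stackBase n q M := by unfold stackBase; omega
  have hlen : (stackWords n q tenc l).length = l.length + 1 := by simp [stackWords]
  have hsp := hst.add_one (by omega)
  rw [hlen] at hsp
  have hw := h.word (S.pos t)
  set a := f (S.pos t) with ha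
  set w := 16 + (pos (S.pos t) : ℕ) with hwdef
  have hwn : w < 16 + n := by
    have := (pos (S.pos t)).2
    omega
  set p := taskAddr n q tenc t with hp
  have hfield : ∀ i : Fin 4, p + enc a + 1 + i * q = fieldAddr (n := n) enc tenc t (some (i, a)) := by
    intro i
    simp only [fieldAddr, fieldOffset, ← hp]
    omega
  have e0 := hfield 0
  have e1 := hfield 1
  have e2 := hfield 2
  have e3 := hfield 3
  simp only [Fin.val_zero, zero_mul, add_zero] at e0
  have e1' : p + enc a + 1 + q = fieldAddr (n := n) enc tenc t (some (1, a)) := by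
    rw [← e1]; simp
  have e2' : p + enc a + 1 + q + q = fieldAddr (n := n) enc tenc t (some (2, a)) := by
    rw [← e2]; simp only [Fin.val_two]; ring
  have e3' : p + enc a + 1 + q + q + q = fieldAddr (n := n) enc tenc t (some (3, a)) := by
    rw [← e3]
    have : ((3 : Fin 4) : ℕ) = 3 := rfl
    rw [this]; ring
  set c₁ := S.fieldVal pos enc tenc t (some (2, a)) with hc₁
  set c₂ := S.fieldVal pos enc tenc t (some (3, a)) with hc₂
  set o : ℕ := ((enc (S.out t a) : Fin q) : ℕ) with ho
  set M₁ := Function.update s w o with hM₁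
  set M₂ := Function.update M₁ (s 1 + 1) c₁ with hM₂
  set M₃ := Function.update M₂ (s 1 + 1 + 1) c₂ with hM₃
  have hlen2 := S.length_next_le t a
  have hT1 : ∀ x, 16 + n ≤ x → M₁ x = s x := fun x hx =>
    Function.update_of_ne (by omega) _ _
  have hT2 : ∀ x, x < stackBase n q M → M₂ x = M₁ x := fun x hx =>
    Function.update_of_ne (by omega) _ _
  have hT3 : ∀ x, x < stackBase n q M → M₃ x = M₂ x := fun x hx =>
    Function.update_of_ne (by omega) _ _
  have htab : ∀ t j, M₃ (fieldAddr (n := n) enc tenc t j) = S.fieldVal pos enc tenc t j := by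
    intro t j
    have h1 := fieldAddr_lt (n := n) enc tenc t j
    rw [hT3 _ h1, hT2 _ h1, hT1 _ (le_fieldAddr enc tenc t j), h.table]
  have hlt3 := fieldAddr_lt (n := n) enc tenc t (some (3, a))
  obtain ⟨r, hr, r0, r1, r5, r6⟩ := taskBody_runs (N := N) (s := s) (M₁ := M₁) (M₂ := M₂)
    (M₃ := M₃) (p := p) (sp := s 1) (w := w) (a := enc a) (q := q) (o := o)
    (c := (S.next t a).length) (c₁ := c₁) (c₂ := c₂) h0 rfl h.reg5 h.reg6
    (by rw [hp]; unfold taskAddr; omega) (by omega) (by omega)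
    (by
      have := h.table t none
      simpa only [fieldAddr, fieldOffset, add_zero, fieldVal] using this)
    hw (by rw [e0, h.table]; rfl) hM₁
    (by rw [e1', hT1 _ (le_fieldAddr enc tenc t _), h.table]; rfl)
    (by rw [e2', hT1 _ (le_fieldAddr enc tenc t _), h.table])
    hM₂
    (by rw [e3', hT2 _ hlt3, hT1 _ (le_fieldAddr enc tenc t _), h.table])
    hM₃ (by rw [e3']; omega) (by omega) (by omega)
  refine ⟨_, hr, ?_, ?_, ?_, ?_, ?_⟩
  · rw [joinMemory_low (by norm_num), r5]
  · rw [joinMemory_low (by norm_num), r6]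
  · intro i
    have hi := (pos i).2
    rw [joinMemory_high (by omega), hT3 _ (by omega), hT2 _ (by omega), hM₁]
    by_cases hi' : i = S.pos t
    · subst hi'
      rw [Function.update_self, Function.update_self]
    · rw [Function.update_of_ne hi', Function.update_of_ne, h.word i]
      intro he
      apply hi'
      apply pos.injective
      apply Fin.ext
      omega
  · intro t' j
    rw [joinMemory_high (by have := le_fieldAddr (n := n) enc tenc t' j; omega), htab]
  · have hold : StackAt (stackBase n q M) M₃ (s 1) (stackWords n q tenc l) := by
      refine hst.congr fun x h1 h2 => ?_
      rw [hM₃, Function.update_of_ne (by omega), hM₂, Function.update_of_ne (by omega),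
        hT1 _ (by omega)]
    have hnew : StackAt (stackBase n q M) M₃ (s 1 + (S.next t a).length)
        (stackWords n q tenc (S.next t a ++ l)) := by
      have hv1 : M₃ (s 1 + 1) = c₁ := by
        rw [hM₃, Function.update_of_ne (by omega), hM₂, Function.update_self]
      have hv2 : M₃ (s 1 + 1 + 1) = c₂ := by rw [hM₃, Function.update_self]
      have hc₁' : c₁ = ((S.next t a).map (taskAddr n q tenc)).getLastD 0 := rfl
      have hc₂' : c₂ = ((S.next t a).map (taskAddr n q tenc)).headD 0 := rfl
      clear_value c₁ c₂
      match hnx : S.next t a with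
      | [] => simpa using hold
      | [t₁] =>
        rw [hnx] at hc₁'
        refine ⟨by simp only [List.length_singleton]; omega, ?_, by simpa [stackWords] using hold⟩
        rw [List.length_singleton, hv1, hc₁']
        simp
      | [t₁, t₂] =>
        rw [hnx] at hc₁' hc₂'
        refine ⟨by simp only [List.length_cons]; omega, ?_, ?_, ?_, ?_⟩
        · simp only [List.length_cons, List.length_nil]
          rw [show s 1 + (0 + 1 + 1) = s 1 + 1 + 1 by omega, hv2, hc₂']
          simp
        · simp only [List.length_cons]; omega
        · simp only [List.length_cons, List.length_nil]
          rw [show s 1 + (0 + 1 + 1) - 1 = s 1 + 1 by omega, hv1, hc₁']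
          simp
        · simpa [stackWords] using hold
      | _ :: _ :: _ :: _ =>
        rw [hnx] at hlen2
        simp only [List.length_cons] at hlen2
        omega
    obtain ⟨x, l'', hxl⟩ : ∃ x l'', stackWords n q tenc (S.next t a ++ l) = x :: l'' :=
      List.exists_cons_of_ne_nil (by simp [stackWords])
    rw [hxl] at hnew
    refine ⟨x, l'', hxl, ?_, ?_⟩
    · rw [joinMemory_low (by norm_num), r0, hnew.2.1]
    · rw [joinMemory_low (by norm_num), r1]
      refine hnew.2.2.congr fun y h1 _ => joinMemory_high (by omega)

/-- Task addresses are at least `16`, hence nonzero, and the stack ends with the word `0`; the loop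
therefore stops exactly when no task is left. Each task costs the `19` operations of the body and
one loop test. -/
theorem Represents.runs {N k : ℕ} {s : ℕ → ℕ} {f f' : ι → A} {l : List τ}
    (h : S.Represents pos enc tenc s f l) (hr : S.Runs k f l f')
    (hN : stackBase n q M + l.length + 2 * k + 3 < N) :
    ∃ s', RamRuns N (.loop 0 taskBody) s (20 * k + 1) s' ∧ ∀ i, s' (16 + pos i) = enc (f' i) := by
  induction hr generalizing s with
  | nil f =>
    obtain ⟨x, l', hl, h0, -⟩ := h.stack
    simp only [stackWords, List.map_nil, List.nil_append, List.cons.injEq] at hl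
    exact ⟨s, .loop_done (by rw [h0, ← hl.1]), h.word⟩
  | @cons k f f' t l hr ih =>
    simp only [List.length_cons] at hN
    obtain ⟨s₁, hs₁, h₁⟩ := h.step (N := N) (by omega)
    have h2 := S.length_next_le t (f (S.pos t))
    obtain ⟨s', hs', hw⟩ := ih h₁ (by rw [List.length_append]; omega)
    obtain ⟨x, l', hl, h0, -⟩ := h.stack
    simp only [stackWords, List.map_cons, List.cons_append, List.cons.injEq] at hl
    refine ⟨s', ?_, hw⟩
    have := RamRuns.loop_step (by rw [h0, ← hl.1]; unfold taskAddr; omega) hs₁ hs'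
    rwa [show 19 + (20 * k + 1) + 1 = 20 * (k + 1) + 1 by ring] at this

variable (S pos enc tenc)

/-- The table that makes a task system known to the machine, with the initial tasks `l`. -/
def ramTable (l : List τ) (a : ℕ) : ℕ :=
  if a < 16 then
    if a = 0 then (stackWords n q tenc l).headD 0
    else if a = 1 then stackBase n q M + l.length - 1
    else if a = 5 then q else if a = 6 then 1 else 0
  else if a < stackBase n q M then
    Function.extend (fun x : τ × Option (Fin 4 × A) => fieldAddr (n := n) enc tenc x.1 x.2)
      (fun x => S.fieldVal pos enc tenc x.1 x.2) 0 a
  else (stackWords n q tenc l).tail.reverse.getD (a - stackBase n q M) 0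

theorem fieldVal_lt {N : ℕ} (hN : stackBase n q M + q + 3 ≤ N) (t : τ) (j : Option (Fin 4 × A)) :
    S.fieldVal pos enc tenc t j < N := by
  have hb : 16 + n ≤ stackBase n q M := by unfold stackBase; omega
  match j with
  | none =>
    have := (pos (S.pos t)).2
    simp only [fieldVal]; omega
  | some (0, a) =>
    have := (enc (S.out t a)).2
    simp only [fieldVal]; omega
  | some (1, a) =>
    have := S.length_next_le t a
    simp only [fieldVal]; omega
  | some (2, a) =>
    have : ((S.next t a).map (taskAddr n q tenc)).getLastD 0 < stackBase n q M := by
      rcases List.eq_nil_or_concat (S.next t a) with h | ⟨l, x, h⟩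
      · rw [h]; simp; omega
      · rw [h]; simpa using taskAddr_lt tenc x
    simp only [fieldVal]; omega
  | some (3, a) =>
    have : ((S.next t a).map (taskAddr n q tenc)).headD 0 < stackBase n q M := by
      cases S.next t a with
      | nil => simp; omega
      | cons x l => simpa using taskAddr_lt tenc x
    simp only [fieldVal]; omega

theorem ramTable_lt {N : ℕ} (l : List τ) (hN : stackBase n q M + q + l.length + 3 ≤ N) (a : ℕ) :
    S.ramTable pos enc tenc l a < N := by
  have hb : 16 + n ≤ stackBase n q M := by unfold stackBase; omega
  have hw : ∀ x ∈ stackWords n q tenc l, x < N := fun x hx =>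
    (stackWords_lt tenc l hx).trans_le (by omega)
  obtain ⟨x, l', hxl⟩ : ∃ x l', stackWords n q tenc l = x :: l' :=
    List.exists_cons_of_ne_nil (by simp [stackWords])
  unfold ramTable
  rw [hxl] at hw ⊢
  split_ifs
  · exact hw x (by simp)
  · omega
  · omega
  · omega
  · omega
  · by_cases h : ∃ y : τ × Option (Fin 4 × A), fieldAddr (n := n) enc tenc y.1 y.2 = a
    · obtain ⟨y, rfl⟩ := h
      rw [(fieldAddr_injective (n := n) enc tenc).extend_apply _ _ y]
      exact fieldVal_lt S pos enc tenc (by omega) _ _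
    · rw [Function.extend_apply' _ _ _ h, Pi.zero_apply]
      omega
  · simp only [List.tail_cons]
    by_cases h : a - stackBase n q M < l'.reverse.length
    · rw [List.getD_eq_getElem _ _ h]
      refine hw _ (List.mem_cons_of_mem _ ?_)
      exact List.mem_reverse.1 (List.getElem_mem h)
    · rw [List.getD_eq_default _ _ (by omega)]
      omega

theorem represents_ramInput (f : ι → A) (l : List τ) :
    S.Represents pos enc tenc (ramInput 16 enc pos (S.ramTable pos enc tenc l) f) f l := by
  have hb : 16 + n ≤ stackBase n q M := by unfold stackBase; omega
  have hout : ∀ a, (a < 16 ∨ 16 + n ≤ a) →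
      ramInput 16 enc pos (S.ramTable pos enc tenc l) f a = S.ramTable pos enc tenc l a := by
    intro a ha
    unfold ramInput
    rw [dif_neg (by omega)]
  obtain ⟨x, l', hxl⟩ : ∃ x l', stackWords n q tenc l = x :: l' :=
    List.exists_cons_of_ne_nil (by simp [stackWords])
  have hlen : l'.length = l.length := by
    have := congrArg List.length hxl
    simpa [stackWords] using this.symm
  refine ⟨?_, ?_, ?_, ?_, x, l', hxl, ?_, ?_⟩
  · rw [hout _ (by omega)]; simp [ramTable]
  · rw [hout _ (by omega)]; simp [ramTable]
  · intro i
    unfold ramInput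
    rw [dif_pos (by have := (pos i).2; omega)]
    congr 3
    rw [Equiv.symm_apply_eq]
    apply Fin.ext
    simp
  · intro t j
    have h1 := le_fieldAddr (n := n) enc tenc t j
    have h2 := fieldAddr_lt (n := n) enc tenc t j
    rw [hout _ (by omega)]
    unfold ramTable
    rw [if_neg (by omega), if_pos h2]
    exact (fieldAddr_injective (n := n) enc tenc).extend_apply _ _ (t, j)
  · rw [hout _ (by omega)]; simp [ramTable, hxl]
  · rw [hout 1 (by omega)]
    have h1 : S.ramTable pos enc tenc l 1 = stackBase n q M + l'.length - 1 := by
      simp [ramTable, hlen]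
    rw [h1]
    refine stackAt_of_reverse (by omega) l' fun j hj => ?_
    rw [hout _ (by omega)]
    unfold ramTable
    rw [if_neg (by omega), if_neg (by omega), hxl]
    simp

end Layout

/-- The tables have constant length per task, and each task pushes at most two words, so linearly
many tasks and steps keep all addresses, words and running times below one multiple of the length.
-/
theorem linearTimeDecodable {A : Type*} [Finite A] {ι τ : ℕ → Type*} [∀ r, Fintype (ι r)]
    [∀ r, Nonempty (ι r)] [∀ r, Fintype (τ r)] {C : ∀ r, Set (ι r → A)} {η : ℝ}
    (S : ∀ r, TaskSystem (ι r) A (τ r)) (l : ∀ r, List (τ r)) (B : ℕ)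
    (hτ : ∀ r, Fintype.card (τ r) ≤ B * Fintype.card (ι r))
    (hl : ∀ r, (l r).length ≤ B * Fintype.card (ι r))
    (hrun : ∀ r, ∀ g ∈ C r, ∀ f : ι r → A, relHamming f g < η →
      ∃ k ≤ B * Fintype.card (ι r), (S r).Runs k f (l r) g) : LinearTimeDecodable C η := by
  set q := Nat.card A with hq
  set c := 16 + 1 + B * (1 + 4 * q) + q + B + 20 * B + 4 with hc
  refine ⟨.loop 0 taskBody, 16, c, Finite.equivFin A, fun r => ?_⟩
  set n := Fintype.card (ι r) with hn
  have hn1 : 1 ≤ n := Fintype.card_pos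
  have hcn : 16 + n + B * n * (1 + 4 * q) + q + B * n + 20 * (B * n) + 4 ≤ c * n := by
    have : c * n = 16 * n + n + B * n * (1 + 4 * q) + q * n + B * n + 20 * (B * n) + 4 * n := by
      rw [hc]; ring
    have hqn : q ≤ q * n := Nat.le_mul_of_pos_right _ hn1
    omega
  have hM : Fintype.card (τ r) * (1 + 4 * q) ≤ B * n * (1 + 4 * q) :=
    Nat.mul_le_mul_right _ (hτ r)
  have hl := hl r
  have hbase : stackBase n q (Fintype.card (τ r)) =
    16 + n + Fintype.card (τ r) * (1 + 4 * q) := rfl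
  have h1 : stackBase n q (Fintype.card (τ r)) + q + (l r).length + 3 ≤ c * n := by linarith
  have h2 : ∀ k ≤ B * n, stackBase n q (Fintype.card (τ r)) + (l r).length + 2 * k + 3 < c * n :=
    fun k hk => by linarith
  have h3 : ∀ k ≤ B * n, 20 * k + 1 ≤ c * n := fun k hk => by linarith
  refine ⟨Fintype.equivFin (ι r), (S r).ramTable (Fintype.equivFin (ι r)) (Finite.equivFin A)
    (Fintype.equivFin (τ r)) (l r), ?_, ?_⟩
  · exact fun a => ramTable_lt _ _ _ _ _ h1 a
  · intro g hg f hfg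
    obtain ⟨k, hk, hr⟩ := hrun r g hg f hfg
    obtain ⟨s', hs', hw⟩ := (represents_ramInput (S r) (Fintype.equivFin (ι r))
      (Finite.equivFin A) (Fintype.equivFin (τ r)) f (l r)).runs (N := c * n) hr (h2 k hk)
    exact ⟨20 * k + 1, s', h3 k hk, hs', hw⟩

end TaskSystem

end

noncomputable section

/-! ## Local search by task systems -/

/-- A local search: the step at a site depends on at most `D` letters and changes no others, and
it unsettles at most `L` sites. -/
structure LocalSearch (ι A σ : Type*) (D L : ℕ) where
  read : σ → Fin D → ι
  near : σ → Fin L → σ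
  step : σ → (ι → A) → (ι → A)
  step_apply : ∀ s f i, (∀ j, read s j ≠ i) → step s f i = f i
  step_congr : ∀ s f g, (∀ j, f (read s j) = g (read s j)) →
    ∀ j, step s f (read s j) = step s g (read s j)
  exists_near : ∀ s t f, (t = s ∨ step t f = f) → step t (step s f) ≠ step s f →
    ∃ l, near s l = t

namespace LocalSearch

variable {ι A σ : Type*} {D L : ℕ} (S : LocalSearch ι A σ D L)

section Tasks

variable [Nonempty ι] [Nonempty A]

open scoped Classical in
/-- A word with the letters `v` at the positions read by the site `s`. -/
def fill (s : σ) (v : Fin D → A) (i : ι) : A :=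
  if h : ∃ j, S.read s j = i then v h.choose else Classical.arbitrary A

/-- The letters after the step at `s`. -/
def newLetter (s : σ) (v : Fin D → A) (j : Fin D) : A := S.step s (S.fill s v) (S.read s j)

/-- The values of `fill` away from the positions read are arbitrary, and the step does not depend on
them. -/
theorem newLetter_eq (s : σ) (f : ι → A) (j : Fin D) :
    S.newLetter s (fun j => f (S.read s j)) j = S.step s f (S.read s j) := by
  refine S.step_congr s _ _ (fun j => ?_) j
  have h : ∃ j', S.read s j' = S.read s j := ⟨j, rfl⟩
  unfold fill
  rw [dif_pos h]
  exact congrArg f h.choose_spec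

/-- The tasks executing a local search. -/
abbrev SearchTask (A σ : Type*) (D L : ℕ) : Type _ := σ × Fin (2 * D + L + 1) × (Fin D → A)

/-- The task of the site `s` in the given phase, when the letters `v` have been read. -/
def task (L : ℕ) (s : σ) (i : ℕ) (v : Fin D → A) : SearchTask A σ D L :=
  (s, Fin.ofNat (2 * D + L + 1) i, v)

/-- The task that begins the step at the site `s`. -/
def start (D L : ℕ) (s : σ) : SearchTask A σ D L := task L s 0 fun _ => Classical.arbitrary A

open scoped Classical in
/-- The task system executing a local search: the tasks of a site read the letters one by one,
then write the new ones, and then schedule the sites which may have become unsettled. -/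
def taskSystem : TaskSystem ι A (SearchTask A σ D L) where
  pos t := if h : t.2.1.1 < D then S.read t.1 ⟨t.2.1.1, h⟩
    else if h : t.2.1.1 - D < D then S.read t.1 ⟨t.2.1.1 - D, h⟩ else Classical.arbitrary ι
  out t a := if t.2.1.1 < D then a
    else if h : t.2.1.1 - D < D then S.newLetter t.1 t.2.2 ⟨t.2.1.1 - D, h⟩ else a
  next t a := if h : t.2.1.1 < D then
      [task L t.1 (t.2.1.1 + 1) (Function.update t.2.2 ⟨t.2.1.1, h⟩ a)]
    else if t.2.1.1 - D < D then [task L t.1 (t.2.1.1 + 1) t.2.2]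
    else if h : t.2.1.1 - D - D < L ∧ S.newLetter t.1 t.2.2 ≠ t.2.2 then
      [task L t.1 (t.2.1.1 + 1) t.2.2, start D L (S.near t.1 ⟨t.2.1.1 - D - D, h.1⟩)]
    else []
  length_next_le t a := by split_ifs <;> simp

variable {S}

theorem task_eq (s : σ) {i : ℕ} (hi : i < 2 * D + L + 1) (v : Fin D → A) :
    task L s i v = (s, ⟨i, hi⟩, v) := by
  have : Fin.ofNat (2 * D + L + 1) i = ⟨i, hi⟩ := Fin.ext (Nat.mod_eq_of_lt hi)
  rw [task, this]

open scoped Classical in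
-- The letters read so far are carried in the task itself, so a site needs only finitely many tasks,
-- in number independent of the level. The lemmas on the three phases extend a run backwards, from
-- the remaining tasks to those that lead to them.
theorem runs_read {s : σ} {f f' : ι → A} {l : List (SearchTask A σ D L)} {k : ℕ}
    (h : S.taskSystem.Runs k f (task L s D (fun j => f (S.read s j)) :: l) f') (i : ℕ) :
    ∀ ph v, ph + i = D → (∀ j : Fin D, j.1 < ph → v j = f (S.read s j)) →
      S.taskSystem.Runs (k + i) f (task L s ph v :: l) f' := by
  induction i with
  | zero =>
    intro ph v hph hv
    have : v = fun j => f (S.read s j) := funext fun j => hv j (by omega)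
    rw [this, show ph = D by omega]
    exact h
  | succ i ih =>
    intro ph v hph hv
    have hp := task_eq (L := L) s (show ph < 2 * D + L + 1 by omega) v
    have hlt : ph < D := by omega
    have e1 : S.taskSystem.pos (task L s ph v) = S.read s ⟨ph, hlt⟩ := by
      rw [hp]; exact dif_pos hlt
    have e2 : ∀ a, S.taskSystem.out (task L s ph v) a = a := by
      intro a
      rw [hp]; exact if_pos hlt
    have e3 : ∀ a, S.taskSystem.next (task L s ph v) a =
        [task L s (ph + 1) (Function.update v ⟨ph, hlt⟩ a)] := by
      intro a
      rw [hp]; exact dif_pos hlt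
    refine .cons ?_
    rw [e2, e3, e1, Function.update_eq_self]
    refine ih (ph + 1) _ (by omega) fun j hj => ?_
    by_cases hj' : j = ⟨ph, hlt⟩
    · subst hj'
      rw [Function.update_self]
    · rw [Function.update_of_ne hj']
      refine hv j ?_
      have : j.1 ≠ ph := fun h => hj' (Fin.ext h)
      omega

open scoped Classical in
-- In between, exactly the positions of the phases already passed hold new letters. Positions may
-- repeat among those read; this is harmless, since new letters are computed from the stored ones
-- and not from the half-written word.
theorem runs_write {s : σ} {f f' : ι → A} {l : List (SearchTask A σ D L)} {k : ℕ}
    (h : S.taskSystem.Runs k (S.step s f) (task L s (D + D) (fun j => f (S.read s j)) :: l) f')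
    (i : ℕ) : ∀ ph, ph + i = D → S.taskSystem.Runs (k + i)
      (fun x => if ∃ j : Fin D, j.1 < ph ∧ S.read s j = x then S.step s f x else f x)
      (task L s (D + ph) (fun j => f (S.read s j)) :: l) f' := by
  induction i with
  | zero =>
    intro ph hph
    have : (fun x => if ∃ j : Fin D, j.1 < ph ∧ S.read s j = x then S.step s f x else f x) =
        S.step s f := by
      funext x
      split_ifs with hx
      · rfl
      · refine (S.step_apply s f x fun j hj => hx ⟨j, ?_, hj⟩).symm
        omega
    rw [this, show ph = D by omega]
    exact h
  | succ i ih =>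
    intro ph hph
    set v : Fin D → A := fun j => f (S.read s j) with hv
    have hp := task_eq (L := L) s (show D + ph < 2 * D + L + 1 by omega) v
    have hlt : ¬ D + ph < D := by omega
    have hlt' : D + ph - D < D := by omega
    have hlt'' : ph < D := by omega
    have e1 : S.taskSystem.pos (task L s (D + ph) v) = S.read s ⟨ph, hlt''⟩ := by
      rw [hp]
      refine (dif_neg hlt).trans ((dif_pos hlt').trans ?_)
      exact congrArg _ (Fin.ext (Nat.add_sub_cancel_left D ph))
    have e2 : ∀ a, S.taskSystem.out (task L s (D + ph) v) a =
        S.step s f (S.read s ⟨ph, hlt''⟩) := by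
      intro a
      rw [← S.newLetter_eq s f]
      rw [hp]
      refine (if_neg hlt).trans ((dif_pos hlt').trans ?_)
      exact congrArg _ (Fin.ext (Nat.add_sub_cancel_left D ph))
    have e3 : ∀ a, S.taskSystem.next (task L s (D + ph) v) a = [task L s (D + (ph + 1)) v] := by
      intro a
      rw [hp]; exact (dif_neg hlt).trans (if_pos hlt')
    refine .cons ?_
    rw [e2, e3, e1]
    have := ih (ph + 1) (by omega)
    refine Eq.subst (motive := fun g => S.taskSystem.Runs (k + i) g _ f') ?_ this
    funext x
    by_cases hx : x = S.read s ⟨ph, hlt''⟩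
    · subst hx
      rw [Function.update_self, if_pos ⟨⟨ph, hlt''⟩, by simp, rfl⟩]
    · rw [Function.update_of_ne hx]
      refine if_congr (exists_congr fun j => and_congr_left fun hj => ?_) rfl rfl
      constructor
      · intro hj'
        have : j.1 ≠ ph := fun he => hx (hj.symm.trans (congrArg _ (Fin.ext he)))
        omega
      · intro hj'; omega

/-- The first sites in the neighbourhood of `s`, in the reverse order. -/
def nearList (S : LocalSearch ι A σ D L) (s : σ) : ℕ → List σ
  | 0 => []
  | i + 1 => if h : i < L then S.near s ⟨i, h⟩ :: nearList S s i else nearList S s i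

theorem length_nearList_le (s : σ) (i : ℕ) : (S.nearList s i).length ≤ i := by
  induction i with
  | zero => simp [nearList]
  | succ i ih =>
    unfold nearList
    split_ifs
    · simpa using ih
    · omega

theorem near_mem_nearList (s : σ) (j : Fin L) {i : ℕ} (h : j.1 < i) :
    S.near s j ∈ S.nearList s i := by
  induction i with
  | zero => omega
  | succ i ih =>
    unfold nearList
    by_cases hj : j.1 = i
    · subst hj
      rw [dif_pos j.2]
      simp
    · have := ih (by omega)
      split_ifs
      · exact List.mem_cons_of_mem _ this
      · exact this

open scoped Classical in
theorem runs_notify {s : σ} {g f' : ι → A} {v : Fin D → A} {l : List (SearchTask A σ D L)} {k : ℕ}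
    (hv : S.newLetter s v ≠ v)
    (h : S.taskSystem.Runs k g ((S.nearList s L).map (start D L) ++ l) f') (i : ℕ) :
    ∀ ph, ph + i = L → S.taskSystem.Runs (k + 1 + i) g
      (task L s (D + D + ph) v :: ((S.nearList s ph).map (start D L) ++ l)) f' := by
  induction i with
  | zero =>
    intro ph hph
    have hp := task_eq (L := L) s (show D + D + ph < 2 * D + L + 1 by omega) v
    have h1 : ¬ D + D + ph < D := by omega
    have h2 : ¬ D + D + ph - D < D := by omega
    have h3 : ¬ (D + D + ph - D - D < L ∧ S.newLetter s v ≠ v) := by omega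
    have e2 : ∀ a, S.taskSystem.out (task L s (D + D + ph) v) a = a := by
      intro a
      rw [hp]; exact (if_neg h1).trans (dif_neg h2)
    have e3 : ∀ a, S.taskSystem.next (task L s (D + D + ph) v) a = [] := by
      intro a
      rw [hp]; exact (dif_neg h1).trans ((if_neg h2).trans (dif_neg h3))
    refine .cons ?_
    rw [e2, e3, Function.update_eq_self, show ph = L by omega]
    exact h
  | succ i ih =>
    intro ph hph
    have hp := task_eq (L := L) s (show D + D + ph < 2 * D + L + 1 by omega) v
    have h1 : ¬ D + D + ph < D := by omega
    have h2 : ¬ D + D + ph - D < D := by omega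
    have h0 : D + D + ph - D - D = ph := by omega
    have h3 : D + D + ph - D - D < L ∧ S.newLetter s v ≠ v := ⟨by omega, hv⟩
    have hlt : ph < L := by omega
    have e2 : ∀ a, S.taskSystem.out (task L s (D + D + ph) v) a = a := by
      intro a
      rw [hp]; exact (if_neg h1).trans (dif_neg h2)
    have e3 : ∀ a, S.taskSystem.next (task L s (D + D + ph) v) a =
        [task L s (D + D + (ph + 1)) v, start D L (S.near s ⟨ph, hlt⟩)] := by
      intro a
      rw [hp]
      refine (dif_neg h1).trans ((if_neg h2).trans ((dif_pos h3).trans ?_))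
      have : (⟨D + D + ph - D - D, h3.1⟩ : Fin L) = ⟨ph, hlt⟩ := Fin.ext h0
      exact congrArg (fun j => [task L s (D + D + (ph + 1)) v, start D L (S.near s j)]) this
    refine .cons ?_
    rw [e2, e3, Function.update_eq_self]
    have := ih (ph + 1) (by omega)
    rw [nearList, dif_pos hlt] at this
    exact this

theorem newLetter_ne_iff (s : σ) (f : ι → A) :
    S.newLetter s (fun j => f (S.read s j)) ≠ (fun j => f (S.read s j)) ↔ S.step s f ≠ f := by
  refine not_congr ⟨fun h => ?_, fun h => ?_⟩
  · funext i
    by_cases hi : ∃ j, S.read s j = i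
    · obtain ⟨j, rfl⟩ := hi
      rw [← S.newLetter_eq]
      exact congrFun h j
    · exact S.step_apply s f i fun j hj => hi ⟨j, hj⟩
  · funext j
    rw [S.newLetter_eq, h]

open scoped Classical in
theorem runs_stay {s : σ} {g f' : ι → A} {v : Fin D → A} {l : List (SearchTask A σ D L)} {k : ℕ}
    (hv : S.newLetter s v = v) (h : S.taskSystem.Runs k g l f') :
    S.taskSystem.Runs (k + 1) g (task L s (D + D) v :: l) f' := by
  have hp := task_eq (L := L) s (show D + D < 2 * D + L + 1 by omega) v
  have h1 : ¬ D + D < D := by omega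
  have h2 : ¬ D + D - D < D := by omega
  have h3 : ¬ (D + D - D - D < L ∧ S.newLetter s v ≠ v) := fun h => h.2 hv
  have e2 : ∀ a, S.taskSystem.out (task L s (D + D) v) a = a := by
    intro a
    rw [hp]; exact (if_neg h1).trans (dif_neg h2)
  have e3 : ∀ a, S.taskSystem.next (task L s (D + D) v) a = [] := by
    intro a
    rw [hp]; exact (dif_neg h1).trans ((if_neg h2).trans (dif_neg h3))
  refine .cons ?_
  rw [e2, e3, Function.update_eq_self]
  exact h

open scoped Classical in
theorem runs_start {s : σ} {f f' : ι → A} {l : List (SearchTask A σ D L)} {k : ℕ}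
    (h : S.taskSystem.Runs k (S.step s f)
      ((if S.step s f = f then [] else S.nearList s L).map (start D L) ++ l) f') :
    ∃ k' ≤ 2 * D + L + 1, S.taskSystem.Runs (k + k') f (start D L s :: l) f' := by
  obtain ⟨k₁, hk₁, h1⟩ : ∃ k₁ ≤ L + 1, S.taskSystem.Runs (k + k₁) (S.step s f)
      (task L s (D + D) (fun j => f (S.read s j)) :: l) f' := by
    by_cases hs : S.step s f = f
    · rw [if_pos hs] at h
      refine ⟨1, by omega, runs_stay ?_ h⟩
      by_contra hne
      exact (newLetter_ne_iff s f).1 hne hs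
    · rw [if_neg hs] at h
      refine ⟨1 + L, by omega, ?_⟩
      rw [← add_assoc]
      exact runs_notify ((newLetter_ne_iff s f).2 hs) h L 0 (by omega)
  have h2 := runs_write h1 D 0 (by omega)
  have h3 : (fun x => if ∃ j : Fin D, j.1 < 0 ∧ S.read s j = x then S.step s f x else f x) = f := by
    funext x
    exact if_neg (by rintro ⟨j, hj, -⟩; omega)
  rw [h3] at h2
  refine ⟨k₁ + D + D, by omega, ?_⟩
  have := runs_read h2 D 0 (fun _ => Classical.arbitrary A) (by omega) fun j hj => by omega
  rw [show k + (k₁ + D + D) = k + k₁ + D + D by ring]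
  exact this

/-- The word `g` is obtained from `f` by steps of the local search. -/
def Reaches (S : LocalSearch ι A σ D L) (f g : ι → A) : Prop :=
  Relation.ReflTransGen (fun f g => ∃ s, S.step s f = g) f g

/-- The worklist always contains every unsettled site, so the word is settled when the list is
empty. The quantity `l.length + (L + 1) Ψ` drops with each site treated: an idle step only removes a
site, while an effective one adds at most `L` sites but lowers `Ψ`. Each site costs at most `2 D + L
+ 1` tasks. -/
theorem exists_runs {Ψ : (ι → A) → ℕ} (hΨ : ∀ s f, S.step s f = f ∨ Ψ (S.step s f) < Ψ f)
    (f : ι → A) (l : List σ) (hl : ∀ t, S.step t f ≠ f → t ∈ l) :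
    ∃ k f', S.taskSystem.Runs k f (l.map (start D L)) f' ∧ (∀ t, S.step t f' = f') ∧
      S.Reaches f f' ∧ k ≤ (2 * D + L + 1) * (l.length + (L + 1) * Ψ f) := by
  classical
  induction hN : l.length + (L + 1) * Ψ f using Nat.strong_induction_on generalizing f l with
  | _ N ih =>
    match l, hl, hN with
    | [], hl, _ =>
      refine ⟨0, f, .nil f, fun t => ?_, Relation.ReflTransGen.refl, by omega⟩
      by_contra ht
      simpa using hl t ht
    | s :: l, hl, hN =>
      set l₁ := (if S.step s f = f then [] else S.nearList s L) ++ l with hl₁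
      have hlen : l₁.length + (L + 1) * Ψ (S.step s f) + 1 ≤ N := by
        rw [← hN, hl₁, List.length_append, List.length_cons]
        by_cases hs : S.step s f = f
        · rw [if_pos hs, hs, List.length_nil]
          omega
        · rw [if_neg hs]
          have h1 := length_nearList_le (S := S) s L
          have h2 : (L + 1) * (Ψ (S.step s f) + 1) ≤ (L + 1) * Ψ f :=
            Nat.mul_le_mul_left _ ((hΨ s f).resolve_left hs)
          rw [mul_add, mul_one] at h2
          omega
      obtain ⟨k, f', hr, hfix, hreach, hk⟩ := ih _ (by omega) (S.step s f) l₁ (fun t ht => by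
        rw [hl₁, List.mem_append]
        by_cases hs : S.step s f = f
        · rw [hs] at ht
          rcases List.mem_cons.1 (hl t ht) with rfl | h
          · exact absurd hs ht
          · exact Or.inr h
        · rw [if_neg hs]
          by_cases htl : t = s ∨ S.step t f = f
          · obtain ⟨j, rfl⟩ := S.exists_near s t f htl ht
            exact Or.inl (near_mem_nearList s j j.2)
          · push Not at htl
            exact Or.inr ((List.mem_cons.1 (hl t htl.2)).resolve_left htl.1)) rfl
      rw [hl₁, List.map_append] at hr
      obtain ⟨k', hk', hr'⟩ := runs_start hr
      refine ⟨k + k', f', hr', hfix, Relation.ReflTransGen.head ⟨s, rfl⟩ hreach, ?_⟩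
      have h1 := Nat.mul_le_mul_left (2 * D + L + 1) hlen
      rw [mul_add, mul_one] at h1
      omega

end Tasks

/-- All sites are scheduled at the start. The numbers of sites and the potential are linear in the
length, and a site has `(2 D + L + 1) |A|^D` tasks, so tables and runs are linear too. -/
theorem linearTimeDecodable {A : Type*} [Finite A] [Nonempty A] {ι σ : ℕ → Type*}
    [∀ r, Fintype (ι r)] [∀ r, Nonempty (ι r)] [∀ r, Fintype (σ r)] {C : ∀ r, Set (ι r → A)}
    {η : ℝ} {D L : ℕ} (S : ∀ r, LocalSearch (ι r) A (σ r) D L) (Ψ : ∀ r, (ι r → A) → ℕ)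
    (hΨ : ∀ r s f, (S r).step s f = f ∨ Ψ r ((S r).step s f) < Ψ r f) (B : ℕ)
    (hσ : ∀ r, Fintype.card (σ r) ≤ B * Fintype.card (ι r))
    (hB : ∀ r f, Ψ r f ≤ B * Fintype.card (ι r))
    (hdec : ∀ r, ∀ g ∈ C r, ∀ f : ι r → A, relHamming f g < η → ∀ f', (S r).Reaches f f' →
      (∀ t, (S r).step t f' = f') → f' = g) : LinearTimeDecodable C η := by
  classical
  have := Fintype.ofFinite A
  set a := (2 * D + L + 1) * Fintype.card A ^ D with ha
  set b := (2 * D + L + 1) * (1 + (L + 1)) with hb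
  have hmono : ∀ (r c : ℕ), c ≤ 1 + a + b → c * B * Fintype.card (ι r) ≤
      (1 + a + b) * B * Fintype.card (ι r) := fun r c hc =>
    Nat.mul_le_mul_right _ (Nat.mul_le_mul_right _ hc)
  refine TaskSystem.linearTimeDecodable (fun r => (S r).taskSystem)
    (fun r => (Finset.univ : Finset (σ r)).toList.map (start D L)) ((1 + a + b) * B) ?_ ?_ ?_
  · intro r
    refine le_trans ?_ (hmono r a (by omega))
    rw [Fintype.card_prod, Fintype.card_prod, Fintype.card_fin, Fintype.card_fun, Fintype.card_fin,
      mul_assoc, mul_comm (Fintype.card (σ r))]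
    exact Nat.mul_le_mul_left a (hσ r)
  · intro r
    rw [List.length_map, Finset.length_toList, Finset.card_univ]
    refine (hσ r).trans ?_
    have := hmono r 1 (by omega)
    rwa [one_mul] at this
  · intro r g hg f hfg
    obtain ⟨k, f', hr, hfix, hreach, hk⟩ := exists_runs (hΨ r) f (Finset.univ : Finset (σ r)).toList
      (fun t _ => by simp)
    rw [hdec r g hg f hfg f' hreach hfix] at hr
    refine ⟨k, ?_, hr⟩
    rw [Finset.length_toList, Finset.card_univ] at hk
    refine (hk.trans (Nat.mul_le_mul_left _ (Nat.add_le_add (hσ r)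
      (Nat.mul_le_mul_left _ (hB r f))))).trans ?_
    refine le_trans (le_of_eq ?_) (hmono r b (by omega))
    rw [hb]; ring

end LocalSearch

end

/-! ### The decoder of a cocycle code as a local search -/

noncomputable section

theorem Finset.exists_fin_enumeration {α : Type*} [Nonempty α] (R : Finset α) {D : ℕ}
    (h : R.card ≤ D) : ∃ g : Fin D → α, ∀ x ∈ R, ∃ j, g j = x := by
  refine ⟨fun j => if hj : j.1 < R.card then (R.equivFin.symm ⟨j.1, hj⟩).1
    else Classical.arbitrary α, fun x hx => ?_⟩
  have h1 := (R.equivFin ⟨x, hx⟩).2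
  refine ⟨⟨R.equivFin ⟨x, hx⟩, by omega⟩, ?_⟩
  simp

namespace AugSheaf

variable {𝔽 : Type*} [Field 𝔽] {V : Type*} [LinearOrder V] {X : SComplex V} {d n k m Q : ℕ}

/-- If the windows of `s` and `t` are disjoint, the step at `s` is invisible at `t`, so a settled
`t` stays settled. For `t = s` an effective step requires a nonempty window, which then meets
itself. -/
theorem mem_nearby_of_improve_ne (F : AugSheaf 𝔽 X) {s t : V} (ht : t ∈ X.verts)
    {f : F.Cochain n} (hf : t = s ∨ F.improve d t f = f)
    (hne : F.improve d t (F.improve d s f) ≠ F.improve d s f) : t ∈ X.nearby n s := by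
  by_contra hnear
  have hdisj : ∀ x ∈ X.window n t, x ∉ X.window n s := by
    intro x hx hx'
    exact hnear (Finset.mem_biUnion.2 ⟨x, hx', Finset.mem_filter.2
      ⟨ht, (Finset.mem_filter.1 hx).2⟩⟩)
  apply hne
  funext x
  by_cases hx : x ∈ X.window n t
  · rcases hf with rfl | hf
    · exact absurd hx (hdisj x hx)
    · have h1 : ∀ x ∈ X.window n t, F.improve d s f x = f x := fun x hx =>
        F.improve_apply_of_not_mem f (hdisj x hx)
      rw [F.improve_congr h1 (h1 x hx), hf, h1 x hx]
  · exact F.improve_apply_of_not_mem _ hx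

section Search

variable {F : AugSheaf 𝔽 X} (e : F.Framing k m)

/-- The local improvement of words. -/
def improveWord (d : ℕ) (v : V) (f : X.CardFace (k + 1) → (Fin m → 𝔽)) :
    X.CardFace (k + 1) → (Fin m → 𝔽) := ofCochain e (F.improve d v (toCochain e f))

theorem toCochain_improveWord (v : V) (f : X.CardFace (k + 1) → (Fin m → 𝔽)) :
    toCochain e (improveWord e d v f) = F.improve d v (toCochain e f) := toCochain_ofCochain e _

theorem toCochain_injective : Function.Injective (toCochain e) :=
  Function.LeftInverse.injective (g := ofCochain e) (ofCochain_toCochain e)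

theorem improveWord_eq_iff (v : V) (f : X.CardFace (k + 1) → (Fin m → 𝔽)) :
    improveWord e d v f = f ↔ F.improve d v (toCochain e f) = toCochain e f := by
  rw [← toCochain_improveWord, (toCochain_injective e).eq_iff]

theorem exists_localSearch (hX : X.IsPure d) (hQ : X.HasDegreeLE Q)
    (hne : Nonempty (X.CardFace (k + 1))) :
    ∃ S : LocalSearch (X.CardFace (k + 1)) (Fin m → 𝔽) X.verts (2 * Q) (2 * Q * (Q * (d + 1))),
      ∀ v, S.step v = improveWord e d v.1 := by
  have h1 : ∀ v : X.verts, ∃ g : Fin (2 * Q) → X.CardFace (k + 1),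
      ∀ x ∈ X.window (k + 1) v.1, ∃ j, g j = x := fun v =>
    Finset.exists_fin_enumeration _ (SComplex.card_window_le hQ v.1)
  have h2 : ∀ v : X.verts, ∃ g : Fin (2 * Q * (Q * (d + 1))) → X.verts,
      ∀ t : X.verts, t.1 ∈ X.nearby (k + 1) v.1 → ∃ j, g j = t := by
    intro v
    have : Nonempty X.verts := ⟨v⟩
    obtain ⟨g, hg⟩ := Finset.exists_fin_enumeration
      ((Finset.univ : Finset X.verts).filter fun t => t.1 ∈ X.nearby (k + 1) v.1)
      (D := 2 * Q * (Q * (d + 1))) (by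
        refine le_trans ?_ (SComplex.card_nearby_le hX hQ (n := k + 1) (by omega) v.1)
        refine Finset.card_le_card_of_injOn (fun t => t.1) ?_ ?_
        · intro t ht
          exact (Finset.mem_filter.1 ht).2
        · intro t _ t' _ h
          exact Subtype.ext h)
    exact ⟨g, fun t ht => hg t (Finset.mem_filter.2 ⟨Finset.mem_univ _, ht⟩)⟩
  choose read hread using h1
  choose near hnear using h2
  have hnot : ∀ (v : X.verts) (x : X.CardFace (k + 1)), (∀ j, read v j ≠ x) →
      x ∉ X.window (k + 1) v.1 := fun v x hx hx' => by
    obtain ⟨j, hj⟩ := hread v x hx'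
    exact hx j hj
  refine ⟨⟨read, near, fun v => improveWord e d v.1, ?_, ?_, ?_⟩, fun v => rfl⟩
  · intro v f x hx
    change e x (F.improve d v.1 (toCochain e f) x) = f x
    rw [F.improve_apply_of_not_mem _ (hnot v x hx)]
    exact (e x).apply_symm_apply _
  · intro v f g hfg j
    change e _ (F.improve d v.1 (toCochain e f) _) = e _ (F.improve d v.1 (toCochain e g) _)
    have h : ∀ j, toCochain e f (read v j) = toCochain e g (read v j) := fun j =>
      congrArg (e (read v j)).symm (hfg j)
    refine congrArg _ (F.improve_congr (fun x hx => ?_) (h j))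
    obtain ⟨j, rfl⟩ := hread v x hx
    exact h j
  · intro s t f hf hne
    refine hnear s t (mem_nearby_of_improve_ne F t.2 (d := d) (f := toCochain e f) ?_ ?_)
    · exact hf.imp (fun h => congrArg _ h) fun h => (improveWord_eq_iff e t.1 f).1 h
    · intro h
      apply hne
      rw [← toCochain_improveWord] at h
      exact (improveWord_eq_iff e t.1 _).2 h

end Search

theorem linearTimeDecodable_cocycleCode [Finite 𝔽] {W : ℕ → Type*} [∀ r, LinearOrder (W r)]
    {Y : ∀ r, SComplex (W r)} {F : ∀ r, AugSheaf 𝔽 (Y r)} (e : ∀ r, (F r).Framing k m)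
    (hY : ∀ r, (Y r).IsPure d) (hQ : ∀ r, (Y r).HasDegreeLE Q) (hQ1 : 1 ≤ Q) (hk : k + 1 ≤ d)
    {θ δ η : ℝ} (hθ : ∀ r, (F r).SmallCocyclesVanish d (k + 1) θ)
    (hδ : ∀ r, HasRelDistance (cocycleCode (e r)) δ) (hη1 : η * ((Q : ℝ) ^ 2 * (k + 2)) ≤ θ)
    (hη2 : η * (1 + (Q : ℝ) ^ 3) ≤ δ) :
    LinearTimeDecodable (fun r => cocycleCode (e r)) η := by
  have hne : ∀ r, Nonempty ((Y r).CardFace (k + 1)) := fun r =>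
    SComplex.cardFace_nonempty (hY r) (by omega)
  choose S hS using fun r => exists_localSearch (e r) (hY r) (hQ r) (hne r)
  refine LocalSearch.linearTimeDecodable S
    (fun r f => (F r).suppCount d ((F r).coboundary (k + 1) (toCochain (e r) f))) ?_
    (k + 1 + Q * Q) ?_ ?_ ?_
  · intro r v f
    rw [hS, improveWord_eq_iff, toCochain_improveWord]
    exact (F r).improve_eq_or_lt v.1 _
  · intro r
    rw [Fintype.card_coe, add_mul]
    exact (SComplex.card_verts_le (hY r) (n := k + 1) (by omega) (by omega)).trans
      (Nat.le_add_right _ _)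
  · intro r f
    refine ((F r).suppCount_le (hQ r) (by omega) _).trans ?_
    have h1 : ((F r).supp ((F r).coboundary (k + 1) (toCochain (e r) f))).card ≤
        Fintype.card ((Y r).CardFace (k + 2)) := by
      rw [SComplex.card_cardFace]
      refine Finset.card_le_card fun s hs => ?_
      have := (F r).supp_subset_faces hs
      exact Finset.mem_filter.2 this
    have h2 := SComplex.card_cardFace_succ_le (hQ r) (n := k + 1) (by omega)
    refine (Nat.mul_le_mul_left Q (h1.trans h2)).trans ?_
    rw [add_mul, ← mul_assoc]
    exact Nat.le_add_left _ _
  · intro r g hg f hfg f' hreach hfix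
    refine eq_of_improves (e r) (hY r) (hQ r) hQ1 hk (hθ r) (hδ r) hη1 hη2 hg hfg ?_ ?_
    · unfold Improves
      clear hfix
      induction hreach with
      | refl => exact .refl
      | tail _ h ih =>
        obtain ⟨v, rfl⟩ := h
        exact ih.tail ⟨v.1, v.2, by rw [hS, toCochain_improveWord]⟩
    · intro v hv
      rw [← improveWord_eq_iff, ← hS r ⟨v, hv⟩]
      exact hfix ⟨v, hv⟩

end AugSheaf

end

/-! ### Uniform testability, distance and decoding along the tower -/

noncomputable section

theorem towerMap_isCovering {V : ℕ → Type*} [∀ r, LinearOrder (V r)] {X : ∀ r, SComplex (V r)}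
    {u : ∀ r, SMap (X (r + 1)) (X r)} (hu : ∀ r, (u r).IsCovering) :
    ∀ r, (towerMap u r).IsCovering
  | 0 => SMap.isCovering_id
  | r + 1 => (towerMap_isCovering hu r).comp (hu r)

namespace AugSheaf

variable {𝔽 : Type*} [Field 𝔽] {W V : Type*} [LinearOrder W] [LinearOrder V]
variable {Y : SComplex W} {X : SComplex V} {d k : ℕ}

/-- Testing on cochains supported on one face turns the global condition `B = 0` into the vanishing
of single restriction maps, a condition that pullbacks along coverings inherit. -/
theorem res_eq_zero_of_coboundaries_eq_bot {F : AugSheaf 𝔽 X} {n : ℕ}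
    (hB : F.coboundaries (n + 1) = ⊥) {x : X.CardFace n} {y : X.CardFace (n + 1)} (h : x.1 ≤ y.1)
    (s : F.obj x.1) : F.res h s = 0 := by
  classical
  obtain ⟨v, hv, rfl⟩ := exists_facet_eq h
  let g : F.Cochain n := Pi.single (facet y v hv) s
  have h0 : F.coboundary n g = 0 := by
    have : F.coboundary n g ∈ F.coboundaries (n + 1) := ⟨g, rfl⟩
    rwa [hB, Submodule.mem_bot] at this
  have h1 := congrFun h0 y
  rw [coboundary_apply, Finset.sum_eq_single v] at h1
  · rw [ev_erase F _ hv] at h1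
    have h2 : g (facet y v hv) = s := Pi.single_eq_same _ _
    rw [h2] at h1
    have h3 : posSign y.1.1 v • posSign y.1.1 v • F.res (facet_le y v hv) s = 0 := by
      rw [h1]; exact smul_zero _
    rwa [smul_smul, posSign_mul_self, one_smul] at h3
  · intro w hw hwv
    have h2 : g (facet y w hw) = 0 := by
      have hne : facet y w hw ≠ facet y v hv := by
        intro he
        have h3 : y.1.1.erase w = y.1.1.erase v := congrArg (fun t => t.1.1) he
        have h4 : v ∈ y.1.1.erase w := Finset.mem_erase.2 ⟨hwv.symm, hv⟩
        rw [h3] at h4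
        exact (Finset.mem_erase.1 h4).1 rfl
      simp only [g]
      rw [Pi.single_eq_of_ne hne]
    rw [ev_erase F _ hw, h2, map_zero, smul_zero]
  · intro h
    exact absurd hv h

theorem coboundary_pullback_eq_zero {F : AugSheaf 𝔽 X} {n : ℕ}
    (hB : F.coboundaries (n + 1) = ⊥) {u : SMap Y X} (hu : u.IsCovering)
    (f : (F.pullback u).Cochain n) : (F.pullback u).coboundary n f = 0 := by
  funext y
  rw [coboundary_apply]
  refine Finset.sum_eq_zero fun v hv => ?_
  rw [ev_erase _ _ hv]
  refine (congrArg _ ?_).trans (smul_zero _)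
  exact res_eq_zero_of_coboundaries_eq_bot hB
    (x := ⟨u.face (facet y v hv).1, (hu.dimPreserving _).trans (facet y v hv).2⟩)
    (y := ⟨u.face y.1, (hu.dimPreserving _).trans y.2⟩) (u.face_mono (facet_le y v hv)) _

theorem testable_distance_decodable [Finite 𝔽] {m : ℕ} (hk : k + 2 ≤ d) (hm : 1 ≤ m)
    {V : ℕ → Type*} [∀ r, LinearOrder (V r)]
    {X : ∀ r, SComplex (V r)} (u : ∀ r, SMap (X (r + 1)) (X r))
    (hpure : (X 0).IsPure d) (hstrong : (X 0).IsStronglyConnected d)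
    (hconn : ∀ r, (X r).IsConnected) (hu : ∀ r, (u r).IsCovering)
    {F : AugSheaf 𝔽 (X 0)} (e : F.Framing k m) (hB : F.coboundaries (k + 1) = ⊥)
    (hne : ∀ x : (X 0).Face, x.1.card = k + 2 ∨ x.1.card = k + 3 → Nontrivial (F.obj x))
    (hexp : F.HasLocalExpansion d k) :
    (∃ μ : ℝ, 0 < μ ∧ ∀ r, IsTestable (cocycleCode (towerFraming e u hu r))
      (cocycleTester (towerFraming e u hu r)) (k + 2) μ) ∧
    (∃ δ : ℝ, 0 < δ ∧ ∀ r, HasRelDistance (cocycleCode (towerFraming e u hu r)) δ) ∧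
    (∃ η : ℝ, 0 < η ∧
      LinearTimeDecodable (fun r => cocycleCode (towerFraming e u hu r)) η) := by
  obtain ⟨ε, ε', lam, hε, hε', hlam, hle, hloc, hloc', hspec⟩ := hexp
  have hcov := fun r => towerMap_isCovering hu r
  have hd0 : (0 : ℝ) < d := by exact_mod_cast (show 0 < d by omega)
  rw [one_div, ← div_eq_inv_mul, le_div_iff₀ hd0, mul_comm] at hle
  have hle1 : d * lam ≤ 1 := hle.trans (min_le_right _ _)
  have hle2 : d * lam ≤ fatScale k (expansionMin k ε) ^ (2 ^ k) :=
    hle.trans ((min_le_left _ _).trans (min_le_left _ _))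
  -- The second bound on `lam` is the first with `k + 1` in place of `k`, since `(k+1) + 1 = k + 2`
  -- and `2 (k+1) + 6 = 2 k + 8`.
  have hle3 : d * lam ≤ fatScale (k + 1) (expansionMin (k + 1) ε') ^ (2 ^ (k + 1)) := by
    refine (hle.trans ((min_le_left _ _).trans (min_le_right _ _))).trans (le_of_eq ?_)
    unfold fatScale
    push_cast
    rw [show (k : ℝ) + 1 + 1 = k + 2 by ring, show 2 * (k + 1) + 6 = 2 * k + 8 by ring]
  have hne1 : ∀ x : (X 0).Face, x.1.card = k + 1 ∨ x.1.card = k + 2 → Nontrivial (F.obj x) := by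
    rintro x (hx | hx)
    · have : Nonempty (Fin m) := ⟨⟨0, hm⟩⟩
      exact (e ⟨x, hx⟩).toEquiv.nontrivial
    · exact hne x (Or.inl hx)
  set Q := (X 0).faces.card with hQdef
  have hQ1 : 1 ≤ Q := Finset.card_pos.2 ⟨∅, (X 0).empty_mem⟩
  have hQ0 : (0 : ℝ) < Q := by exact_mod_cast hQ1
  have hQ : ∀ r, (X r).HasDegreeLE Q := fun r => (hcov r).hasDegreeLE
  have hY : ∀ r, (X r).IsPure d := fun r => (hcov r).isPure hpure
  set θ := fatScale k (expansionMin k ε) ^ (2 ^ (k + 1) - 1) with hθdef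
  have hθ0 : 0 < θ := pow_pos (fatScale_pos (expansionMin_pos hε)) _
  set θ' := fatScale (k + 1) (expansionMin (k + 1) ε') ^ (2 ^ (k + 1 + 1) - 1) with hθ'def
  have hθ'0 : 0 < θ' := pow_pos (fatScale_pos (expansionMin_pos hε')) _
  have hsmall : ∀ r, (F.pullback (towerMap u r)).SmallCocyclesVanish d (k + 1) θ' :=
    fun r f hf hfs hf0 => eq_zero_of_isLocallyMinimal F (hcov r) hpure (by omega) hstrong (hconn r)
      (by omega) hne hε' hloc' hlam hle1 hle3 hspec f hf hfs hf0
  have hdist : ∀ r, HasRelDistance (cocycleCode (towerFraming e u hu r)) (θ / Q) := by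
    intro r
    refine hasRelDistance_cocycleCode _ (hY r) (hQ r) hQ1 (by omega) fun f hfs hf0 => ?_
    refine eq_zero_of_isLocallyMinimal F (hcov r) hpure (by omega) hstrong (hconn r)
      (by omega) hne1 hε hloc hlam hle1 hle2 hspec f ?_ hfs hf0
    -- All coboundaries of degree `k` vanish on the covering, so every cochain is locally minimal.
    intro v g _
    rw [coboundary_pullback_eq_zero hB (hcov r), add_zero]
  refine ⟨⟨min (θ' / Q) (1 / (Q : ℝ) ^ 3), by positivity, fun r =>
    isTestable_cocycleCode _ (hY r) (hQ r) hQ1 (by omega) hθ'0 (hsmall r)⟩,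
    ⟨θ / Q, by positivity, hdist⟩,
    ⟨min (θ' / ((Q : ℝ) ^ 2 * (k + 2))) (θ / Q / (1 + (Q : ℝ) ^ 3)), by positivity, ?_⟩⟩
  refine linearTimeDecodable_cocycleCode (fun r => towerFraming e u hu r) hY hQ hQ1 (by omega)
    hsmall hdist ?_ ?_
  · rw [← le_div_iff₀ (by positivity)]
    exact min_le_left _ _
  · rw [← le_div_iff₀ (by positivity)]
    exact min_le_right _ _

end AugSheaf

end

/-! ### Galois coverings: invariants and growth of cocycle spaces -/

noncomputable section

section Signs

variable {U V W : Type*} [LinearOrder U] [LinearOrder V] [LinearOrder W]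

theorem AugSheaf.transferSign_congr {u u' : W → V} {y : Finset W} (h : ∀ a ∈ y, u a = u' a) :
    AugSheaf.transferSign u ∅ y = AugSheaf.transferSign u' ∅ y :=
  Finset.prod_congr rfl fun a ha => Finset.prod_congr rfl fun b hb => by
    unfold AugSheaf.pairSign
    rw [h a ha, h b hb]

/-- For `z = ∅` the sign is the parity of the inversions of the map. A pair is inverted by the
composite if and only if exactly one of the two maps inverts it. -/
theorem AugSheaf.transferSign_comp {u : W → V} {w : U → W} {y : Finset U} (hw : Set.InjOn w y)
    (hu : Set.InjOn u (y.image w)) :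
    AugSheaf.transferSign (u ∘ w) ∅ y =
      AugSheaf.transferSign w ∅ y * AugSheaf.transferSign u ∅ (y.image w) := by
  have h1 : AugSheaf.transferSign u ∅ (y.image w) =
      ∏ a ∈ y, ∏ b ∈ y, AugSheaf.pairSign u ∅ (w a) (w b) := by
    unfold AugSheaf.transferSign
    rw [Finset.prod_image hw]
    exact Finset.prod_congr rfl fun a _ => Finset.prod_image hw
  have h2 : AugSheaf.transferSign (u ∘ w) ∅ y *
      (AugSheaf.transferSign w ∅ y * AugSheaf.transferSign u ∅ (y.image w)) = 1 := by
    rw [h1]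
    unfold AugSheaf.transferSign
    simp only [← Finset.prod_mul_distrib]
    rw [← Finset.prod_product']
    refine Finset.prod_involution (fun x _ => (x.2, x.1)) ?_ ?_ ?_ ?_
    · rintro ⟨a, b⟩ hab
      obtain ⟨ha, hb⟩ := Finset.mem_product.1 hab
      simp only at ha hb ⊢
      rcases eq_or_ne a b with rfl | hne
      · simp [AugSheaf.pairSign]
      have hne1 : w a ≠ w b := fun h => hne (hw ha hb h)
      have hne2 : u (w a) ≠ u (w b) := fun h =>
        hne1 (hu (by simpa using ⟨a, ha, rfl⟩) (by simpa using ⟨b, hb, rfl⟩) h)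
      unfold AugSheaf.pairSign
      rcases lt_or_gt_of_ne hne with h | h <;> rcases lt_or_gt_of_ne hne1 with h' | h' <;>
        rcases lt_or_gt_of_ne hne2 with h'' | h'' <;>
        simp [h, h', h'', h.not_gt, h'.not_gt, h''.not_gt]
    · rintro ⟨a, b⟩ _ hne he
      simp only [Prod.mk.injEq] at he
      obtain ⟨rfl, -⟩ := he
      exact hne (by simp [AugSheaf.pairSign])
    · rintro ⟨a, b⟩ hab
      exact Finset.mem_product.2 (Finset.mem_product.1 hab).symm
    · rintro ⟨a, b⟩ _
      rfl
  have h3 := AugSheaf.transferSign_mul_self (u ∘ w) ∅ y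
  set s := AugSheaf.transferSign (u ∘ w) ∅ y
  linear_combination (AugSheaf.transferSign w ∅ y * AugSheaf.transferSign u ∅ (y.image w)) * h3 -
    s * h2

theorem AugSheaf.transferSign_id {u : W → W} {y : Finset W} (h : ∀ a ∈ y, u a = a) :
    AugSheaf.transferSign u ∅ y = 1 := by
  refine Finset.prod_eq_one fun a ha => Finset.prod_eq_one fun b hb => ?_
  unfold AugSheaf.pairSign
  rw [h a ha, h b hb]
  have : ¬ (a < b ∧ b < a) := fun h => lt_asymm h.1 h.2
  simp [this]

end Signs

section Algebra

variable {𝔽 M M' M'' : Type*} [Field 𝔽] [AddCommGroup M] [Module 𝔽 M] [AddCommGroup M']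
  [Module 𝔽 M'] [AddCommGroup M''] [Module 𝔽 M''] [Module.Finite 𝔽 M] [Module.Finite 𝔽 M']

/-- The map `g` sends the kernel of the composite into the kernel of `f`, and the part it kills lies
in the kernel of `g`. -/
theorem LinearMap.finrank_ker_comp_le_add (f : M' →ₗ[𝔽] M'') (g : M →ₗ[𝔽] M') :
    Module.finrank 𝔽 (LinearMap.ker (f ∘ₗ g)) ≤
      Module.finrank 𝔽 (LinearMap.ker f) + Module.finrank 𝔽 (LinearMap.ker g) := by
  set h := g.domRestrict (LinearMap.ker (f ∘ₗ g)) with hh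
  rw [← LinearMap.finrank_range_add_finrank_ker h]
  refine Nat.add_le_add (Submodule.finrank_mono ?_) ?_
  · rintro _ ⟨x, rfl⟩
    exact x.2
  · have h1 : ∀ x : LinearMap.ker h, (x.1.1 : M) ∈ LinearMap.ker g := fun x => x.2
    let φ : LinearMap.ker h →ₗ[𝔽] LinearMap.ker g :=
      ((LinearMap.ker (f ∘ₗ g)).subtype ∘ₗ (LinearMap.ker h).subtype).codRestrict _ h1
    refine LinearMap.finrank_le_finrank_of_injective (f := φ) fun x y hxy => ?_
    have h2 : (φ x).1 = (φ y).1 := congrArg Subtype.val hxy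
    exact Subtype.ext (Subtype.ext h2)

theorem LinearMap.finrank_ker_pow_le (f : M →ₗ[𝔽] M) (i : ℕ) :
    Module.finrank 𝔽 (LinearMap.ker (f ^ i)) ≤ i * Module.finrank 𝔽 (LinearMap.ker f) := by
  induction i with
  | zero => simp [Module.End.one_eq_id]
  | succ i ih =>
    rw [pow_succ, Module.End.mul_eq_comp, add_mul, one_mul]
    exact (LinearMap.finrank_ker_comp_le_add _ _).trans (Nat.add_le_add_right ih _)

/-- The fixed space of an operator of order `p` in characteristic `p` is large. -/
theorem LinearMap.finrank_le_mul_finrank_fixed {p : ℕ} [hp : Fact p.Prime] [CharP 𝔽 p]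
    (T : M →ₗ[𝔽] M) (hT : T ^ p = 1) :
    Module.finrank 𝔽 M ≤ p * Module.finrank 𝔽 (LinearMap.ker (T - 1)) := by
  -- By Frobenius, `(T - 1)^p = T^p - 1` in characteristic `p`. The whole space is thus the kernel
  -- of a `p`-th power, and each factor accounts for at most the dimension of the kernel of `T - 1`.
  have h1 : (T - 1) ^ p = 0 := by
    have h2 : (Polynomial.X - 1 : Polynomial 𝔽) ^ p = Polynomial.X ^ p - 1 := by
      rw [sub_pow_char, one_pow]
    have h3 := congrArg (Polynomial.aeval T) h2
    simpa [hT] using h3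
  have h4 := LinearMap.finrank_ker_pow_le (T - 1) p
  rwa [h1, LinearMap.ker_zero, finrank_top] at h4

end Algebra

namespace AugSheaf

variable {𝔽 : Type*} [Field 𝔽] {U V W K : Type*} [LinearOrder U] [LinearOrder V] [LinearOrder W]
  [LinearOrder K] {Z : SComplex U} {Y : SComplex W} {X : SComplex V} {B : SComplex K}

/-- The map `v` on vertices is a morphism of complexes over `B` that preserves dimensions. -/
structure IsOver (a : SMap X B) (b : SMap Y B) (v : W → V) : Prop where
  map_mem : ∀ y ∈ Y.faces, y.image v ∈ X.faces
  injOn : ∀ y ∈ Y.faces, Set.InjOn v y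
  image_image : ∀ y ∈ Y.faces, (y.image v).image a.toFun = y.image b.toFun

section Transport

variable (F : AugSheaf 𝔽 B) {a : SMap X B} {b : SMap Y B} {c : SMap Z B} {v : W → V} {n : ℕ}

/-- The pullback of cochains along a morphism over `B`. -/
def transport (h : IsOver a b v) (n : ℕ) : (F.pullback a).Cochain n →ₗ[𝔽] (F.pullback b).Cochain n :=
  transfer (F.pullback a) (F.pullback b) v ∅ (fun y x _ hx =>
    F.res (x := a.face x) (y := b.face y) (le_of_eq (Subtype.ext (by
      simp only [SMap.face, hx, Finset.image_empty, Finset.sdiff_empty]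
      exact h.image_image _ y.2)))) n n

variable {F}

theorem IsOver.face_le (h : IsOver a b v) {y : Y.Face} {x : X.Face} (hx : x.1 = y.1.image v) :
    a.face x ≤ b.face y := le_of_eq (Subtype.ext (by
  simp only [SMap.face, hx]
  exact h.image_image _ y.2))

theorem IsOver.le_face (h : IsOver a b v) {y : Y.Face} {x : X.Face} (hx : x.1 = y.1.image v) :
    b.face y ≤ a.face x := le_of_eq (Subtype.ext (by
  simp only [SMap.face, hx]
  exact (h.image_image _ y.2).symm))

theorem transport_apply (h : IsOver a b v) (g : (F.pullback a).Cochain n) (y : Y.CardFace n)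
    (x : X.CardFace n) (hx : x.1.1 = y.1.1.image v) :
    F.transport h n g y = transferSign v ∅ y.1.1 • F.res (h.face_le hx) (g x) :=
  transfer_apply g y x (Finset.empty_subset _) (by
    rw [hx, Finset.image_empty, Finset.sdiff_empty])

theorem coboundary_transport (h : IsOver a b v) (g : (F.pullback a).Cochain n) :
    (F.pullback b).coboundary n (F.transport h n g) =
      F.transport h (n + 1) ((F.pullback a).coboundary n g) := by
  refine coboundary_transfer h.injOn (fun y hy _ => ?_) ?_ (by simp) g
  · rw [Finset.image_empty, Finset.sdiff_empty]
    exact h.map_mem y hy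
  · intro y y' x x' hy hx _ _ h h' s
    exact (F.res_res _ _ _).trans (F.res_res _ _ _).symm

/-- The image of a face under a morphism over `B`. -/
def IsOver.cardFace (h : IsOver a b v) (y : Y.CardFace n) : X.CardFace n :=
  ⟨⟨y.1.1.image v, h.map_mem _ y.1.2⟩, by
    rw [Finset.card_image_of_injOn (h.injOn _ y.1.2)]; exact y.2⟩

theorem res_zsmul_res {x y z : B.Face} (hxy : x ≤ y) (hyz : y ≤ z) (i : ℤ) (s : F.obj x) :
    F.res hyz (i • F.res hxy s) = i • F.res (hxy.trans hyz) s := by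
  rw [map_zsmul, F.res_res]

theorem zsmul_res_zsmul_res {x y : B.Face} (hxy : x ≤ y) (hyx : y ≤ x) {i j : ℤ} (hij : i * j = 1)
    (s : F.obj x) : i • F.res hyx (j • F.res hxy s) = s := by
  rw [res_zsmul_res, smul_smul, hij, one_smul, F.res_refl]

theorem transport_transport (h : IsOver a b v) {w : U → W} (h' : IsOver b c w) {v' : U → V}
    (hv' : v' = v ∘ w) (h'' : IsOver a c v') (g : (F.pullback a).Cochain n) :
    F.transport h' n (F.transport h n g) = F.transport h'' n g := by
  subst hv'
  funext z
  have e1 := transport_apply h' (F.transport h n g) z (h'.cardFace z) rfl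
  have e2 := transport_apply h g (h'.cardFace z) (h.cardFace (h'.cardFace z)) rfl
  have e3 := transport_apply h'' g z (h.cardFace (h'.cardFace z)) (Finset.image_image ..)
  rw [e1, e2, e3, transferSign_comp (h'.injOn _ z.1.2) (h.injOn _ (h'.map_mem _ z.1.2)), ← smul_smul]
  exact congrArg _ (res_zsmul_res _ _ _ _)

theorem transport_id {v : W → W} (h : IsOver b b v) (hv : ∀ a, v a = a)
    (g : (F.pullback b).Cochain n) : F.transport h n g = g := by
  funext y
  have e1 := transport_apply h g y y (by
    rw [show v = id from funext hv, Finset.image_id])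
  rw [e1, transferSign_id fun a _ => hv a, one_smul]
  exact F.res_refl _ _

theorem transport_eq_zero (h : IsOver a b v)
    (hsurj : ∀ x ∈ X.faces, ∃ y ∈ Y.faces, y.image v = x) {g : (F.pullback a).Cochain n}
    (hg : F.transport h n g = 0) : g = 0 := by
  funext x
  obtain ⟨y, hy, hyx⟩ := hsurj x.1.1 x.1.2
  have hc : y.card = n := by
    rw [← Finset.card_image_of_injOn (h.injOn _ hy), hyx, x.2]
  have e1 := transport_apply h g ⟨⟨y, hy⟩, hc⟩ x hyx.symm
  rw [hg] at e1
  have e2 : transferSign v ∅ y • transferSign v ∅ y •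
      F.res (h.face_le (y := ⟨y, hy⟩) (x := x.1) hyx.symm) (g x) = 0 := by
    have : transferSign v ∅ y • F.res (h.face_le (y := ⟨y, hy⟩) (x := x.1) hyx.symm) (g x) = 0 :=
      e1.symm
    rw [this, smul_zero]
  rw [smul_smul, transferSign_mul_self, one_smul] at e2
  have e3 := congrArg (F.res (h.le_face (y := ⟨y, hy⟩) (x := x.1) hyx.symm)) e2
  rw [map_zero] at e3
  exact ((F.res_refl _ _).symm.trans (F.res_res _ _ _).symm).trans e3

end Transport

section Galois

variable {F : AugSheaf 𝔽 B} {a : SMap X B} {b : SMap Y B} {n p : ℕ}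

/-- Invariant cochains descend: the value at a face of the base is read off at any lift, and
transitivity on fibres together with invariance makes the choice immaterial, signs included. -/
theorem exists_transport_eq {G : Type*} {u : W → V} (h : IsOver a b u) (ρ : G → W → W)
    (hρ : ∀ g, IsOver b b (ρ g)) (hρu : ∀ g, ∀ y ∈ Y.faces, ∀ c ∈ y, u (ρ g c) = u c)
    (hsurj : ∀ x ∈ X.faces, ∃ y ∈ Y.faces, y.image u = x)
    (htrans : ∀ y ∈ Y.faces, ∀ y' ∈ Y.faces, y.Nonempty → y.image u = y'.image u →
      ∃ g, y.image (ρ g) = y') (hn : 1 ≤ n) (f : (F.pullback b).Cochain n)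
    (hf : ∀ g, F.transport (hρ g) n f = f) : ∃ g, F.transport h n g = f := by
  have key : ∀ x : X.CardFace n, ∃ s : F.obj (a.face x.1), ∀ (y : Y.CardFace n)
      (hx : x.1.1 = y.1.1.image u),
      transferSign u ∅ y.1.1 • F.res (h.face_le hx) s = f y := by
    intro x
    obtain ⟨y₀', hy₀, hyx⟩ := hsurj x.1.1 x.1.2
    have hc : y₀'.card = n := by
      rw [← Finset.card_image_of_injOn (h.injOn _ hy₀), hyx, x.2]
    set y₀ : Y.CardFace n := ⟨⟨y₀', hy₀⟩, hc⟩ with hy₀def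
    refine ⟨transferSign u ∅ y₀' • F.res (h.le_face (y := y₀.1) hyx.symm) (f y₀), fun y hx => ?_⟩
    obtain ⟨g, hg⟩ := htrans y₀' hy₀ y.1.1 y.1.2 (Finset.card_pos.1 (by omega)) (hyx.trans hx)
    have e1 := transport_apply (hρ g) f y₀ y hg.symm
    rw [hf g] at e1
    have e2 : transferSign u ∅ y₀' =
        transferSign (ρ g) ∅ y₀' * transferSign u ∅ y.1.1 := by
      rw [← hg, ← transferSign_comp ((hρ g).injOn _ hy₀) (by rw [hg]; exact h.injOn _ y.1.2)]
      exact transferSign_congr fun c hc => (hρu g _ hy₀ c hc).symm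
    have e3 : F.res (h.le_face (y := y₀.1) hyx.symm) (f y₀) = transferSign (ρ g) ∅ y₀' •
        F.res (((hρ g).face_le (y := y₀.1) hg.symm).trans (h.le_face (y := y₀.1) hyx.symm)) (f y) :=
      (congrArg (F.res (h.le_face (y := y₀.1) hyx.symm)) e1).trans (res_zsmul_res _ _ _ _)
    rw [e3, smul_smul]
    have e4 : transferSign u ∅ y.1.1 * (transferSign u ∅ y₀' * transferSign (ρ g) ∅ y₀') = 1 := by
      rw [e2]
      calc _ = (transferSign (ρ g) ∅ y₀' * transferSign (ρ g) ∅ y₀') *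
            (transferSign u ∅ y.1.1 * transferSign u ∅ y.1.1) := by ring
        _ = 1 := by rw [transferSign_mul_self, transferSign_mul_self, one_mul]
    exact zsmul_res_zsmul_res _ _ e4 _
  choose g hg using key
  refine ⟨g, ?_⟩
  funext y
  have e1 := transport_apply h g y (h.cardFace y) rfl
  rw [e1]
  exact hg _ y rfl

/-- A generator of the Galois group acts on the cocycles of `Y` with `p`-th power one, so they have
dimension at most `p` times that of the fixed ones. A fixed cocycle descends to a cochain on `X`,
which is a cocycle because transport is injective and commutes with coboundaries. -/
theorem finrank_cocycles_le [hp : Fact p.Prime] [CharP 𝔽 p] (hfin : ∀ x, Module.Finite 𝔽 (F.obj x))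
    {u : SMap Y X} (hu : u.IsGalois (Multiplicative (ZMod p))) (h : IsOver a b u.toFun)
    (hn : 1 ≤ n) : Module.finrank 𝔽 ((F.pullback b).cocycles n) ≤
      p * Module.finrank 𝔽 ((F.pullback a).cocycles n) := by
  obtain ⟨hcov, ρ, hρ1, hρ2, hρ3⟩ := hu
  have hfb : ∀ y, Module.Finite 𝔽 ((F.pullback b).obj y) := fun y => hfin (b.face y)
  have hfa : ∀ y, Module.Finite 𝔽 ((F.pullback a).obj y) := fun y => hfin (a.face y)
  have hρ : ∀ g, IsOver b b (ρ g) := fun g =>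
    ⟨hρ1 g, fun _ _ => Function.Injective.injOn (ρ g).injective, fun y hy => by
      rw [← h.image_image _ (hρ1 g y hy), hρ2 g y hy, h.image_image y hy]⟩
  have hρu : ∀ g, ∀ y ∈ Y.faces, ∀ c ∈ y, u.toFun (ρ g c) = u.toFun c := by
    intro g y hy c hc
    have := hρ2 g {c} (Y.down_closed hy (by simpa using hc))
    simpa using this
  set γ : Multiplicative (ZMod p) := Multiplicative.ofAdd 1 with hγ
  set T : Module.End 𝔽 ((F.pullback b).Cochain n) := F.transport (hρ γ) n with hT
  have hpow : ∀ (j : ℕ) (f), (T ^ j) f = F.transport (hρ (γ ^ j)) n f := by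
    intro j
    induction j with
    | zero =>
      intro f
      exact (transport_id (hρ (γ ^ 0)) (fun a => by simp) f).symm
    | succ j ih =>
      intro f
      rw [pow_succ, Module.End.mul_apply, ih]
      refine transport_transport (hρ γ) (hρ (γ ^ j)) ?_ (hρ (γ ^ (j + 1))) f
      rw [pow_succ', map_mul]
      rfl
  have hTp : T ^ p = 1 := by
    refine LinearMap.ext fun f => ?_
    rw [hpow]
    have : γ ^ p = 1 := by
      rw [hγ, ← ofAdd_nsmul]
      simp
    exact transport_id _ (fun a => by rw [this]; simp) f
  have hTZ : ∀ f ∈ (F.pullback b).cocycles n, T f ∈ (F.pullback b).cocycles n := by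
    intro f hf
    have hf' : (F.pullback b).coboundary n f = 0 := hf
    refine LinearMap.mem_ker.2 ?_
    rw [hT, coboundary_transport, hf', map_zero]
  set S := T.restrict hTZ with hS
  have hSp : S ^ p = 1 := by
    refine LinearMap.ext fun f => Subtype.ext ?_
    rw [hS, Module.End.pow_restrict]
    change (T ^ p) f.1 = f.1
    rw [hTp]
    rfl
  refine (LinearMap.finrank_le_mul_finrank_fixed S hSp).trans (Nat.mul_le_mul_left _ ?_)
  have hpull : ∀ g ∈ (F.pullback a).cocycles n, F.transport h n g ∈ (F.pullback b).cocycles n := by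
    intro g hg
    have hg' : (F.pullback a).coboundary n g = 0 := hg
    refine LinearMap.mem_ker.2 ?_
    rw [coboundary_transport, hg', map_zero]
  let φ := (F.transport h n).restrict hpull
  refine le_trans (Submodule.finrank_mono (t := LinearMap.range φ) ?_) (LinearMap.finrank_range_le φ)
  intro f hf
  have hf1 : T f.1 = f.1 := by
    have h1 : S f - f = 0 := hf
    exact congrArg Subtype.val (sub_eq_zero.1 h1)
  have hfix : ∀ g, F.transport (hρ g) n f.1 = f.1 := by
    intro g
    have hg : γ ^ (Multiplicative.toAdd g).val = g := by
      rw [hγ, ← ofAdd_nsmul]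
      simp
    have h1 : ∀ j : ℕ, (T ^ j) f.1 = f.1 := by
      intro j
      induction j with
      | zero => rfl
      | succ j ih => rw [pow_succ, Module.End.mul_apply, hf1, ih]
    have h2 := (hpow (Multiplicative.toAdd g).val f.1).symm.trans (h1 _)
    have h3 : ∀ g', g' = g → F.transport (hρ g') n f.1 = f.1 → F.transport (hρ g) n f.1 = f.1 := by
      rintro _ rfl h
      exact h
    exact h3 _ hg h2
  obtain ⟨g, hg⟩ := exists_transport_eq h (fun g => ρ g) hρ hρu (fun x hx => hcov.exists_face hx)
    (fun y hy y' hy' hne he => (hρ3 y hy y' hy' hne he).exists) hn f.1 hfix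
  have hgZ : g ∈ (F.pullback a).cocycles n := by
    refine LinearMap.mem_ker.2 (transport_eq_zero h (fun x hx => hcov.exists_face hx) ?_)
    rw [← coboundary_transport, hg]
    exact f.2
  exact ⟨⟨g, hgZ⟩, Subtype.ext hg⟩

theorem _root_.SMap.IsGalois.card_cardFace [hp : Fact p.Prime] {u : SMap Y X}
    (hu : u.IsGalois (Multiplicative (ZMod p))) (hn : 1 ≤ n) :
    Fintype.card (Y.CardFace n) = p * Fintype.card (X.CardFace n) := by
  obtain ⟨hcov, ρ, hρ1, hρ2, hρ3⟩ := hu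
  rw [SComplex.card_cardFace, SComplex.card_cardFace]
  rw [Finset.card_eq_sum_card_fiberwise (f := fun y => y.image u.toFun)
    (t := X.faces.filter fun x => x.card = n) (by
      intro y hy
      simp only [Finset.coe_filter, Set.mem_ofPred_eq] at hy ⊢
      exact ⟨u.map_mem y hy.1, (hcov.card_image hy.1).trans hy.2⟩)]
  rw [Finset.sum_const_nat (m := p), mul_comm]
  intro x hx
  rw [Finset.mem_filter] at hx
  obtain ⟨y, hy, rfl⟩ := hcov.exists_face hx.1
  have hyn : y.card = n := (hcov.card_image hy).symm.trans hx.2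
  have hne : y.Nonempty := Finset.card_pos.1 (by omega)
  have hcard : (Finset.univ : Finset (Multiplicative (ZMod p))).card = p := by
    rw [Finset.card_univ, Fintype.card_multiplicative, ZMod.card]
  rw [← hcard]
  symm
  refine Finset.card_bij (fun g _ => y.image (ρ g)) ?_ ?_ ?_
  · intro g _
    simp only [Finset.mem_filter]
    exact ⟨⟨hρ1 g y hy, by rw [Finset.card_image_of_injective _ (ρ g).injective, hyn]⟩, hρ2 g y hy⟩
  · intro g _ g' _ he
    exact (hρ3 y hy (y.image (ρ g')) (hρ1 g' y hy) hne (hρ2 g' y hy).symm).unique he rfl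
  · intro y' hy'
    simp only [Finset.mem_filter] at hy'
    obtain ⟨g, hg, -⟩ := hρ3 y hy y' hy'.1.1 hne hy'.2.symm
    exact ⟨g, Finset.mem_univ _, hg⟩

end Galois

end AugSheaf

end

/-! ### Dimension count and constant rate -/

noncomputable section

namespace AugSheaf

section Rate

variable {𝔽 : Type*} [Field 𝔽] {V : Type*} [LinearOrder V] {X : SComplex V} {k m n : ℕ}

theorem finrank_cochain {F : AugSheaf 𝔽 X} (e : F.Framing k m)
    (hfin : ∀ x, Module.Finite 𝔽 (F.obj x)) :
    Module.finrank 𝔽 (F.Cochain (k + 1)) = m * Fintype.card (X.CardFace (k + 1)) := by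
  rw [Module.finrank_pi_fintype, Finset.sum_congr rfl fun x _ => (e x).finrank_eq]
  simp [mul_comm]

/-- Rank-nullity for the coboundary, whose image consists of cocycles of the next degree. -/
theorem le_finrank_cocycles_add {F : AugSheaf 𝔽 X} (e : F.Framing k m)
    (hfin : ∀ x, Module.Finite 𝔽 (F.obj x)) :
    m * Fintype.card (X.CardFace (k + 1)) ≤
      Module.finrank 𝔽 (F.cocycles (k + 1)) + Module.finrank 𝔽 (F.cocycles (k + 2)) := by
  rw [← finrank_cochain e hfin, ← LinearMap.finrank_range_add_finrank_ker (F.coboundary (k + 1)),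
    add_comm]
  refine Nat.add_le_add_left (Submodule.finrank_mono ?_) _
  rintro _ ⟨f, rfl⟩
  exact F.coboundary_coboundary f

/-- `dim Z^{k+1} = h^{k+1} + dim B^{k+1} < h^k + dim B^{k+1} ≤ dim Z^k + dim B^{k+1} = dim C^k`. -/
theorem finrank_cocycles_lt {F : AugSheaf 𝔽 X} (e : F.Framing k m)
    (hfin : ∀ x, Module.Finite 𝔽 (F.obj x))
    (h : F.cohomologyDim (k + 2) < F.cohomologyDim (k + 1)) :
    Module.finrank 𝔽 (F.cocycles (k + 2)) < m * Fintype.card (X.CardFace (k + 1)) := by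
  have h1 : F.cohomologyDim (k + 1) ≤ Module.finrank 𝔽 (F.cocycles (k + 1)) :=
    Submodule.finrank_quotient_le _
  have h2 := Submodule.finrank_quotient_add_finrank
    ((F.coboundaries (k + 2)).submoduleOf (F.cocycles (k + 2)))
  have h3 : Module.finrank 𝔽 ((F.coboundaries (k + 2)).submoduleOf (F.cocycles (k + 2))) =
      Module.finrank 𝔽 (LinearMap.range (F.coboundary (k + 1))) := by
    refine (Submodule.submoduleOfEquivOfLe ?_).finrank_eq
    rintro _ ⟨f, rfl⟩
    exact F.coboundary_coboundary f
  have h4 := LinearMap.finrank_range_add_finrank_ker (F.coboundary (k + 1))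
  rw [finrank_cochain e hfin] at h4
  have h5 : Module.finrank 𝔽 (LinearMap.ker (F.coboundary (k + 1))) =
      Module.finrank 𝔽 (F.cocycles (k + 1)) := rfl
  rw [h3] at h2
  unfold cohomologyDim at h h1
  omega

/-- Level `0` of the tower carries the pullback along the identity, whose sections at a face are
taken at its image under the identity and not literally at the face. A transfer with trivial signs
compares the two sheaves. -/
theorem finrank_cocycles_pullback_id_le {F : AugSheaf 𝔽 X}
    (hfin : ∀ x, Module.Finite 𝔽 (F.obj x)) :
    Module.finrank 𝔽 ((F.pullback (SMap.id X)).cocycles n) ≤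
      Module.finrank 𝔽 (F.cocycles n) := by
  have hface : ∀ (y x : X.Face), x.1 = y.1.image _root_.id \ (∅ : Finset V).image _root_.id →
      (SMap.id X).face x ≤ y ∧ y ≤ (SMap.id X).face x := by
    intro y x hx
    have : (SMap.id X).face x = y := Subtype.ext (by
      simp only [SMap.face, SMap.id, hx, Finset.image_id, Finset.image_empty, Finset.sdiff_empty,
        Finset.image_id'])
    exact ⟨this.le, this.ge⟩
  let θ : ∀ (y x : X.Face), ∅ ⊆ y.1 → x.1 = y.1.image _root_.id \ (∅ : Finset V).image _root_.id →
      ((F.pullback (SMap.id X)).obj x →ₗ[𝔽] F.obj y) := fun y x _ hx =>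
    F.res (x := (SMap.id X).face x) (y := y) (hface y x hx).1
  let T : ∀ n, (F.pullback (SMap.id X)).Cochain n →ₗ[𝔽] F.Cochain n := fun n =>
    transfer (F.pullback (SMap.id X)) F _root_.id ∅ θ n n
  have himg : ∀ y : Finset V, y = y.image _root_.id \ (∅ : Finset V).image _root_.id := by
    intro y
    rw [Finset.image_id, Finset.image_empty, Finset.sdiff_empty]
  have hT : ∀ n g, F.coboundary n (T n g) = T (n + 1) ((F.pullback (SMap.id X)).coboundary n g) := by
    intro n g
    refine coboundary_transfer (fun y _ => Function.injective_id.injOn) (fun y hy _ => ?_) ?_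
      (by simp) g
    · rw [← himg]; exact hy
    · intro y y' x x' hy hx _ _ h h' s
      exact (F.res_res _ _ _).trans (F.res_res _ _ _).symm
  have hinj : Function.Injective (T n) := by
    rw [← LinearMap.ker_eq_bot, LinearMap.ker_eq_bot']
    intro g hg
    funext x
    have e1 : T n g x = transferSign _root_.id ∅ x.1.1 •
      F.res (x := (SMap.id X).face x.1) (y := x.1) (hface x.1 x.1 (himg _)).1 (g x) :=
        transfer_apply g x x (Finset.empty_subset _) (himg _)
    have hs : transferSign _root_.id ∅ x.1.1 = 1 := transferSign_id fun _ _ => rfl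
    rw [hg, hs, one_smul] at e1
    have e2 := congrArg (F.res (hface x.1 x.1 (himg _)).2) e1
    exact ((F.res_refl _ _).symm.trans (F.res_res _ _ _).symm).trans (e2.symm.trans (map_zero _))
  have hZ : ∀ g ∈ (F.pullback (SMap.id X)).cocycles n, T n g ∈ F.cocycles n := by
    intro g hg
    have hg' : (F.pullback (SMap.id X)).coboundary n g = 0 := hg
    refine LinearMap.mem_ker.2 ?_
    rw [hT, hg', map_zero]
  refine LinearMap.finrank_le_finrank_of_injective (f := (T n).restrict hZ) fun f g hfg => ?_
  have h1 : T n f.1 = T n g.1 := congrArg Subtype.val hfg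
  exact Subtype.ext (hinj h1)

theorem codeRate_cocycleCode [Finite 𝔽] {F : AugSheaf 𝔽 X} (e : F.Framing k m) (hm : 1 ≤ m)
    (hfin : ∀ x, Module.Finite 𝔽 (F.obj x)) : codeRate (cocycleCode e) =
      Module.finrank 𝔽 (F.cocycles (k + 1)) / (m * Fintype.card (X.CardFace (k + 1))) := by
  have h1 : Nat.card (cocycleCode e) = Nat.card 𝔽 ^ Module.finrank 𝔽 (F.cocycles (k + 1)) := by
    rw [← Module.natCard_eq_pow_finrank]
    refine Nat.card_congr ⟨fun f => ⟨toCochain e f.1, f.2⟩, fun f => ⟨ofCochain e f.1, ?_⟩,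
      fun f => Subtype.ext (ofCochain_toCochain e f.1),
      fun f => Subtype.ext (toCochain_ofCochain e f.1)⟩
    rw [mem_cocycleCode, toCochain_ofCochain]
    exact f.2
  have h2 : Nat.card (Fin m → 𝔽) = Nat.card 𝔽 ^ m := by
    rw [Module.natCard_eq_pow_finrank (K := 𝔽), Module.finrank_fin_fun]
  have hq : 1 < Nat.card 𝔽 := Finite.one_lt_card
  have hlog : 0 < Real.log (Nat.card 𝔽) := Real.log_pos (by exact_mod_cast hq)
  have hm0 : (0 : ℝ) < m := by exact_mod_cast hm
  unfold codeRate
  rw [h1, h2, Real.logb]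
  push_cast
  rw [Real.log_pow, Real.log_pow, mul_div_mul_right _ _ hlog.ne', div_div]

/-- With `n` faces of dimension `k` on the base, `dim Z^k(X_r) ≥ p^r m n - dim Z^{k+1}(X_r) ≥ p^r (m
n - dim Z^{k+1}(X))`. The last bracket is a positive integer, hence at least `1`; dividing by `dim
C^k(X_r) = p^r m n` gives the rate `1 / (m n)`. -/
theorem exists_le_codeRate [Finite 𝔽] {p d : ℕ} (hp : p.Prime) [CharP 𝔽 p] (hk : k ≤ d)
    (hm : 1 ≤ m) {V : ℕ → Type*} [∀ r, LinearOrder (V r)]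
    {X : ∀ r, SComplex (V r)} (u : ∀ r, SMap (X (r + 1)) (X r))
    (hpure : (X 0).IsPure d) (hgal : ∀ r, (u r).IsGalois (Multiplicative (ZMod p)))
    {F : AugSheaf 𝔽 (X 0)} (hfin : ∀ x, Module.Finite 𝔽 (F.obj x))
    (e : F.Framing k m)
    (h : F.cohomologyDim (k + 2) < F.cohomologyDim (k + 1)) :
    ∃ ρ : ℝ, 0 < ρ ∧ ∀ r, ρ ≤ codeRate
      (cocycleCode (towerFraming e u (fun r => (hgal r).1) r)) := by
  have := Fact.mk hp
  have hcov : ∀ r, (u r).IsCovering := fun r => (hgal r).1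
  have hcard : ∀ r, Fintype.card ((X r).CardFace (k + 1)) =
      p ^ r * Fintype.card ((X 0).CardFace (k + 1)) := by
    intro r
    induction r with
    | zero => rw [pow_zero, one_mul]
    | succ r ih => rw [(hgal r).card_cardFace (by omega), ih, pow_succ']; ring
  have hover : ∀ r, IsOver (towerMap u r) (towerMap u (r + 1)) (u r).toFun := fun r =>
    ⟨(u r).map_mem, fun y hy => (hcov r).injOn hy, fun y _ => Finset.image_image⟩
  have hZ : ∀ r, Module.finrank 𝔽 ((F.pullback (towerMap u r)).cocycles (k + 2)) ≤
      p ^ r * Module.finrank 𝔽 (F.cocycles (k + 2)) := by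
    intro r
    induction r with
    | zero =>
      rw [pow_zero, one_mul]
      exact finrank_cocycles_pullback_id_le hfin
    | succ r ih =>
      refine (finrank_cocycles_le hfin (hgal r) (hover r) (by omega)).trans ?_
      rw [pow_succ', mul_assoc]
      exact Nat.mul_le_mul_left _ ih
  have h0 := finrank_cocycles_lt e hfin h
  set n := Fintype.card ((X 0).CardFace (k + 1)) with hn
  have hn0 : (0 : ℝ) < n := by
    have := SComplex.cardFace_nonempty hpure (show k + 1 ≤ d + 1 by omega)
    exact_mod_cast Fintype.card_pos
  have hm0 : (0 : ℝ) < m := by exact_mod_cast hm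
  have hp0 : (0 : ℝ) < p := by exact_mod_cast hp.pos
  refine ⟨1 / (m * n), by positivity, fun r => ?_⟩
  have hfr : ∀ x, Module.Finite 𝔽 ((F.pullback (towerMap u r)).obj x) := fun x =>
    hfin ((towerMap u r).face x)
  rw [codeRate_cocycleCode _ hm hfr, hcard r]
  have h1 := le_finrank_cocycles_add (towerFraming e u hcov r) hfr
  rw [hcard r] at h1
  have h2 : p ^ r * (Module.finrank 𝔽 (F.cocycles (k + 2)) + 1) ≤ p ^ r * (m * n) :=
    Nat.mul_le_mul_left _ h0
  have h3 : p ^ r ≤ Module.finrank 𝔽 ((F.pullback (towerMap u r)).cocycles (k + 1)) := by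
    have h4 := hZ r
    have h5 : m * (p ^ r * n) = p ^ r * (m * n) := by ring
    rw [h5] at h1
    rw [mul_add, mul_one] at h2
    omega
  have h3' : (p : ℝ) ^ r ≤ Module.finrank 𝔽 ((F.pullback (towerMap u r)).cocycles (k + 1)) := by
    exact_mod_cast h3
  push_cast
  rw [div_le_div_iff₀ (by positivity) (by positivity)]
  calc 1 * ((m : ℝ) * (p ^ r * n)) = p ^ r * (m * n) := by ring
    _ ≤ _ := by gcongr

end Rate

end AugSheaf

end

theorem mainTheorem3 {p : ℕ} (hp : p.Prime) {𝔽 : Type*} [Field 𝔽] [Finite 𝔽] [CharP 𝔽 p]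
    {d k m : ℕ} (hk : k + 2 ≤ d) (hm : 1 ≤ m)
    {V : ℕ → Type*} [∀ r, LinearOrder (V r)]
    (X : ∀ r, SComplex (V r)) (u : ∀ r, SMap (X (r + 1)) (X r))
    (hpure : (X 0).IsPure d) (hstrong : (X 0).IsStronglyConnected d)
    (hconn : ∀ r, (X r).IsConnected)
    (hgal : ∀ r, (u r).IsGalois (Multiplicative (ZMod p)))
    (F : AugSheaf 𝔽 (X 0)) (hF : F.IsSheaf) (hfin : ∀ x, Module.Finite 𝔽 (F.obj x))
    (e : F.Framing k m) (hB : F.coboundaries (k + 1) = ⊥)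
    (hne : ∀ x : (X 0).Face, x.1.card = k + 2 ∨ x.1.card = k + 3 → Nontrivial (F.obj x)) :
    (F.HasLocalExpansion d k →
      (∃ μ : ℝ, 0 < μ ∧ ∀ r,
        IsTestable (AugSheaf.cocycleCode (AugSheaf.towerFraming e u (fun r => (hgal r).1) r))
          (AugSheaf.cocycleTester (AugSheaf.towerFraming e u (fun r => (hgal r).1) r)) (k + 2) μ) ∧
      (∃ δ : ℝ, 0 < δ ∧ ∀ r,
        HasRelDistance
          (AugSheaf.cocycleCode (AugSheaf.towerFraming e u (fun r => (hgal r).1) r)) δ) ∧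
      (∃ η : ℝ, 0 < η ∧ LinearTimeDecodable
        (fun r => AugSheaf.cocycleCode (AugSheaf.towerFraming e u (fun r => (hgal r).1) r)) η)) ∧
    (F.cohomologyDim (k + 2) < F.cohomologyDim (k + 1) →
      ∃ ρ : ℝ, 0 < ρ ∧ ∀ r, ρ ≤ codeRate
        (AugSheaf.cocycleCode (AugSheaf.towerFraming e u (fun r => (hgal r).1) r))) := by
  refine ⟨fun h => ?_, fun h => ?_⟩
  · exact AugSheaf.testable_distance_decodable hk hm u hpure hstrong hconn
      (fun r => (hgal r).1) e hB hne h
  · exact AugSheaf.exists_le_codeRate hp (by omega) hm u hpure hgal hfin e h
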